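/- **Setting.** Let $A\ge 1$, $d=A+2$, and write $\boldsymbol\nu=(\underline m,n_1,n_2)\in\mathbb Z^A\times\mathbb Z\times\mathbb Z=\mathbb Z^d$, $|\boldsymbol\nu|$ for the $\ell^1$-norm, and $\boldsymbol\omega=(\underline\omega_1,\omega_0,\Omega_0)\in\mathbb R^d$. Consider $\ddot\phi+(p_0(t)+\varepsilon p_1(t))\phi=0$, where $p_0:\mathbb R\to\mathbb R$ is real analytic with period $2\pi/\omega_0$; $p_1(t)=P_1(\underline\omega_1t)$ with $P_1:\mathbb R^A\to\mathbb R$ real analytic and $2\pi$-periodic in each variable; and let $\phi_0\not\equiv0$ be an analytic solution of $\ddot\phi_0+p_0\phi_0=0$ such that $e^{-i\Omega_0t}\phi_0(t)$ has period $2\pi/\omega_0$. Assume $|\boldsymbol\omega\cdot\boldsymbol\nu|\ge C_0|\boldsymbol\nu|^{-\tau}$ for all $\boldsymbol\nu\in\mathbb Z^d\setminus\{0\}$, with $C_0>0$ and $\tau>d-1$. Let $Q_{\boldsymbol\nu},R_{\boldsymbol\nu}$ be the Fourier coefficients of $Q=\phi_0^{-2}=\sum_{\boldsymbol\nu} Q_{\boldsymbol\nu}e^{i\boldsymbol\omega\cdot\boldsymbol\nu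 t}$ and $R=p_1\phi_0^2=\sum_{\boldsymbol\nu} R_{\boldsymbol\nu}e^{i\boldsymbol\omega\cdot\boldsymbol\nu t}$ (so $Q_{\boldsymbol\nu}\ne0$ only if $\underline m=0$, $n_2=-2$, and $R_{\boldsymbol\nu}\neq 0$ only if $n_2=2$). Let $0<C_1<C_0$ and $\tau_1>\tau$, let $\psi\in C^\infty(\mathbb R)$ be non-decreasing with $\psi=1$ on $[C_1,\infty)$ and $\psi=0$ on $(-\infty,C_1/2]$, and put $\chi=1-\psi$, $\psi_n(y)=\psi(2^ny)$, $\chi_n(y)=\chi(2^ny)$. Fix $n_0\in\mathbb Z_{\ge0}$ and $\varepsilon\in\mathbb R$. **Trees.** A tree is a planar rooted binary tree, in which every vertex has two (ordered) entering lines. Endpoints (black bullets) carry a mode $\boldsymbol\nu_v\ne0$ and a factor $F_v=R_{\boldsymbol\nu_v}$, vertices carry a mode $\boldsymbol\nu_v\in\mathbb Z^d$ and a factor $F_v=Q_{\boldsymbol\nu_v}$. The line $\ell$ leaving a node $v$ carries a scale $n_\ell\ge n_0$ and the momentum $\boldsymbol\nu_\ell\neq0$ which is the sum of the modes of $v$ and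 of all nodes preceding it. The order is the number of vertices. A cluster on scale $n$ is a maximal connected set of nodes and lines all of whose lines have scale $\le n$, at least one having scale $n$; its external lines are those entering it and the one, if any, leaving it. A self-energy graph is a cluster $T$ with exactly one entering and one exiting line and with $\sum_{v\in T}\boldsymbol\nu_v=0$. Let $\Theta^{\mathcal R}_{k,\boldsymbol\nu}$ be the set of trees of order $k$ and root momentum $\boldsymbol\nu$ without self-energy graphs, and $\mathcal S^{\mathcal R}_{k,n}$ the set of self-energy graphs with $k$ vertices and maximal scale $n$ which contain no other self-energy graph. For a line $\ell$ of $T\in\mathcal S^{\mathcal R}_{k,n}$ put $x_\ell=\boldsymbol\omega\cdot\boldsymbol\nu^0_\ell+\sigma_\ell x$, where $\boldsymbol\nu^0_\ell$ is the sum of the modes of the nodes of $T$ preceding $\ell$, and $\sigma_\ell=1$ if $\ell$ lies on the path joining the two external lines, $\sigma_\ell=0$ otherwise. **Renormalized propagators.** For $x\in\mathbb R$ define recursively $\mathcal M^{[n_0-1]}=0$ and, for $n\ge n_0$, $$\Xi_n(x)=\prod_{j=n_0}^{n}\chi_j\big(|ix-\mathcal M^{[j-1]}(x;\varepsilon)|\big),\qquad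 g^{[n]}(x;\varepsilon)=\frac{\Xi_{n-1}(x)\,\psi_n(|ix-\mathcal M^{[n-1]}(x;\varepsilon)|)}{ix-\mathcal M^{[n-1]}(x;\varepsilon)}\quad(\Xi_{n_0-1}=1),$$ $$M^{[n]}(x;\varepsilon)=\sum_{k\ge1}\sum_{T\in\mathcal S^{\mathcal R}_{k,n}}\mathcal V_T(x;\varepsilon),\quad \mathcal V_T(x;\varepsilon)=\varepsilon^{k}\prod_{\ell\in T}g^{[n_\ell]}(x_\ell;\varepsilon)\prod_{v\in T}F_v,\qquad \mathcal M^{[n]}=\mathcal M^{[n-1]}+\Xi_nM^{[n]}$$ (the products in $\mathcal V_T$ do not include the external lines). Put $u^{[k]}_{\boldsymbol0}=0$ and, for $\boldsymbol\nu\ne0$, $$u^{[k]}_{\boldsymbol\nu}=\sum_{\theta\in\Theta^{\mathcal R}_{k,\boldsymbol\nu}}\ \prod_{\ell\in\theta}g^{[n_\ell]}(\boldsymbol\omega\cdot\boldsymbol\nu_\ell;\varepsilon)\prod_{v\in\theta}F_v ,\qquad \bar u(t)=\sum_{k\ge0}\varepsilon^k\sum_{\boldsymbol\nu\in\mathbb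 Z^d}e^{i\boldsymbol\omega\cdot\boldsymbol\nu t}u^{[k]}_{\boldsymbol\nu}.$$ Let $\mathcal E_*$ (which depends on $n_0$) be the set of $\varepsilon\in\mathbb R$ with $|i\boldsymbol\omega\cdot\boldsymbol\nu-\mathcal M^{[n]}(\boldsymbol\omega\cdot\boldsymbol\nu;\varepsilon)|\ge C_1|\boldsymbol\nu|^{-\tau_1}$ for all $\boldsymbol\nu\in\mathbb Z^d\setminus\{0\}$ and all $n\ge n_0$. **Proposition.** There is a constant $c_*$ such that for all $c_1>0$ and $c_2\ge0$, with $c_1\ge c_*$ in case $c_2=0$, the following holds for all sufficiently small $\varepsilon_0>0$ and all integers $m\ge0$. Put $\varepsilon_m=2^{-m}\varepsilon_0$, $\mathcal E_m=(\varepsilon_m/2,\varepsilon_m]$, let $n_0$ be $\tau_1\log_2(c_1+c_2\log(2/\varepsilon_m))$ rounded up to a non-negative integer, and suppose that $\mathcal E^{[\infty]}=\mathcal E_*\cap\mathcal E_m$ has non-zero Lebesgue measure. Then for every $\varepsilon\in\mathcal E^{[\infty]}$: 1. for all $n\ge n_0$ and all $x\in\mathbb R$ with $\Xi_n(x)\ne0$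 the sum defining $M^{[n]}(x;\varepsilon)$ converges absolutely, and for all $n\ge n_0$ and all $x\in\mathbb R$ one has $|g^{[n]}(x;\varepsilon)|\le C_1^{-1}2^{n+1}$; in particular $|g^{[n_\ell]}_\ell|\le C_1^{-1}2^{n_\ell+1}$ for all lines $\ell$ of all trees and self-energy graphs; 2. the sums over trees defining the $u^{[k]}_{\boldsymbol\nu}$ converge absolutely, $\sum_{k,\boldsymbol\nu}|\varepsilon^ku^{[k]}_{\boldsymbol\nu}|<\infty$, and the series defining $\bar u(t)$ converges uniformly in $t\in\mathbb R$ to a function which is analytic in $t$. -/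

import Mathlib

open MeasureTheory Filter

noncomputable section

namespace HillRen

/-! ### Modes and the unperturbed data -/

/-- Fourier modes `ν = (m, n₁, n₂) ∈ ℤ^A × ℤ × ℤ = ℤ^d`, with `d = A + 2`. -/
abbrev Mode (A : ℕ) : Type := (Fin A → ℤ) × ℤ × ℤ

/-- The `ℓ¹`-norm `|ν|` on `ℤ^d`. -/
def Mode.l1 {A : ℕ} (ν : Mode A) : ℝ :=
  ∑ i, |(ν.1 i : ℝ)| + |(ν.2.1 : ℝ)| + |(ν.2.2 : ℝ)|

/-- The data of the perturbed Hill equation `φ'' + (p₀(t) + ε p₁(t)) φ = 0`: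
* `p₀` is real analytic and periodic with frequency `ω₀`;
* `p₁(t) = P₁(ω₁ t)` is quasi-periodic with frequency vector `ω₁ ∈ ℝ^A`, where `P₁` is a real
  analytic function on `ℝ^A` which is `2π`-periodic in each argument;
* `φ₀` is a nontrivial analytic quasi-periodic solution of the unperturbed equation
  `φ'' + p₀(t) φ = 0` with rotation vector `(ω₀, Ω₀)`, that is, `exp(-i Ω₀ t) φ₀(t)` is periodic
  with frequency `ω₀`. -/
structure HillData (A : ℕ) where
  ω₁ : Fin A → ℝ
  ω₀ : ℝ
  Ω₀ : ℝ
  p₀ : ℝ → ℝ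
  p₀_analytic : AnalyticOnNhd ℝ p₀ Set.univ
  p₀_periodic : Function.Periodic p₀ (2 * Real.pi / ω₀)
  P₁ : (Fin A → ℝ) → ℝ
  P₁_analytic : AnalyticOnNhd ℝ P₁ Set.univ
  P₁_periodic : ∀ (α : Fin A → ℝ) (i : Fin A),
    P₁ (Function.update α i (α i + 2 * Real.pi)) = P₁ α
  φ₀ : ℝ → ℂ
  φ₀_analytic : AnalyticOnNhd ℝ φ₀ Set.univ
  φ₀_nontrivial : ∃ t, φ₀ t ≠ 0
  φ₀_hill : ∀ t, deriv (deriv φ₀) t + (p₀ t : ℂ) * φ₀ t = 0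
  φ₀_floquet : Function.Periodic (fun t : ℝ => Complex.exp (-(Complex.I * Ω₀ * t)) * φ₀ t)
    (2 * Real.pi / ω₀)

namespace HillData

variable {A : ℕ} (H : HillData A)

/-- `ω · ν = m · ω₁ + n₁ ω₀ + n₂ Ω₀`, where `ω = (ω₁, ω₀, Ω₀)`. -/
def freq (ν : Mode A) : ℝ :=
  ∑ i, (ν.1 i : ℝ) * H.ω₁ i + (ν.2.1 : ℝ) * H.ω₀ + (ν.2.2 : ℝ) * H.Ω₀

/-- The Diophantine condition `|ω · ν| ≥ C₀ |ν|^{-τ}` for all `ν ≠ 0`. -/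
def IsDiophantine (C₀ τ : ℝ) : Prop :=
  ∀ ν : Mode A, ν ≠ 0 → C₀ * ν.l1 ^ (-τ) ≤ |H.freq ν|

/-- The Fourier coefficients of `p₁`:
`P_m = (2π)^{-A} ∫_{[0,2π]^A} P₁(α) exp(-i m · α) dα`. -/
def p₁Coeff (m : Fin A → ℤ) : ℂ :=
  ((2 * Real.pi : ℝ) : ℂ)⁻¹ ^ A *
    ∫ α in Set.Icc (0 : Fin A → ℝ) (fun _ => 2 * Real.pi),
      (H.P₁ α : ℂ) * Complex.exp (-(Complex.I * ∑ i, (m i : ℂ) * (α i : ℂ)))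

/-- The Fourier coefficients of `φ₀^a` for `a = 2` and `a = -2`:
`φ₀(t)^a = ∑ₙ F_n exp(i (n ω₀ + a Ω₀) t)`. -/
def φ₀Coeff (a : ℤ) (n : ℤ) : ℂ :=
  ((H.ω₀ / (2 * Real.pi) : ℝ) : ℂ) *
    ∫ t in (0 : ℝ)..(2 * Real.pi / H.ω₀),
      (H.φ₀ t) ^ a * Complex.exp (-(Complex.I * ((n * H.ω₀ + a * H.Ω₀ : ℝ) : ℂ) * t))

/-- The Fourier coefficients of `Q = φ₀⁻²`. -/
def Q (ν : Mode A) : ℂ :=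
  if ν.1 = 0 ∧ ν.2.2 = -2 then H.φ₀Coeff (-2) ν.2.1 else 0

/-- The Fourier coefficients of `R = p₁ φ₀²`. -/
def R (ν : Mode A) : ℂ :=
  if ν.2.2 = 2 then H.p₁Coeff ν.1 * H.φ₀Coeff 2 ν.2.1 else 0

end HillData

/-! ### Labelled trees, clusters and self-energy graphs -/

/-- Planar binary trees with labels.  A line is identified with the node it leaves; the second
label of a node is the scale of that line.
* `ent` is an entering external line: it carries neither a node nor a propagator.  It occurs only
  in subgraphs of a tree, never in a tree.
* `bullet ν n` is a black bullet with mode `ν`, whose exiting line is on scale `n`.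
* `vertex ν n l r` is a vertex with mode `ν`, whose exiting line is on scale `n`, entered by the
  root lines of `l` and `r`. -/
inductive LTree (A : ℕ) : Type
  | ent : LTree A
  | bullet (ν : Mode A) (n : ℕ) : LTree A
  | vertex (ν : Mode A) (n : ℕ) (l r : LTree A) : LTree A

namespace LTree

variable {A : ℕ}

/-- The number of entering external lines. -/
def numEnt : LTree A → ℕ
  | ent => 1
  | bullet _ _ => 0
  | vertex _ _ l r => l.numEnt + r.numEnt

/-- The number of vertices. -/
def order : LTree A → ℕ
  | ent => 0
  | bullet _ _ => 0
  | vertex _ _ l r => 1 + l.order + r.order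

/-- The sum of the modes of all bullets and vertices.  If there is no entering external line, it is
the momentum flowing through the root line. -/
def modeSum : LTree A → Mode A
  | ent => 0
  | bullet ν _ => ν
  | vertex ν _ l r => ν + l.modeSum + r.modeSum

/-- The set of the scales of all lines (the root line included, entering external lines not). -/
def scales : LTree A → Finset ℕ
  | ent => ∅
  | bullet _ n => {n}
  | vertex _ n l r => insert n (l.scales ∪ r.scales)

/-- Every line along which no entering external line is transported has nonzero momentum
(in particular the modes of the black bullets are nonzero). -/
def NonzeroMomenta : LTree A → Prop
  | ent => True
  | bullet ν _ => ν ≠ 0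
  | vertex ν _ l r => (l.numEnt + r.numEnt = 0 → ν + l.modeSum + r.modeSum ≠ 0) ∧
      l.NonzeroMomenta ∧ r.NonzeroMomenta

/-- Cut all lines on scale larger than `n` and keep the component of the root line: the topmost
lines on scale larger than `n` become entering external lines. -/
def cut (n : ℕ) : LTree A → LTree A
  | ent => ent
  | bullet ν s => if s ≤ n then bullet ν s else ent
  | vertex ν s l r => if s ≤ n then vertex ν s (l.cut n) (r.cut n) else ent

/-- `x_ℓ = x_ℓ⁰ + σ_ℓ x` for the root line `ℓ`, where `x = ω · ν` for the momentum `ν` of the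
entering external line; it equals `ω · ν_ℓ` if there is no entering external line. -/
def arg (H : HillData A) (x : ℝ) : LTree A → ℝ
  | ent => x
  | bullet ν _ => H.freq ν
  | vertex ν _ l r => H.freq ν + l.arg H x + r.arg H x

/-- The product of the propagators `g n_ℓ x_ℓ` of all lines and of all node factors. -/
def value (H : HillData A) (g : ℕ → ℝ → ℂ) (x : ℝ) : LTree A → ℂ
  | ent => 1
  | bullet ν n => g n (H.freq ν) * H.R ν
  | vertex ν n l r => g n ((vertex ν n l r).arg H x) * H.Q ν * l.value H g x * r.value H g x

end LTree

/-- A connected subgraph with an exiting external line: its topmost node is a vertex with mode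
`mode`, entered by the root lines of `left` and `right`; the line exiting the topmost vertex does
not belong to the subgraph. -/
structure Subgraph (A : ℕ) where
  mode : Mode A
  left : LTree A
  right : LTree A

namespace Subgraph

variable {A : ℕ} (T : Subgraph A)

/-- The order `k_T`, that is, the number of vertices of `T`. -/
def order : ℕ := 1 + T.left.order + T.right.order

/-- The scales of the lines in `L(T)`. -/
def scales : Finset ℕ := T.left.scales ∪ T.right.scales

/-- The maximal connected subgraph with the same topmost vertex and lines on scales `≤ n`. -/
def cut (n : ℕ) : Subgraph A := ⟨T.mode, T.left.cut n, T.right.cut n⟩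

/-- All lines in `T` are on scales `≤ n`, at least one is on scale `n`, there is exactly one
entering line, and the momentum of `T` vanishes.  For a subgraph all of whose external lines are on
scales larger than `n` (so that it is a cluster on scale `n`), this says that it is a
self-energy graph. -/
def IsSelfEnergyOn (n : ℕ) : Prop :=
  (∀ s ∈ T.scales, s ≤ n) ∧ n ∈ T.scales ∧ T.left.numEnt + T.right.numEnt = 1 ∧
    T.mode + T.left.modeSum + T.right.modeSum = 0

/-- The self-energy value
`ε^{k_T} (∏_{ℓ ∈ L(T)} g n_ℓ x_ℓ) (∏_{v ∈ B(T)} F_v)`. -/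
def value (H : HillData A) (g : ℕ → ℝ → ℂ) (ε x : ℝ) : ℂ :=
  (ε : ℂ) ^ T.order * (H.Q T.mode * T.left.value H g x * T.right.value H g x)

end Subgraph

/-- The tree contains a self-energy graph.  The clusters with an exiting line are the following:
take a vertex whose exiting line is on a scale `s`, take `n < s`, and let the cluster on scale `n`
consist of what is reached from the vertex, against the orientation, through lines on scales
`≤ n`. -/
def LTree.ContainsSelfEnergy {A : ℕ} : LTree A → Prop
  | .ent => False
  | .bullet _ _ => False
  | .vertex ν s l r => (∃ n < s, ((⟨ν, l, r⟩ : Subgraph A).cut n).IsSelfEnergyOn n) ∨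
      l.ContainsSelfEnergy ∨ r.ContainsSelfEnergy

/-- The set `Θ^R_{k,ν}` of renormalized trees of order `k` and momentum `ν`: the lines are on scales
`≥ n₀` and carry nonzero momenta, and there are no self-energy graphs. -/
def renTrees (A n₀ k : ℕ) (ν : Mode A) : Set (LTree A) :=
  {θ | θ.numEnt = 0 ∧ θ.order = k ∧ θ.modeSum = ν ∧ θ.NonzeroMomenta ∧
    (∀ s ∈ θ.scales, n₀ ≤ s) ∧ ¬ θ.ContainsSelfEnergy}

/-- The set `S^R_{k,n}` of self-energy graphs of order `k` with maximal scale `n` (the two external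
lines being on scales larger than `n`) which do not contain any other self-energy graph. -/
def renSelfEnergies (A n₀ k n : ℕ) : Set (Subgraph A) :=
  {T | T.IsSelfEnergyOn n ∧ T.order = k ∧ T.left.NonzeroMomenta ∧ T.right.NonzeroMomenta ∧
    (∀ s ∈ T.scales, n₀ ≤ s) ∧ (∀ j < n, ¬ (T.cut j).IsSelfEnergyOn j) ∧
    ¬ T.left.ContainsSelfEnergy ∧ ¬ T.right.ContainsSelfEnergy}

/-! ### Renormalized propagators -/

/-- The cutoff function: smooth, non-decreasing, `1` on `[C₁, ∞)` and `0` on `(-∞, C₁/2]`. -/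
structure IsCutoff (C₁ : ℝ) (ψ : ℝ → ℝ) : Prop where
  smooth : ContDiff ℝ (⊤ : ℕ∞) ψ
  mono : Monotone ψ
  eq_one : ∀ x, C₁ ≤ x → ψ x = 1
  eq_zero : ∀ x, x ≤ C₁ / 2 → ψ x = 0

/-- `ψ_n(y) = ψ(2^n y)`. -/
def psiN (ψ : ℝ → ℝ) (n : ℕ) (y : ℝ) : ℝ := ψ (2 ^ n * y)

/-- `χ_n(y) = χ(2^n y)`, where `χ = 1 - ψ`. -/
def chiN (ψ : ℝ → ℝ) (n : ℕ) (y : ℝ) : ℝ := 1 - ψ (2 ^ n * y)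

section Of

/-! In this section `K n` stands for the function `x ↦ 𝓜^{[n-1]}(x)`. -/

/-- `Ξ_n(x) = ∏_{i=n₀}^{n} χ_i(|i x - 𝓜^{[i-1]}(x)|)`. -/
def XiOf (ψ : ℝ → ℝ) (n₀ : ℕ) (K : ℕ → ℝ → ℂ) (n : ℕ) (x : ℝ) : ℝ :=
  ∏ i ∈ Finset.Icc n₀ n, chiN ψ i ‖Complex.I * x - K i x‖

/-- `Ψ_n(x) = (∏_{i=n₀}^{n-1} χ_i(|i x - 𝓜^{[i-1]}(x)|)) ψ_n(|i x - 𝓜^{[n-1]}(x)|)`. -/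
def PsiOf (ψ : ℝ → ℝ) (n₀ : ℕ) (K : ℕ → ℝ → ℂ) (n : ℕ) (x : ℝ) : ℝ :=
  (∏ i ∈ Finset.Ico n₀ n, chiN ψ i ‖Complex.I * x - K i x‖) *
    psiN ψ n ‖Complex.I * x - K n x‖

/-- `g^{[n]}(x) = Ψ_n(x) / (i x - 𝓜^{[n-1]}(x))`. -/
def propOf (ψ : ℝ → ℝ) (n₀ : ℕ) (K : ℕ → ℝ → ℂ) (n : ℕ) (x : ℝ) : ℂ :=
  (PsiOf ψ n₀ K n x : ℂ) / (Complex.I * x - K n x)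

/-- `M^{[n]}(x) = ∑_{k ≥ 1} ∑_{T ∈ S^R_{k,n}} V_T(x)` (there is no `T` with `k = 0`). -/
def massOf {A : ℕ} (H : HillData A) (ψ : ℝ → ℝ) (n₀ : ℕ) (ε : ℝ) (K : ℕ → ℝ → ℂ)
    (n : ℕ) (x : ℝ) : ℂ :=
  ∑' k : ℕ, ∑' T : renSelfEnergies A n₀ k n, T.1.value H (propOf ψ n₀ K) ε x

end Of

namespace HillData

variable {A : ℕ} (H : HillData A) (ψ : ℝ → ℝ) (n₀ : ℕ) (ε : ℝ)

/-- The list of the first functions `𝓜^{[n-1]}`: for `i ≤ n` the value of `lagHist n` at `i` is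
`𝓜^{[i-1]}`. -/
def lagHist : ℕ → ℕ → ℝ → ℂ
  | 0 => fun _ _ => 0
  | n + 1 => Function.update (lagHist n) (n + 1) fun x =>
      if n₀ ≤ n then
        lagHist n n x + (XiOf ψ n₀ (lagHist n) n x : ℂ) * massOf H ψ n₀ ε (lagHist n) n x
      else 0

/-- `lag n = 𝓜^{[n-1]}(· ; ε)`, with `𝓜^{[n₀-1]} = 0`. -/
def lag (n : ℕ) : ℝ → ℂ := H.lagHist ψ n₀ ε n n

/-- `𝓜^{[n]}(x; ε)`. -/
def calM (n : ℕ) : ℝ → ℂ := H.lag ψ n₀ ε (n + 1)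

/-- `M^{[n]}(x; ε)`. -/
def mass (n : ℕ) (x : ℝ) : ℂ := massOf H ψ n₀ ε (H.lag ψ n₀ ε) n x

/-- `Ξ_n(x; ε)`. -/
def Xi (n : ℕ) (x : ℝ) : ℝ := XiOf ψ n₀ (H.lag ψ n₀ ε) n x

/-- The renormalized propagator `g^{[n]}(x; ε)`. -/
def prop (n : ℕ) (x : ℝ) : ℂ := propOf ψ n₀ (H.lag ψ n₀ ε) n x

end HillData

/-! The recursion reads as it should: `𝓜^{[n₀-1]} = 0` and
`𝓜^{[n]} = 𝓜^{[n-1]} + Ξ_n M^{[n]}` for `n ≥ n₀`. -/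

theorem LTree.value_congr {A : ℕ} (H : HillData A) {g g' : ℕ → ℝ → ℂ} (x : ℝ) (t : LTree A)
    (h : ∀ s ∈ t.scales, g s = g' s) : t.value H g x = t.value H g' x := by
  induction t with
  | ent => rfl
  | bullet ν n => simp [LTree.value, h n (by simp [LTree.scales])]
  | vertex ν n l r ihl ihr =>
    simp only [LTree.value]
    rw [h n (by simp [LTree.scales]), ihl fun s hs => h s (by simp [LTree.scales, hs]),
      ihr fun s hs => h s (by simp [LTree.scales, hs])]

theorem XiOf_congr (ψ : ℝ → ℝ) (n₀ : ℕ) {K K' : ℕ → ℝ → ℂ} {n : ℕ}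
    (h : ∀ i ≤ n, K i = K' i) (x : ℝ) : XiOf ψ n₀ K n x = XiOf ψ n₀ K' n x := by
  refine Finset.prod_congr rfl fun i hi => ?_
  rw [h i (Finset.mem_Icc.1 hi).2]

theorem propOf_congr (ψ : ℝ → ℝ) (n₀ : ℕ) {K K' : ℕ → ℝ → ℂ} {n : ℕ}
    (h : ∀ i ≤ n, K i = K' i) : propOf ψ n₀ K n = propOf ψ n₀ K' n := by
  funext x
  have h1 : ∏ i ∈ Finset.Ico n₀ n, chiN ψ i ‖Complex.I * x - K i x‖ =
      ∏ i ∈ Finset.Ico n₀ n, chiN ψ i ‖Complex.I * x - K' i x‖ := by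
    refine Finset.prod_congr rfl fun i hi => ?_
    rw [h i (Finset.mem_Ico.1 hi).2.le]
  simp only [propOf, PsiOf, h1, h n le_rfl]

theorem massOf_congr {A : ℕ} (H : HillData A) (ψ : ℝ → ℝ) (n₀ : ℕ) (ε : ℝ)
    {K K' : ℕ → ℝ → ℂ} {n : ℕ} (h : ∀ i ≤ n, K i = K' i) (x : ℝ) :
    massOf H ψ n₀ ε K n x = massOf H ψ n₀ ε K' n x := by
  refine tsum_congr fun k => tsum_congr fun T => ?_
  have hg : ∀ s ∈ T.1.scales, propOf ψ n₀ K s = propOf ψ n₀ K' s := fun s hs =>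
    propOf_congr ψ n₀ fun i hi => h i (hi.trans (T.2.1.1 s hs))
  simp only [Subgraph.value]
  rw [LTree.value_congr H x T.1.left fun s hs => hg s (Finset.mem_union_left _ hs),
    LTree.value_congr H x T.1.right fun s hs => hg s (Finset.mem_union_right _ hs)]

namespace HillData

variable {A : ℕ} (H : HillData A) (ψ : ℝ → ℝ) (n₀ : ℕ) (ε : ℝ)

theorem lagHist_eq_lag (n : ℕ) : ∀ i ≤ n, H.lagHist ψ n₀ ε n i = H.lag ψ n₀ ε i := by
  induction n with
  | zero => intro i hi; obtain rfl := Nat.le_zero.1 hi; rfl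
  | succ n ih =>
    intro i hi
    rcases Nat.lt_or_eq_of_le hi with h | rfl
    · rw [← ih i (Nat.lt_succ_iff.1 h), lagHist, Function.update_of_ne h.ne]
    · rfl

theorem lag_start : H.lag ψ n₀ ε n₀ = fun _ => 0 := by
  cases n₀ with
  | zero => rfl
  | succ n => funext x; simp [lag, lagHist]

theorem calM_eq {n : ℕ} (hn : n₀ ≤ n) (x : ℝ) : H.calM ψ n₀ ε n x =
    H.lag ψ n₀ ε n x + (H.Xi ψ n₀ ε n x : ℂ) * H.mass ψ n₀ ε n x := by
  have h := H.lagHist_eq_lag ψ n₀ ε n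
  simp only [calM, lag, lagHist, Function.update_self, hn, if_true]
  rw [XiOf_congr ψ n₀ h, massOf_congr H ψ n₀ ε h]
  rfl

/-! ### The renormalized series -/

/-- The coefficients `u^{[k]}_ν = ∑_{θ ∈ Θ^R_{k,ν}} Val(θ)` for `ν ≠ 0`, and `u^{[k]}_0 = 0`.  A tree
has no entering external line, so that its value does not depend on the argument `0`. -/
def uCoeff (k : ℕ) (ν : Mode A) : ℂ :=
  if ν = 0 then 0 else ∑' θ : renTrees A n₀ k ν, θ.1.value H (H.prop ψ n₀ ε) 0

/-- `u^{[k]}(t) = ∑_ν exp(i ν · ω t) u^{[k]}_ν`. -/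
def uOrder (k : ℕ) (t : ℝ) : ℂ :=
  ∑' ν : Mode A, Complex.exp (Complex.I * (H.freq ν : ℂ) * t) * H.uCoeff ψ n₀ ε k ν

/-- The renormalized series `ū(t) = ∑_k ε^k u^{[k]}(t)`. -/
def uBar (t : ℝ) : ℂ := ∑' k : ℕ, (ε : ℂ) ^ k * H.uOrder ψ n₀ ε k t

/-- The set `𝓔_*` of admissible values of `ε`: those with
`|i ω · ν - 𝓜^{[n]}(ω · ν; ε)| ≥ C₁ |ν|^{-τ₁}` for all `ν ≠ 0` and all `n ≥ n₀`. -/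
def admissible (C₁ τ₁ : ℝ) : Set ℝ :=
  {ε | ∀ ν : Mode A, ν ≠ 0 → ∀ n, n₀ ≤ n →
    C₁ * ν.l1 ^ (-τ₁) ≤ ‖Complex.I * (H.freq ν : ℂ) - H.calM ψ n₀ ε n (H.freq ν)‖}

end HillData

/-- The dyadic shell `𝓔_m = (ε_m / 2, ε_m]`, where `ε_m = 2^{-m} ε₀`. -/
def shell (ε₀ : ℝ) (m : ℕ) : Set ℝ := Set.Ioc (ε₀ / 2 ^ m / 2) (ε₀ / 2 ^ m)

/-- The initial scale `n₀ = τ₁ log₂ (c₁ + c₂ log (2 / ε_m))`, rounded up to an integer. -/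
def startScale (τ₁ c₁ c₂ ε₀ : ℝ) (m : ℕ) : ℕ :=
  ⌈τ₁ * Real.logb 2 (c₁ + c₂ * Real.log (2 / (ε₀ / 2 ^ m)))⌉₊

end HillRen

end

open MeasureTheory Filter

noncomputable section

namespace HillRen

open scoped ENNReal NNReal Topology ComplexConjugate

/-! Everything reduces to one absolutely convergent sum over labelled trees. A propagator on scale
`n` has size `O(2^n)`, and it is Lipschitz with constant `O(4^n)` as long as the functions
`𝓜^{[j-1]}` with `j ≤ n` are Lipschitz with constant `1/2`. Tree values are therefore under control
once the sum of the scales of the lines is.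

That sum is bounded by the Siegel–Bryuno argument (`LTree.numAbove_add_le`). Consider a line on
scale above `q` and the part of the tree just before it, reached through lines on scales at most
`q`. If no line enters this part, its total momentum is that of the line, and admissibility of `ε`
forces the modes in it to be large. If exactly one line enters, both lines have small divisors; the
Lipschitz property of `𝓜^{[q-1]}` turns this into smallness of `ω · μ` for the momentum `μ` of the
part, which is nonzero because self-energy graphs are excluded, and the Diophantine condition makes
`μ` large. If two or more lines enter, the count gains by branching. So the number of lines above
scale `q` is at most `countConst τ₁ q` times the total mode norm, and the scale sum is at most `n₀`
per line plus `γ` times the mode norm, with `γ` small when `n₀` is large.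

Consequently a factor `64` per unit of scale costs `64^{n₀}` per line and an exponential of the mode
norm, which the exponential decay of `Q` and `R` absorbs. Half of `64 = 8 · 8` makes the sums over
scales converge, `(4/8)^n`; the other half gives `M^{[n]}` a decay `8^{-n}`. The sum over binary
trees (`LTree.tsum_weight_le`) converges when `ε (64^{n₀})²` is small. Since `64^{n₀}` is at most a
power of `c₁ + c₂ log(2/ε_m)`, up to a constant, this holds for small `ε₀`.

The argument is circular in appearance: the count for self-energy graphs on scale `n` uses the
Lipschitz bounds on `𝓜^{[j-1]}` for `j ≤ n`. `TreeBounds.norm_lag_sub_le` resolves this by induction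
on the scale: `Ξ_n M^{[n]}` has Lipschitz constant at most `4^{-(n+1)}`, and these constants sum to
less than `1/2`.

The decay of `Q` requires that `φ₀` has no zeros, which follows from the absence of resonances
(`HillData.φ₀_ne_zero`). A weight `exp(κ|ν|)` is carried through the tree sum, so that `ū` extends
holomorphically to a strip around the real axis. -/

/-! ### Norms and frequencies of modes -/

theorem Mode.l1_nonneg {A : ℕ} (ν : Mode A) : 0 ≤ ν.l1 := by
  unfold Mode.l1; positivity

theorem Mode.l1_add_le {A : ℕ} (ν μ : Mode A) : (ν + μ).l1 ≤ ν.l1 + μ.l1 := by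
  have h1 : ∑ i, |(((ν + μ).1 i : ℤ) : ℝ)| ≤ ∑ i, |(ν.1 i : ℝ)| + ∑ i, |(μ.1 i : ℝ)| := by
    rw [← Finset.sum_add_distrib]
    refine Finset.sum_le_sum fun i _ => ?_
    simpa using abs_add_le (ν.1 i : ℝ) (μ.1 i : ℝ)
  have h2 := abs_add_le (ν.2.1 : ℝ) (μ.2.1 : ℝ)
  have h3 := abs_add_le (ν.2.2 : ℝ) (μ.2.2 : ℝ)
  simp only [Mode.l1, Prod.fst_add, Prod.snd_add, Int.cast_add] at *
  linarith

theorem Mode.one_le_l1 {A : ℕ} {ν : Mode A} (h : ν ≠ 0) : 1 ≤ ν.l1 := by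
  have key : ∀ z : ℤ, z ≠ 0 → (1 : ℝ) ≤ |(z : ℝ)| := fun z hz => by
    exact_mod_cast Int.one_le_abs hz
  have hs : 0 ≤ ∑ i, |(ν.1 i : ℝ)| := Finset.sum_nonneg fun i _ => abs_nonneg _
  have h2 := abs_nonneg (ν.2.1 : ℝ)
  have h3 := abs_nonneg (ν.2.2 : ℝ)
  unfold Mode.l1
  by_cases h₂ : ν.2.1 = 0
  · by_cases h₃ : ν.2.2 = 0
    · have : ∃ i, ν.1 i ≠ 0 := by
        by_contra! hc
        exact h (Prod.ext (funext hc) (Prod.ext h₂ h₃))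
      obtain ⟨i, hi⟩ := this
      have := Finset.single_le_sum (f := fun i => |(ν.1 i : ℝ)|) (fun i _ => abs_nonneg _)
        (Finset.mem_univ i)
      have := key _ hi
      linarith
    · have := key _ h₃
      linarith
  · have := key _ h₂
    linarith

namespace HillData

variable {A : ℕ} (H : HillData A)

theorem freq_add (ν μ : Mode A) : H.freq (ν + μ) = H.freq ν + H.freq μ := by
  simp only [freq, Prod.fst_add, Prod.snd_add, Pi.add_apply, Int.cast_add, add_mul,
    Finset.sum_add_distrib]
  ring

@[simp] theorem freq_zero : H.freq (0 : Mode A) = 0 := by simp [freq]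

end HillData

/-! ### Cutting trees at a scale and counting lines on high scales -/

namespace LTree

variable {A : ℕ}

/-- The number of lines on scale larger than `q`. -/
def numAbove (q : ℕ) : LTree A → ℕ
  | ent => 0
  | bullet _ s => if q < s then 1 else 0
  | vertex _ s l r => (if q < s then 1 else 0) + l.numAbove q + r.numAbove q

/-- The sum of the norms of the modes of all nodes. -/
def modeNorm : LTree A → ℝ
  | ent => 0
  | bullet ν _ => ν.l1
  | vertex ν _ l r => ν.l1 + l.modeNorm + r.modeNorm

/-- The number of lines. -/
def numLines : LTree A → ℕ
  | ent => 0
  | bullet _ _ => 1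
  | vertex _ _ l r => 1 + l.numLines + r.numLines

/-- The sum of the scales of all lines. -/
def scaleSum : LTree A → ℕ
  | ent => 0
  | bullet _ s => s
  | vertex _ s l r => s + l.scaleSum + r.scaleSum

/-- Every line on scale `s` has an argument satisfying `good s`. -/
def Supported (H : HillData A) (good : ℕ → ℝ → Prop) (x : ℝ) : LTree A → Prop
  | ent => True
  | bullet ν s => good s (H.freq ν)
  | vertex ν s l r => good s ((vertex ν s l r).arg H x) ∧ l.Supported H good x ∧
      r.Supported H good x

theorem Supported.imp {H : HillData A} {good good' : ℕ → ℝ → Prop} {x : ℝ}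
    (h : ∀ s y, good s y → good' s y) {t : LTree A} (ht : t.Supported H good x) :
    t.Supported H good' x := by
  induction t with
  | ent => trivial
  | bullet ν s => exact h _ _ ht
  | vertex ν s l r ihl ihr => exact ⟨h _ _ ht.1, ihl ht.2.1, ihr ht.2.2⟩

theorem modeNorm_nonneg (t : LTree A) : 0 ≤ t.modeNorm := by
  induction t with
  | ent => exact le_rfl
  | bullet ν s => exact ν.l1_nonneg
  | vertex ν s l r ihl ihr => have := ν.l1_nonneg; simp only [modeNorm]; linarith

theorem l1_modeSum_le (t : LTree A) : t.modeSum.l1 ≤ t.modeNorm := by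
  induction t with
  | ent => simp [modeSum, modeNorm, Mode.l1]
  | bullet ν s => exact le_rfl
  | vertex ν s l r ihl ihr =>
    have h1 := Mode.l1_add_le (ν + l.modeSum) r.modeSum
    have h2 := Mode.l1_add_le ν l.modeSum
    simp only [modeSum, modeNorm]
    linarith

theorem arg_eq (H : HillData A) (x : ℝ) (t : LTree A) :
    t.arg H x = H.freq t.modeSum + t.numEnt * x := by
  induction t with
  | ent => simp [arg, modeSum, numEnt]
  | bullet ν s => simp [arg, modeSum, numEnt]
  | vertex ν s l r ihl ihr =>
    simp only [arg, modeSum, numEnt, ihl, ihr, H.freq_add]; push_cast; ring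

theorem scales_nonempty {t : LTree A} (h : t.numEnt = 0) : t.scales.Nonempty := by
  cases t with
  | ent => simp [numEnt] at h
  | bullet ν s => exact ⟨s, by simp [scales]⟩
  | vertex ν s l r => exact ⟨s, by simp [scales]⟩

/-- A self-energy graph on scale `n` must contain a line on scale exactly `n`. This allows the
threshold `q` to be lowered to the largest scale actually present. -/
theorem cut_eq_cut {q n : ℕ} (hn : n ≤ q) (t : LTree A)
    (h : ∀ s ∈ (t.cut q).scales, s ≤ n) : t.cut n = t.cut q := by
  induction t with
  | ent => rfl
  | bullet ν s =>
    by_cases hs : s ≤ q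
    · have : s ≤ n := h s (by simp [cut, hs, scales])
      simp [cut, hs, this]
    · have : ¬ s ≤ n := by omega
      simp [cut, hs, this]
  | vertex ν s l r ihl ihr =>
    by_cases hs : s ≤ q
    · have h' : ∀ s' ∈ insert s ((l.cut q).scales ∪ (r.cut q).scales), s' ≤ n := by
        simpa [cut, hs, scales] using h
      have : s ≤ n := h' s (by simp)
      simp only [cut, hs, this, if_true]
      rw [ihl fun s' hs' => h' s' (by simp [hs']), ihr fun s' hs' => h' s' (by simp [hs'])]
    · have : ¬ s ≤ n := by omega
      simp [cut, hs, this]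

theorem scales_cut_le (q : ℕ) (t : LTree A) : ∀ s ∈ (t.cut q).scales, s ≤ q := by
  induction t with
  | ent => simp [cut, scales]
  | bullet ν s =>
    by_cases hs : s ≤ q <;> simp [cut, hs, scales]
  | vertex ν s l r ihl ihr =>
    by_cases hs : s ≤ q
    · simp only [cut, hs, if_true, scales, Finset.mem_insert, Finset.mem_union]
      rintro s' (rfl | h | h)
      · exact hs
      · exact ihl _ h
      · exact ihr _ h
    · simp [cut, hs, scales]

theorem cut_eq_self {q : ℕ} (t : LTree A) (h : (t.cut q).numEnt = 0) : t.cut q = t := by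
  induction t with
  | ent => rfl
  | bullet ν s => by_cases hs : s ≤ q <;> simp_all [cut, numEnt]
  | vertex ν s l r ihl ihr =>
    by_cases hs : s ≤ q
    · simp only [cut, hs, if_true, numEnt] at h ⊢
      rw [ihl (by omega), ihr (by omega)]
    · simp [cut, hs, numEnt] at h

theorem numEnt_cut_pos {q : ℕ} (t : LTree A) (h : 0 < t.numEnt) : 0 < (t.cut q).numEnt := by
  by_contra h0
  rw [cut_eq_self t (by omega)] at h0
  exact h0 h

/-- If exactly one line enters the part of the tree reached through lines on scales `≤ q`, the
argument of the root line is the sum of the one of the entering line and of the momentum of that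
part. -/
theorem exists_arg_eq_of_numEnt_cut (H : HillData A) {q : ℕ} {P : ℝ → Prop} {x : ℝ}
    (t : LTree A) (hP : t.Supported H (fun s y => q < s → P y) x) (hx : 0 < t.numEnt → P x)
    (h1 : (t.cut q).numEnt = 1) :
    ∃ y, P y ∧ t.arg H x = H.freq (t.cut q).modeSum + y := by
  induction t with
  | ent => exact ⟨x, hx (by simp [numEnt]), by simp [arg, cut, modeSum]⟩
  | bullet ν s =>
    by_cases hs : s ≤ q
    · simp [cut, hs, numEnt] at h1
    · exact ⟨_, hP (by omega), by simp [cut, hs, arg, modeSum]⟩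
  | vertex ν s l r ihl ihr =>
    by_cases hs : s ≤ q
    · simp only [cut, hs, if_true, numEnt, modeSum, H.freq_add, arg] at h1 hx ⊢
      rcases Nat.eq_zero_or_pos (l.cut q).numEnt with h | h
      · obtain ⟨y, hy, he⟩ := ihr hP.2.2 (fun h => hx (by omega)) (by omega)
        refine ⟨y, hy, ?_⟩
        have hl := cut_eq_self l h
        rw [he, arg_eq H x l, hl]
        rw [hl] at h
        rw [h]; push_cast; ring
      · obtain ⟨y, hy, he⟩ := ihl hP.2.1 (fun h => hx (by omega)) (by omega)
        refine ⟨y, hy, ?_⟩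
        have h : (r.cut q).numEnt = 0 := by omega
        have hr := cut_eq_self r h
        rw [he, arg_eq H x r, hr]
        rw [hr] at h
        rw [h]; push_cast; ring
    · exact ⟨_, hP.1 (by omega), by simp [cut, hs, modeSum]⟩

end LTree

/-- A part of a tree below a line on a high scale, with one entering line and momentum zero, yields
a self-energy graph. -/
theorem containsSelfEnergy_of_cut {A : ℕ} {ν : Mode A} {s q : ℕ} {l r : LTree A} (hs : q < s)
    (h1 : (l.cut q).numEnt + (r.cut q).numEnt = 1)
    (h0 : ν + (l.cut q).modeSum + (r.cut q).modeSum = 0) :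
    (LTree.vertex ν s l r).ContainsSelfEnergy := by
  -- A vertex has two entering branches. With a single entering external line, one of the branches
  -- is a complete subtree and so contributes at least its root line.
  have hne : ((l.cut q).scales ∪ (r.cut q).scales).Nonempty := by
    rcases Nat.eq_zero_or_pos (l.cut q).numEnt with h | h
    · exact (LTree.scales_nonempty h).mono Finset.subset_union_left
    · exact (LTree.scales_nonempty (t := r.cut q) (by omega)).mono Finset.subset_union_right
  obtain ⟨n, hn, hmax⟩ : ∃ n ∈ (l.cut q).scales ∪ (r.cut q).scales,
      ∀ s' ∈ (l.cut q).scales ∪ (r.cut q).scales, s' ≤ n :=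
    ⟨_, Finset.max'_mem _ hne, fun s' hs' => Finset.le_max' _ s' hs'⟩
  have hnq : n ≤ q := by
    rcases Finset.mem_union.1 hn with h | h
    · exact LTree.scales_cut_le q _ _ h
    · exact LTree.scales_cut_le q _ _ h
  have hl := LTree.cut_eq_cut hnq l fun s' h => hmax s' (Finset.mem_union_left _ h)
  have hr := LTree.cut_eq_cut hnq r fun s' h => hmax s' (Finset.mem_union_right _ h)
  refine Or.inl ⟨n, by omega, ?_⟩
  simp only [Subgraph.IsSelfEnergyOn, Subgraph.cut, Subgraph.scales, hl, hr]
  exact ⟨hmax, hn, h1, h0⟩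

namespace LTree

variable {A : ℕ}

/-- The Siegel–Bryuno counting argument: the number of lines on scale larger than `q`. -/
theorem numAbove_add_le (H : HillData A) {q : ℕ} {P : ℝ → Prop} {c x : ℝ} (hc : 0 ≤ c)
    (hP1 : ∀ ν : Mode A, ν ≠ 0 → P (H.freq ν) → 2 ≤ c * ν.l1)
    (hP2 : ∀ ν : Mode A, ν ≠ 0 → ∀ y, P y → P (H.freq ν + y) → 2 ≤ c * ν.l1)
    (t : LTree A) (he : t.numEnt ≤ 1) (hx : 0 < t.numEnt → P x)
    (hP : t.Supported H (fun s y => q < s → P y) x) (hm : t.NonzeroMomenta)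
    (hs : ¬ t.ContainsSelfEnergy) :
    (t.numAbove q : ℝ) + (t.cut q).numEnt ≤ c * (t.modeNorm - (t.cut q).modeNorm) + t.numEnt := by
  induction t with
  | ent => simp [numAbove, cut, numEnt, modeNorm]
  | bullet ν s =>
    by_cases h : s ≤ q
    · have h' : ¬ q < s := by omega
      simp [numAbove, cut, h, h', numEnt, modeNorm]
    · have h' : q < s := by omega
      have := hP1 ν hm (hP h')
      simp [numAbove, cut, h, h', numEnt, modeNorm]
      linarith
  | vertex ν s l r ihl ihr =>
    simp only [numEnt] at he hx
    have hsl : ¬ l.ContainsSelfEnergy := fun h => hs (Or.inr (Or.inl h))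
    have hsr : ¬ r.ContainsSelfEnergy := fun h => hs (Or.inr (Or.inr h))
    have h1 := ihl (by omega) (fun h => hx (by omega)) hP.2.1 hm.2.1 hsl
    have h2 := ihr (by omega) (fun h => hx (by omega)) hP.2.2 hm.2.2 hsr
    -- A root line on scale at most `q` merges the cut parts of the two branches, so the two bounds
    -- just add up.
    by_cases h : s ≤ q
    · have h' : ¬ q < s := by omega
      simp only [numAbove, cut, h, h', numEnt, modeNorm, if_true, if_false]
      push_cast
      linarith
    · have h' : q < s := by omega
      -- The line is counted once in `numAbove` and once more as an entering line of the part that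
      -- follows it; hence the `2`. It is paid for by the modes of the part closed off by this line,
      -- or by the lines entering that part.
      have key : 2 ≤ c * (ν.l1 + (l.cut q).modeNorm + (r.cut q).modeNorm) +
          (((l.cut q).numEnt + (r.cut q).numEnt : ℕ) : ℝ) := by
        have hn : 0 ≤ c * (ν.l1 + (l.cut q).modeNorm + (r.cut q).modeNorm) :=
          mul_nonneg hc (by
            have := ν.l1_nonneg
            have := (l.cut q).modeNorm_nonneg
            have := (r.cut q).modeNorm_nonneg
            linarith)
        have hsum : (ν + (l.cut q).modeSum + (r.cut q).modeSum).l1 ≤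
            ν.l1 + (l.cut q).modeNorm + (r.cut q).modeNorm :=
          l1_modeSum_le (vertex ν s (l.cut q) (r.cut q))
        have hPs := hP.1 h'
        rcases (by omega : (l.cut q).numEnt + (r.cut q).numEnt = 0 ∨
          (l.cut q).numEnt + (r.cut q).numEnt = 1 ∨
          2 ≤ (l.cut q).numEnt + (r.cut q).numEnt) with h0 | h0 | h0
        · have hl := cut_eq_self l (q := q) (by omega)
          have hr := cut_eq_self r (q := q) (by omega)
          rw [hl, hr] at hsum h0 ⊢
          rw [arg_eq] at hPs
          simp only [modeSum, numEnt, h0] at hPs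
          have := hP1 _ (hm.1 h0) (by simpa using hPs)
          have := mul_le_mul_of_nonneg_left hsum hc
          rw [h0]; push_cast; linarith
        · have hne : ν + (l.cut q).modeSum + (r.cut q).modeSum ≠ 0 := fun h00 =>
            hs (containsSelfEnergy_of_cut h' h0 h00)
          -- The root line is relabelled with scale `q` so that the cut passes through it; its
          -- argument does not depend on the label.
          obtain ⟨y, hy, hya⟩ := exists_arg_eq_of_numEnt_cut H (q := q) (P := P) (x := x)
            (vertex ν q l r) ⟨fun h => absurd h (lt_irrefl _), hP.2⟩ hx
            (by simpa [cut, numEnt] using h0)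
          have hya' : (vertex ν s l r).arg H x =
              H.freq (ν + (l.cut q).modeSum + (r.cut q).modeSum) + y := by
            simpa [cut, modeSum, arg] using hya
          have := hP2 _ hne y hy (hya' ▸ hPs)
          have := mul_le_mul_of_nonneg_left hsum hc
          rw [h0]; push_cast; linarith
        · have : (2 : ℝ) ≤ (((l.cut q).numEnt + (r.cut q).numEnt : ℕ) : ℝ) := by
            exact_mod_cast h0
          linarith
      simp only [numAbove, cut, h, h', numEnt, modeNorm, if_true, if_false]
      push_cast at key ⊢
      linarith

/-- An entering external line survives the cut, so `numEnt` on the right is dominated by that of the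
cut tree on the left, and both can be dropped. -/
theorem numAbove_le (H : HillData A) {q : ℕ} {P : ℝ → Prop} {c x : ℝ} (hc : 0 ≤ c)
    (hP1 : ∀ ν : Mode A, ν ≠ 0 → P (H.freq ν) → 2 ≤ c * ν.l1)
    (hP2 : ∀ ν : Mode A, ν ≠ 0 → ∀ y, P y → P (H.freq ν + y) → 2 ≤ c * ν.l1)
    (t : LTree A) (he : t.numEnt ≤ 1) (hx : 0 < t.numEnt → P x)
    (hP : t.Supported H (fun s y => q < s → P y) x) (hm : t.NonzeroMomenta)
    (hs : ¬ t.ContainsSelfEnergy) : (t.numAbove q : ℝ) ≤ c * t.modeNorm := by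
  have h := numAbove_add_le H hc hP1 hP2 t he hx hP hm hs
  have h1 : (t.numEnt : ℝ) ≤ (t.cut q).numEnt := by
    rcases Nat.eq_zero_or_pos t.numEnt with h0 | h0
    · simp [h0]
    · have := numEnt_cut_pos (q := q) t h0
      exact_mod_cast (by omega)
  have := mul_nonneg hc (t.cut q).modeNorm_nonneg
  linarith

theorem numAbove_eq_zero {n q : ℕ} (hq : n ≤ q) (t : LTree A) (h : ∀ s ∈ t.scales, s ≤ n) :
    t.numAbove q = 0 := by
  induction t with
  | ent => rfl
  | bullet ν s =>
    have : s ≤ n := h s (by simp [scales])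
    simp only [numAbove]; rw [if_neg (by omega)]
  | vertex ν s l r ihl ihr =>
    have : s ≤ n := h s (by simp [scales])
    simp only [numAbove]
    rw [if_neg (by omega), ihl fun s' h' => h s' (by simp [scales, h']),
      ihr fun s' h' => h s' (by simp [scales, h'])]

/-- Layer-cake summation: a scale `s ≥ n₀` is `n₀` plus the number of `q` with `n₀ ≤ q < s`. -/
theorem scaleSum_eq {n₀ n : ℕ} (t : LTree A) (h0 : ∀ s ∈ t.scales, n₀ ≤ s)
    (h : ∀ s ∈ t.scales, s ≤ n) :
    t.scaleSum = n₀ * t.numLines + ∑ q ∈ Finset.Ico n₀ n, t.numAbove q := by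
  have key : ∀ s, n₀ ≤ s → s ≤ n →
      s = n₀ + ∑ q ∈ Finset.Ico n₀ n, (if q < s then 1 else 0) := fun s h1 h2 => by
    rw [← Finset.sum_filter, Finset.sum_const]
    have : Finset.filter (fun q => q < s) (Finset.Ico n₀ n) = Finset.Ico n₀ s := by
      ext q; simp only [Finset.mem_filter, Finset.mem_Ico]; omega
    rw [this, Nat.card_Ico]; simp; omega
  induction t with
  | ent => simp [scaleSum, numLines, numAbove]
  | bullet ν s =>
    simpa [scaleSum, numLines, numAbove] using key s (h0 s (by simp [scales])) (h s (by simp [scales]))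
  | vertex ν s l r ihl ihr =>
    have h1 := key s (h0 s (by simp [scales])) (h s (by simp [scales]))
    have h2 := ihl (fun s' h' => h0 s' (by simp [scales, h']))
      (fun s' h' => h s' (by simp [scales, h']))
    have h3 := ihr (fun s' h' => h0 s' (by simp [scales, h']))
      (fun s' h' => h s' (by simp [scales, h']))
    simp only [scaleSum, numLines, numAbove, Finset.sum_add_distrib]
    rw [h2, h3]
    nlinarith

theorem le_scaleSum (t : LTree A) : ∀ s ∈ t.scales, s ≤ t.scaleSum := by
  induction t with
  | ent => simp [scales]
  | bullet ν s => simp [scales, scaleSum]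
  | vertex ν s l r ihl ihr =>
    simp only [scales, Finset.mem_insert, Finset.mem_union, scaleSum]
    rintro s' (rfl | h | h)
    · omega
    · have := ihl _ h; omega
    · have := ihr _ h; omega

/-- The bound on the sum of the scales which comes from the bounds on the numbers of lines on large
scales. -/
theorem scaleSum_le {n₀ : ℕ} {c : ℕ → ℝ} {γ : ℝ} (hγ : ∀ n, ∑ q ∈ Finset.Ico n₀ n, c q ≤ γ)
    (t : LTree A) (h0 : ∀ s ∈ t.scales, n₀ ≤ s)
    (hc : ∀ q, n₀ ≤ q → (∃ s ∈ t.scales, q < s) → (t.numAbove q : ℝ) ≤ c q * t.modeNorm)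
    (hc0 : ∀ q, 0 ≤ c q) :
    (t.scaleSum : ℝ) ≤ n₀ * t.numLines + γ * t.modeNorm := by
  rw [scaleSum_eq t h0 t.le_scaleSum]
  push_cast
  have h1 : ∑ q ∈ Finset.Ico n₀ t.scaleSum, (t.numAbove q : ℝ) ≤
      ∑ q ∈ Finset.Ico n₀ t.scaleSum, c q * t.modeNorm := by
    refine Finset.sum_le_sum fun q hq => ?_
    by_cases h : ∃ s ∈ t.scales, q < s
    · exact hc q (Finset.mem_Ico.1 hq).1 h
    · push Not at h
      rw [numAbove_eq_zero le_rfl t h]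
      have := mul_nonneg (hc0 q) t.modeNorm_nonneg
      simpa using this
  rw [← Finset.sum_mul] at h1
  have := mul_le_mul_of_nonneg_right (hγ t.scaleSum) t.modeNorm_nonneg
  linarith

end LTree


/-! ### Summing multiplicative weights over all trees -/

namespace LTree

variable {A : ℕ}

/-- The product of the weights `a` of the vertices and `b` of the bullets. -/
def weight (a b : Mode A → ℕ → ℝ≥0∞) : LTree A → ℝ≥0∞
  | ent => 1
  | bullet ν n => b ν n
  | vertex ν n l r => a ν n * l.weight a b * r.weight a b

/-- The height of a tree. -/
def height : LTree A → ℕ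
  | ent => 0
  | bullet _ _ => 0
  | vertex _ _ l r => max l.height r.height + 1

/-- A tree is an entering line, a bullet, or a vertex with two subtrees. -/
def equivSum (A : ℕ) :
    LTree A ≃ Unit ⊕ (Mode A × ℕ) ⊕ ((Mode A × ℕ) × LTree A × LTree A) where
  toFun
    | ent => .inl ()
    | bullet ν n => .inr (.inl (ν, n))
    | vertex ν n l r => .inr (.inr ((ν, n), l, r))
  invFun
    | .inl () => ent
    | .inr (.inl (ν, n)) => bullet ν n
    | .inr (.inr ((ν, n), l, r)) => vertex ν n l r
  left_inv t := by cases t <;> rfl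
  right_inv
    | .inl () => rfl
    | .inr (.inl (_, _)) => rfl
    | .inr (.inr ((_, _), _, _)) => rfl

theorem tsum_eq_sum (f : LTree A → ℝ≥0∞) :
    ∑' t, f t = f ent + (∑' p : Mode A × ℕ, f (bullet p.1 p.2) +
      ∑' p : (Mode A × ℕ) × LTree A × LTree A, f (vertex p.1.1 p.1.2 p.2.1 p.2.2)) := by
  rw [← (equivSum A).symm.tsum_eq f, Summable.tsum_sum ENNReal.summable ENNReal.summable,
    Summable.tsum_sum (f := fun x => f ((equivSum A).symm (.inr x))) ENNReal.summable
      ENNReal.summable, tsum_fintype]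
  simp [equivSum]

/-- The sum `s` over trees of bounded height satisfies the recursion `s ↦ 1 + β + α s²`, and the
smallness of `α` makes the interval up to `2 (1 + β)` invariant. Truncation by height turns this
into an induction, and every finite set of trees has bounded height. -/
theorem tsum_weight_le {a b : Mode A → ℕ → ℝ≥0∞}
    {α β : ℝ≥0∞} (ha : ∑' p : Mode A × ℕ, a p.1 p.2 ≤ α) (hb : ∑' p : Mode A × ℕ, b p.1 p.2 ≤ β)
    (h : 4 * α * (1 + β) ≤ 1) : ∑' t : LTree A, t.weight a b ≤ 2 * (1 + β) := by
  have key : ∀ h : ℕ, ∑' t : LTree A, (if t.height ≤ h then t.weight a b else 0) ≤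
      2 * (1 + β) := by
    have hpre : 1 + β + α * (2 * (1 + β)) * (2 * (1 + β)) ≤ 2 * (1 + β) := by
      have : α * (2 * (1 + β)) * (2 * (1 + β)) = 4 * α * (1 + β) * (1 + β) := by ring
      rw [this, two_mul]
      -- This is where `4 α (1 + β) ≤ 1` enters: the quadratic term is at most `1 + β`.
      gcongr
      calc 4 * α * (1 + β) * (1 + β) ≤ 1 * (1 + β) := by gcongr
        _ = 1 + β := one_mul _
    have step : ∀ h : ℕ, ∀ S : ℝ≥0∞, S ≤ 2 * (1 + β) →
        (∑' t : LTree A, (if t.height < h then t.weight a b else 0) ≤ S) →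
        ∑' t : LTree A, (if t.height ≤ h then t.weight a b else 0) ≤ 2 * (1 + β) := by
      intro h S hS hsum
      rw [tsum_eq_sum]
      refine le_trans ?_ hpre
      rw [← add_assoc]
      refine add_le_add (add_le_add ?_ ?_) ?_
      · simp [weight, height]
      · simpa [weight, height] using hb
      · calc ∑' p : (Mode A × ℕ) × LTree A × LTree A,
              (if (vertex p.1.1 p.1.2 p.2.1 p.2.2).height ≤ h then
                (vertex p.1.1 p.1.2 p.2.1 p.2.2).weight a b else 0)
            ≤ ∑' p : (Mode A × ℕ) × LTree A × LTree A, a p.1.1 p.1.2 *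
              ((if p.2.1.height < h then p.2.1.weight a b else 0) *
              (if p.2.2.height < h then p.2.2.weight a b else 0)) := by
              refine ENNReal.tsum_le_tsum fun p => ?_
              by_cases hh : (vertex p.1.1 p.1.2 p.2.1 p.2.2).height ≤ h
              · have h1 : p.2.1.height < h := by simp only [height] at hh; omega
                have h2 : p.2.2.height < h := by simp only [height] at hh; omega
                simp only [hh, h1, h2, if_true, weight, mul_assoc, le_refl]
              · simp [hh]
          _ = (∑' p : Mode A × ℕ, a p.1 p.2) *
              ((∑' t : LTree A, (if t.height < h then t.weight a b else 0)) *
              (∑' t : LTree A, (if t.height < h then t.weight a b else 0))) := by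
              rw [ENNReal.tsum_prod', ← ENNReal.tsum_mul_right]
              refine tsum_congr fun p => ?_
              simp only
              rw [ENNReal.tsum_mul_left, ENNReal.tsum_prod', ← ENNReal.tsum_mul_right]
              congr 1
              exact tsum_congr fun t => by simp only; rw [ENNReal.tsum_mul_left]
          _ ≤ α * (2 * (1 + β) * (2 * (1 + β))) := by
              have := hsum.trans hS
              gcongr
          _ = α * (2 * (1 + β)) * (2 * (1 + β)) := by ring
    intro h
    induction h with
    | zero => exact step 0 0 zero_le (by simp)
    | succ h ih =>
      exact step (h + 1) _ ih (by simp only [Nat.lt_succ_iff]; exact le_rfl)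
  rw [ENNReal.tsum_eq_iSup_sum]
  refine iSup_le fun s => ?_
  calc ∑ t ∈ s, t.weight a b
      = ∑ t ∈ s, (if t.height ≤ s.sup height then t.weight a b else 0) :=
        Finset.sum_congr rfl fun t ht => by rw [if_pos (Finset.le_sup ht)]
    _ ≤ _ := ENNReal.sum_le_tsum s
    _ ≤ _ := key _

end LTree

/-! ### Size and Lipschitz bounds for cutoffs and propagators -/

namespace IsCutoff

variable {C₁ : ℝ} {ψ : ℝ → ℝ}

theorem nonneg (h : IsCutoff C₁ ψ) (x : ℝ) : 0 ≤ ψ x := by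
  rw [← h.eq_zero (min x (C₁ / 2)) (min_le_right _ _)]
  exact h.mono (min_le_left _ _)

theorem le_one (h : IsCutoff C₁ ψ) (x : ℝ) : ψ x ≤ 1 := by
  rw [← h.eq_one (max x C₁) (le_max_right _ _)]
  exact h.mono (le_max_left _ _)

/-- The derivative vanishes outside the compact interval `[C₁/2, C₁]` and is bounded on it. -/
theorem exists_lipschitz (h : IsCutoff C₁ ψ) :
    ∃ L : ℝ, 0 ≤ L ∧ ∀ x y, |ψ x - ψ y| ≤ L * |x - y| := by
  have hd : Differentiable ℝ ψ := h.smooth.differentiable (by simp)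
  have hc : Continuous (deriv ψ) := h.smooth.continuous_deriv (by simp)
  obtain ⟨L, hL⟩ := (isCompact_Icc (a := C₁ / 2) (b := C₁)).exists_bound_of_continuousOn
    hc.continuousOn
  have hb : ∀ x, ‖deriv ψ x‖ ≤ max L 0 := by
    intro x
    rcases lt_or_ge x (C₁ / 2) with h1 | h1
    · have : ψ =ᶠ[nhds x] fun _ => 0 := by
        filter_upwards [Iio_mem_nhds h1] with y hy using h.eq_zero y (le_of_lt hy)
      rw [this.deriv_eq]; simp
    rcases lt_or_ge C₁ x with h2 | h2
    · have : ψ =ᶠ[nhds x] fun _ => 1 := by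
        filter_upwards [Ioi_mem_nhds h2] with y hy using h.eq_one y (le_of_lt hy)
      rw [this.deriv_eq]; simp
    · exact (hL x ⟨h1, h2⟩).trans (le_max_left _ _)
  refine ⟨max L 0, le_max_right _ _, fun x y => ?_⟩
  simpa [Real.norm_eq_abs] using convex_univ.norm_image_sub_le_of_norm_deriv_le
    (fun x _ => hd x) (fun x _ => hb x) (Set.mem_univ y) (Set.mem_univ x)

theorem psiN_mem (h : IsCutoff C₁ ψ) (n : ℕ) (y : ℝ) : psiN ψ n y ∈ Set.Icc (0 : ℝ) 1 :=
  ⟨h.nonneg _, h.le_one _⟩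

theorem chiN_mem (h : IsCutoff C₁ ψ) (n : ℕ) (y : ℝ) : chiN ψ n y ∈ Set.Icc (0 : ℝ) 1 :=
  ⟨by have := h.le_one (2 ^ n * y); unfold chiN; linarith,
    by have := h.nonneg (2 ^ n * y); unfold chiN; linarith⟩

theorem lt_of_psiN_ne_zero (h : IsCutoff C₁ ψ) {n : ℕ} {y : ℝ} (hy : psiN ψ n y ≠ 0) :
    C₁ / 2 < 2 ^ n * y := by
  by_contra! hc
  exact hy (h.eq_zero _ hc)

theorem lt_of_chiN_ne_zero (h : IsCutoff C₁ ψ) {n : ℕ} {y : ℝ} (hy : chiN ψ n y ≠ 0) :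
    2 ^ n * y < C₁ := by
  by_contra! hc
  exact hy (by rw [chiN, h.eq_one _ hc, sub_self])

end IsCutoff

theorem abs_prod_sub_prod_le {ι : Type*} (s : Finset ι) {f g c : ι → ℝ}
    (hf : ∀ i ∈ s, f i ∈ Set.Icc (0 : ℝ) 1) (hg : ∀ i ∈ s, g i ∈ Set.Icc (0 : ℝ) 1)
    (hc : ∀ i ∈ s, |f i - g i| ≤ c i) :
    |∏ i ∈ s, f i - ∏ i ∈ s, g i| ≤ ∑ i ∈ s, c i := by
  classical
  induction s using Finset.induction_on with
  | empty => simp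
  | insert a s ha ih =>
    rw [Finset.prod_insert ha, Finset.prod_insert ha, Finset.sum_insert ha]
    have h1 := ih (fun i hi => hf i (Finset.mem_insert_of_mem hi))
      (fun i hi => hg i (Finset.mem_insert_of_mem hi))
      (fun i hi => hc i (Finset.mem_insert_of_mem hi))
    have h2 := hc a (Finset.mem_insert_self a s)
    have h3 := hf a (Finset.mem_insert_self a s)
    have h4 : |∏ i ∈ s, g i| ≤ 1 := by
      rw [Finset.abs_prod]
      exact Finset.prod_le_one (fun i _ => abs_nonneg _) fun i hi => by
        have := hg i (Finset.mem_insert_of_mem hi)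
        rw [abs_of_nonneg this.1]; exact this.2
    calc |f a * ∏ i ∈ s, f i - g a * ∏ i ∈ s, g i|
        = |f a * (∏ i ∈ s, f i - ∏ i ∈ s, g i) + (f a - g a) * ∏ i ∈ s, g i| := by ring_nf
      _ ≤ |f a| * |∏ i ∈ s, f i - ∏ i ∈ s, g i| + |f a - g a| * |∏ i ∈ s, g i| := by
          rw [← abs_mul, ← abs_mul]; exact abs_add_le _ _
      _ ≤ 1 * |∏ i ∈ s, f i - ∏ i ∈ s, g i| + |f a - g a| * 1 := by
          rw [abs_of_nonneg h3.1]
          gcongr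
          exact h3.2
      _ ≤ _ := by linarith

/-- The divisor `i x - 𝓜^{[j-1]}(x)` in absolute value. -/
def divisor (K : ℕ → ℝ → ℂ) (j : ℕ) (x : ℝ) : ℝ := ‖Complex.I * x - K j x‖

theorem abs_divisor_sub_le {K : ℕ → ℝ → ℂ} {j : ℕ}
    (hK : ∀ x y, ‖K j x - K j y‖ ≤ 1 / 2 * |x - y|) (x y : ℝ) :
    ‖(Complex.I * x - K j x) - (Complex.I * y - K j y)‖ ≤ 3 / 2 * |x - y| := by
  have h1 : (Complex.I * x - K j x) - (Complex.I * y - K j y) =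
      Complex.I * ((x - y : ℝ) : ℂ) - (K j x - K j y) := by push_cast; ring
  rw [h1]
  refine (norm_sub_le _ _).trans ?_
  have h2 : ‖Complex.I * ((x - y : ℝ) : ℂ)‖ = |x - y| := by
    rw [norm_mul, Complex.norm_I, one_mul, Complex.norm_real, Real.norm_eq_abs]
  have := hK x y
  linarith

theorem divisor_le_add {K : ℕ → ℝ → ℂ} {j : ℕ}
    (hK : ∀ x y, ‖K j x - K j y‖ ≤ 1 / 2 * |x - y|) (x y : ℝ) :
    divisor K j x ≤ divisor K j y + 3 / 2 * |x - y| := by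
  have h1 := abs_divisor_sub_le hK x y
  have h2 := norm_sub_norm_le (Complex.I * x - K j x) (Complex.I * y - K j y)
  unfold divisor
  linarith

/-- The difference of the arguments is controlled by the divisors. -/
theorem abs_sub_le_divisor {K : ℕ → ℝ → ℂ} {j : ℕ}
    (hK : ∀ x y, ‖K j x - K j y‖ ≤ 1 / 2 * |x - y|) (x y : ℝ) :
    |x - y| ≤ 2 * (divisor K j x + divisor K j y) := by
  have h1 : Complex.I * ((x - y : ℝ) : ℂ) =
      (Complex.I * x - K j x) - (Complex.I * y - K j y) + (K j x - K j y) := by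
    push_cast; ring
  have h2 : ‖Complex.I * ((x - y : ℝ) : ℂ)‖ = |x - y| := by
    rw [norm_mul, Complex.norm_I, one_mul, Complex.norm_real, Real.norm_eq_abs]
  rw [h1] at h2
  have h3 := norm_add_le ((Complex.I * x - K j x) - (Complex.I * y - K j y)) (K j x - K j y)
  have h4 := norm_sub_le (Complex.I * x - K j x) (Complex.I * y - K j y)
  have := hK x y
  unfold divisor
  linarith

theorem abs_psiN_sub_le {ψ : ℝ → ℝ} {L : ℝ} (hL0 : 0 ≤ L)
    (hL : ∀ x y, |ψ x - ψ y| ≤ L * |x - y|) {K : ℕ → ℝ → ℂ} {j : ℕ}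
    (hK : ∀ x y, ‖K j x - K j y‖ ≤ 1 / 2 * |x - y|) (x y : ℝ) :
    |psiN ψ j (divisor K j x) - psiN ψ j (divisor K j y)| ≤ 2 ^ j * (3 / 2 * L * |x - y|) := by
  have h1 : |divisor K j x - divisor K j y| ≤ 3 / 2 * |x - y| :=
    (abs_norm_sub_norm_le _ _).trans (abs_divisor_sub_le hK x y)
  calc _ ≤ L * |2 ^ j * divisor K j x - 2 ^ j * divisor K j y| := hL _ _
    _ = L * (2 ^ j * |divisor K j x - divisor K j y|) := by
      rw [← mul_sub, abs_mul, abs_of_nonneg (by positivity : (0 : ℝ) ≤ 2 ^ j)]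
    _ ≤ L * (2 ^ j * (3 / 2 * |x - y|)) := by gcongr
    _ = _ := by ring

theorem abs_chiN_sub_le {ψ : ℝ → ℝ} {L : ℝ} (hL0 : 0 ≤ L)
    (hL : ∀ x y, |ψ x - ψ y| ≤ L * |x - y|) {K : ℕ → ℝ → ℂ} {j : ℕ}
    (hK : ∀ x y, ‖K j x - K j y‖ ≤ 1 / 2 * |x - y|) (x y : ℝ) :
    |chiN ψ j (divisor K j x) - chiN ψ j (divisor K j y)| ≤ 2 ^ j * (3 / 2 * L * |x - y|) := by
  have := abs_psiN_sub_le hL0 hL hK x y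
  rw [abs_sub_comm] at this
  refine le_trans (le_of_eq ?_) this
  unfold chiN psiN
  ring_nf

theorem sum_Ico_two_pow_le (n₀ n : ℕ) : ∑ i ∈ Finset.Ico n₀ n, (2 : ℝ) ^ i ≤ 2 ^ n := by
  calc ∑ i ∈ Finset.Ico n₀ n, (2 : ℝ) ^ i ≤ ∑ i ∈ Finset.range n, (2 : ℝ) ^ i :=
        Finset.sum_le_sum_of_subset_of_nonneg (fun i hi => by
          simp only [Finset.mem_Ico, Finset.mem_range] at hi ⊢; omega) fun i _ _ => by positivity
    _ = 2 ^ n - 1 := by rw [geom_sum_eq (by norm_num)]; ring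
    _ ≤ 2 ^ n := by linarith

section Propagator

variable {C₁ : ℝ} {ψ : ℝ → ℝ} {n₀ : ℕ} {K : ℕ → ℝ → ℂ} {n : ℕ}

theorem XiOf_mem (hψ : IsCutoff C₁ ψ) (x : ℝ) : XiOf ψ n₀ K n x ∈ Set.Icc (0 : ℝ) 1 :=
  ⟨Finset.prod_nonneg fun _ _ => (hψ.chiN_mem _ _).1,
    Finset.prod_le_one (fun _ _ => (hψ.chiN_mem _ _).1) fun _ _ => (hψ.chiN_mem _ _).2⟩

theorem PsiOf_mem (hψ : IsCutoff C₁ ψ) (x : ℝ) : PsiOf ψ n₀ K n x ∈ Set.Icc (0 : ℝ) 1 := by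
  have h1 : ∏ i ∈ Finset.Ico n₀ n, chiN ψ i ‖Complex.I * x - K i x‖ ∈ Set.Icc (0 : ℝ) 1 :=
    ⟨Finset.prod_nonneg fun _ _ => (hψ.chiN_mem _ _).1,
      Finset.prod_le_one (fun _ _ => (hψ.chiN_mem _ _).1) fun _ _ => (hψ.chiN_mem _ _).2⟩
  have h2 := hψ.psiN_mem n ‖Complex.I * x - K n x‖
  exact ⟨mul_nonneg h1.1 h2.1, mul_le_one₀ h1.2 h2.1 h2.2⟩

theorem divisor_lt_of_XiOf_ne_zero (hψ : IsCutoff C₁ ψ) {x : ℝ} (hx : XiOf ψ n₀ K n x ≠ 0) :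
    ∀ j, n₀ ≤ j → j ≤ n → 2 ^ j * divisor K j x < C₁ := fun j h1 h2 =>
  hψ.lt_of_chiN_ne_zero (Finset.prod_ne_zero_iff.1 hx j (Finset.mem_Icc.2 ⟨h1, h2⟩))

theorem divisor_lt_of_propOf_ne_zero (hψ : IsCutoff C₁ ψ) {x : ℝ} (hx : propOf ψ n₀ K n x ≠ 0) :
    ∀ j, n₀ ≤ j → j < n → 2 ^ j * divisor K j x < C₁ := fun j h1 h2 => by
  have h : PsiOf ψ n₀ K n x ≠ 0 := fun h => hx (by simp [propOf, h])
  exact hψ.lt_of_chiN_ne_zero (Finset.prod_ne_zero_iff.1 (left_ne_zero_of_mul h) j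
    (Finset.mem_Ico.2 ⟨h1, h2⟩))

theorem lt_divisor_of_PsiOf_ne_zero (hψ : IsCutoff C₁ ψ) {x : ℝ} (hx : PsiOf ψ n₀ K n x ≠ 0) :
    C₁ / 2 < 2 ^ n * divisor K n x :=
  hψ.lt_of_psiN_ne_zero (right_ne_zero_of_mul hx)

theorem inv_divisor_le (hC₁ : 0 < C₁) (hψ : IsCutoff C₁ ψ) {x : ℝ}
    (hx : PsiOf ψ n₀ K n x ≠ 0) : (divisor K n x)⁻¹ ≤ C₁⁻¹ * 2 ^ (n + 1) := by
  have h := lt_divisor_of_PsiOf_ne_zero hψ hx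
  have h2 : (0 : ℝ) < 2 ^ n := by positivity
  have h3 : C₁ / 2 ^ (n + 1) < divisor K n x := by
    rw [div_lt_iff₀ (by positivity), pow_succ]; linarith
  calc (divisor K n x)⁻¹ ≤ (C₁ / 2 ^ (n + 1))⁻¹ :=
        inv_anti₀ (by positivity) h3.le
    _ = _ := by rw [inv_div, div_eq_mul_inv, mul_comm]

theorem norm_propOf_le (hC₁ : 0 < C₁) (hψ : IsCutoff C₁ ψ) (x : ℝ) :
    ‖propOf ψ n₀ K n x‖ ≤ C₁⁻¹ * 2 ^ (n + 1) := by
  by_cases h : PsiOf ψ n₀ K n x = 0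
  · simp only [propOf, h, Complex.ofReal_zero, zero_div, norm_zero]; positivity
  · have h1 := PsiOf_mem (n₀ := n₀) (K := K) (n := n) hψ x
    have h2 := inv_divisor_le hC₁ hψ h
    rw [propOf, norm_div, div_eq_mul_inv, Complex.norm_real, Real.norm_eq_abs,
      abs_of_nonneg h1.1]
    calc _ ≤ 1 * (C₁⁻¹ * 2 ^ (n + 1)) :=
          mul_le_mul h1.2 h2 (inv_nonneg.2 (norm_nonneg _)) zero_le_one
      _ = _ := one_mul _

theorem abs_XiOf_sub_le (hψ : IsCutoff C₁ ψ) {L : ℝ} (hL0 : 0 ≤ L)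
    (hL : ∀ x y, |ψ x - ψ y| ≤ L * |x - y|)
    (hK : ∀ j ≤ n, ∀ x y, ‖K j x - K j y‖ ≤ 1 / 2 * |x - y|) (x y : ℝ) :
    |XiOf ψ n₀ K n x - XiOf ψ n₀ K n y| ≤ 3 * L * 2 ^ n * |x - y| := by
  refine (abs_prod_sub_prod_le _ (fun i _ => hψ.chiN_mem _ _) (fun i _ => hψ.chiN_mem _ _)
    fun i hi => abs_chiN_sub_le hL0 hL (hK i (Finset.mem_Icc.1 hi).2) x y).trans ?_
  rw [← Finset.sum_mul]
  -- The Lipschitz constants of the factors grow geometrically with the scale, so that the last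
  -- factor dominates the product.
  have : ∑ i ∈ Finset.Icc n₀ n, (2 : ℝ) ^ i ≤ 2 ^ (n + 1) := by
    have := sum_Ico_two_pow_le n₀ (n + 1)
    rwa [Finset.Ico_add_one_right_eq_Icc] at this
  calc _ ≤ (2 : ℝ) ^ (n + 1) * (3 / 2 * L * |x - y|) := by gcongr
    _ = _ := by ring

theorem abs_PsiOf_sub_le (hψ : IsCutoff C₁ ψ) {L : ℝ} (hL0 : 0 ≤ L)
    (hL : ∀ x y, |ψ x - ψ y| ≤ L * |x - y|)
    (hK : ∀ j ≤ n, ∀ x y, ‖K j x - K j y‖ ≤ 1 / 2 * |x - y|) (x y : ℝ) :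
    |PsiOf ψ n₀ K n x - PsiOf ψ n₀ K n y| ≤ 3 * L * 2 ^ n * |x - y| := by
  have h1 := abs_prod_sub_prod_le (Finset.Ico n₀ n)
    (f := fun i => chiN ψ i (divisor K i x)) (g := fun i => chiN ψ i (divisor K i y))
    (fun i _ => hψ.chiN_mem _ _) (fun i _ => hψ.chiN_mem _ _)
    fun i hi => abs_chiN_sub_le hL0 hL (hK i (Finset.mem_Ico.1 hi).2.le) x y
  have h2 := abs_psiN_sub_le hL0 hL (hK n le_rfl) x y
  have h3 : |∏ i ∈ Finset.Ico n₀ n, chiN ψ i (divisor K i x)| ≤ 1 := by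
    rw [Finset.abs_prod]
    exact Finset.prod_le_one (fun i _ => abs_nonneg _) fun i hi => by
      have := hψ.chiN_mem i (divisor K i x)
      rw [abs_of_nonneg this.1]; exact this.2
  have h4 := hψ.psiN_mem n (divisor K n y)
  rw [← Finset.sum_mul] at h1
  have h5 : (∑ i ∈ Finset.Ico n₀ n, (2 : ℝ) ^ i) * (3 / 2 * L * |x - y|) ≤
      2 ^ n * (3 / 2 * L * |x - y|) := by
    have := sum_Ico_two_pow_le n₀ n
    gcongr
  set P := ∏ i ∈ Finset.Ico n₀ n, chiN ψ i (divisor K i x)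
  set P' := ∏ i ∈ Finset.Ico n₀ n, chiN ψ i (divisor K i y)
  set p := psiN ψ n (divisor K n x)
  set p' := psiN ψ n (divisor K n y)
  calc |P * p - P' * p'| = |P * (p - p') + (P - P') * p'| := by ring_nf
    _ ≤ |P| * |p - p'| + |P - P'| * |p'| := by
      rw [← abs_mul, ← abs_mul]; exact abs_add_le _ _
    _ ≤ 1 * |p - p'| + |P - P'| * 1 := by
      rw [abs_of_nonneg h4.1]
      gcongr
      exact h4.2
    _ ≤ _ := by linarith

/-- A constant bounding the size and the Lipschitz constant of `g^{[n]}` in units of `4 ^ n`. -/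
def propConst (C₁ L : ℝ) : ℝ := 6 * L * C₁⁻¹ + 6 * C₁⁻¹ ^ 2 + 2 * C₁⁻¹

theorem propConst_nonneg (hC₁ : 0 < C₁) {L : ℝ} (hL : 0 ≤ L) : 0 ≤ propConst C₁ L := by
  unfold propConst; positivity

theorem norm_propOf_le' (hC₁ : 0 < C₁) (hψ : IsCutoff C₁ ψ) {L : ℝ} (hL0 : 0 ≤ L) (x : ℝ) :
    ‖propOf ψ n₀ K n x‖ ≤ propConst C₁ L * 4 ^ n := by
  refine (norm_propOf_le hC₁ hψ x).trans ?_
  have h1 : (2 : ℝ) ^ n ≤ 4 ^ n := pow_le_pow_left₀ (by norm_num) (by norm_num) n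
  have h2 : 0 ≤ 6 * L * C₁⁻¹ + 6 * C₁⁻¹ ^ 2 := by positivity
  calc C₁⁻¹ * 2 ^ (n + 1) = 2 * C₁⁻¹ * 2 ^ n := by ring
    _ ≤ propConst C₁ L * 4 ^ n := by
      refine mul_le_mul ?_ h1 (by positivity) (propConst_nonneg hC₁ hL0)
      unfold propConst; linarith

/-- One `2^n` comes from the cutoffs or from a second inverse divisor, the other from the inverse
divisor at `x`. Only a nonzero cutoff bounds a divisor from below, so the two points are treated
asymmetrically: when the cutoff vanishes at `y`, the difference is a difference of cutoffs over the
divisor at `x`. -/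
theorem norm_propOf_sub_le_of_ne (hC₁ : 0 < C₁) (hψ : IsCutoff C₁ ψ) {L : ℝ} (hL0 : 0 ≤ L)
    (hL : ∀ x y, |ψ x - ψ y| ≤ L * |x - y|)
    (hK : ∀ j ≤ n, ∀ x y, ‖K j x - K j y‖ ≤ 1 / 2 * |x - y|) (x y : ℝ)
    (hx : PsiOf ψ n₀ K n x ≠ 0) :
    ‖propOf ψ n₀ K n x - propOf ψ n₀ K n y‖ ≤ propConst C₁ L * 4 ^ n * |x - y| := by
  have hP := abs_PsiOf_sub_le (n₀ := n₀) hψ hL0 hL hK x y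
  have hix := inv_divisor_le hC₁ hψ hx
  have hx0 : Complex.I * x - K n x ≠ 0 := by
    intro h
    have := lt_divisor_of_PsiOf_ne_zero hψ hx
    rw [divisor, h, norm_zero] at this
    linarith
  have e4 : (4 : ℝ) ^ n = 2 ^ n * 2 ^ n := by rw [← mul_pow]; norm_num
  have t1 : ‖((PsiOf ψ n₀ K n x - PsiOf ψ n₀ K n y : ℝ) : ℂ) / (Complex.I * x - K n x)‖ ≤
      6 * L * C₁⁻¹ * 4 ^ n * |x - y| := by
    rw [norm_div, Complex.norm_real, Real.norm_eq_abs, div_eq_mul_inv]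
    calc _ ≤ (3 * L * 2 ^ n * |x - y|) * (C₁⁻¹ * 2 ^ (n + 1)) :=
          mul_le_mul hP hix (inv_nonneg.2 (norm_nonneg _)) (by positivity)
      _ = _ := by rw [e4]; ring
  by_cases hy : PsiOf ψ n₀ K n y = 0
  · have : propOf ψ n₀ K n x - propOf ψ n₀ K n y =
        ((PsiOf ψ n₀ K n x - PsiOf ψ n₀ K n y : ℝ) : ℂ) / (Complex.I * x - K n x) := by
      simp [propOf, hy]
    rw [this]
    refine t1.trans ?_
    have : 6 * L * C₁⁻¹ ≤ propConst C₁ L := by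
      have : 0 ≤ 6 * C₁⁻¹ ^ 2 + 2 * C₁⁻¹ := by positivity
      unfold propConst; linarith
    gcongr
  · have hiy := inv_divisor_le hC₁ hψ hy
    have hy0 : Complex.I * y - K n y ≠ 0 := by
      intro h
      have := lt_divisor_of_PsiOf_ne_zero hψ hy
      rw [divisor, h, norm_zero] at this
      linarith
    have hsplit : propOf ψ n₀ K n x - propOf ψ n₀ K n y =
        ((PsiOf ψ n₀ K n x - PsiOf ψ n₀ K n y : ℝ) : ℂ) / (Complex.I * x - K n x) +
        (PsiOf ψ n₀ K n y : ℂ) * (-((Complex.I * x - K n x) - (Complex.I * y - K n y)) *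
          ((Complex.I * x - K n x)⁻¹ * (Complex.I * y - K n y)⁻¹)) := by
      simp only [propOf]
      push_cast
      field_simp
      ring
    have hm := PsiOf_mem (n₀ := n₀) (K := K) (n := n) hψ y
    have t2 : ‖(PsiOf ψ n₀ K n y : ℂ) *
        (-((Complex.I * x - K n x) - (Complex.I * y - K n y)) *
          ((Complex.I * x - K n x)⁻¹ * (Complex.I * y - K n y)⁻¹))‖ ≤
        6 * C₁⁻¹ ^ 2 * 4 ^ n * |x - y| := by
      rw [norm_mul, norm_mul, norm_mul, norm_neg, norm_inv, norm_inv, Complex.norm_real,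
        Real.norm_eq_abs, abs_of_nonneg hm.1]
      have hd := abs_divisor_sub_le (hK n le_rfl) x y
      calc _ ≤ 1 * ((3 / 2 * |x - y|) * ((C₁⁻¹ * 2 ^ (n + 1)) * (C₁⁻¹ * 2 ^ (n + 1)))) := by
            refine mul_le_mul hm.2 (mul_le_mul hd (mul_le_mul hix hiy
              (inv_nonneg.2 (norm_nonneg _)) (by positivity)) (by positivity) (by positivity))
              (by positivity) zero_le_one
        _ = _ := by rw [e4]; ring
    rw [hsplit]
    refine (norm_add_le _ _).trans ((add_le_add t1 t2).trans ?_)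
    rw [← add_mul, ← add_mul]
    have : 6 * L * C₁⁻¹ + 6 * C₁⁻¹ ^ 2 ≤ propConst C₁ L := by
      have : 0 ≤ 2 * C₁⁻¹ := by positivity
      unfold propConst; linarith
    gcongr

theorem norm_propOf_sub_le (hC₁ : 0 < C₁) (hψ : IsCutoff C₁ ψ) {L : ℝ} (hL0 : 0 ≤ L)
    (hL : ∀ x y, |ψ x - ψ y| ≤ L * |x - y|)
    (hK : ∀ j ≤ n, ∀ x y, ‖K j x - K j y‖ ≤ 1 / 2 * |x - y|) (x y : ℝ) :
    ‖propOf ψ n₀ K n x - propOf ψ n₀ K n y‖ ≤ propConst C₁ L * 4 ^ n * |x - y| := by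
  by_cases hx : PsiOf ψ n₀ K n x = 0
  · by_cases hy : PsiOf ψ n₀ K n y = 0
    · have := propConst_nonneg hC₁ hL0
      simp only [propOf, hx, hy, Complex.ofReal_zero, zero_div, sub_zero, norm_zero]
      positivity
    · rw [norm_sub_rev, abs_sub_comm]
      exact norm_propOf_sub_le_of_ne hC₁ hψ hL0 hL hK y x hy
  · exact norm_propOf_sub_le_of_ne hC₁ hψ hL0 hL hK x y hx

end Propagator

/-! ### Values of trees: size and dependence on the external argument -/

/-- The same constants bound the factors and their Lipschitz quotients, so the Leibniz rule costs
only a factor `3`. In the induction over a tree this factor is paid once per vertex and is absorbed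
by replacing `D` with `3 * D`. -/
theorem norm_mul_mul_sub_le {g g' a a' b b' : ℂ} {W A B δ : ℝ} (hg : ‖g - g'‖ ≤ W * δ)
    (hg' : ‖g'‖ ≤ W) (ha : ‖a‖ ≤ A) (ha' : ‖a'‖ ≤ A) (haa : ‖a - a'‖ ≤ A * δ) (hb : ‖b‖ ≤ B)
    (hbb : ‖b - b'‖ ≤ B * δ) : ‖g * a * b - g' * a' * b'‖ ≤ 3 * (W * A * B) * δ := by
  have hW := (norm_nonneg _).trans hg'
  have hA := (norm_nonneg _).trans ha
  have hB := (norm_nonneg _).trans hb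
  have e : g * a * b - g' * a' * b' =
      (g - g') * a * b + g' * (a - a') * b + g' * a' * (b - b') := by ring
  have h1 : ‖(g - g') * a * b‖ ≤ W * δ * A * B := by
    rw [norm_mul, norm_mul]
    have := (norm_nonneg _).trans hg
    gcongr
  have h2 : ‖g' * (a - a') * b‖ ≤ W * (A * δ) * B := by
    rw [norm_mul, norm_mul]
    have := (norm_nonneg _).trans haa
    gcongr
  have h3 : ‖g' * a' * (b - b')‖ ≤ W * A * (B * δ) := by
    rw [norm_mul, norm_mul]
    have := (norm_nonneg _).trans hbb
    gcongr
  rw [e]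
  refine (norm_add₃_le).trans ?_
  linarith

namespace LTree

variable {A : ℕ}

/-- The bound on the value of a tree obtained by estimating the propagators on scale `n` by
`D 4 ^ n`. -/
def valueBound (H : HillData A) (D : ℝ) : LTree A → ℝ
  | ent => 1
  | bullet ν n => D * 4 ^ n * ‖H.R ν‖
  | vertex ν n l r => D * 4 ^ n * ‖H.Q ν‖ * l.valueBound H D * r.valueBound H D

theorem valueBound_nonneg (H : HillData A) {D : ℝ} (hD : 0 ≤ D) (t : LTree A) :
    0 ≤ t.valueBound H D := by
  induction t with
  | ent => exact zero_le_one
  | bullet ν n => simp only [valueBound]; positivity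
  | vertex ν n l r ihl ihr => simp only [valueBound]; positivity

theorem norm_value_le (H : HillData A) {g : ℕ → ℝ → ℂ} {D : ℝ} (hD : 0 ≤ D) (x : ℝ) (t : LTree A)
    (hg : ∀ s ∈ t.scales, ∀ y, ‖g s y‖ ≤ D * 4 ^ s) : ‖t.value H g x‖ ≤ t.valueBound H D := by
  induction t with
  | ent => simp [value, valueBound]
  | bullet ν n =>
    simp only [value, valueBound, norm_mul]
    have := hg n (by simp [scales]) (H.freq ν)
    gcongr
  | vertex ν n l r ihl ihr =>
    simp only [value, valueBound, norm_mul]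
    have h1 := hg n (by simp [scales]) ((vertex ν n l r).arg H x)
    have h2 := ihl fun s hs => hg s (by simp [scales, hs])
    have h3 := ihr fun s hs => hg s (by simp [scales, hs])
    have h4 := valueBound_nonneg H hD l
    gcongr

theorem abs_arg_sub_le (H : HillData A) (x y : ℝ) (t : LTree A) (he : t.numEnt ≤ 1) :
    |t.arg H x - t.arg H y| ≤ |x - y| := by
  rw [arg_eq, arg_eq, add_sub_add_left_eq_sub, ← mul_sub, abs_mul, Nat.abs_cast]
  have : (t.numEnt : ℝ) ≤ 1 := by exact_mod_cast he
  nlinarith [abs_nonneg (x - y)]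

theorem norm_value_sub_le (H : HillData A) {g : ℕ → ℝ → ℂ} {D : ℝ} (hD : 0 ≤ D) (x x' : ℝ)
    (t : LTree A) (he : t.numEnt ≤ 1) (hg : ∀ s ∈ t.scales, ∀ y, ‖g s y‖ ≤ D * 4 ^ s)
    (hgl : ∀ s ∈ t.scales, ∀ y y', ‖g s y - g s y'‖ ≤ D * 4 ^ s * |y - y'|) :
    ‖t.value H g x - t.value H g x'‖ ≤ t.valueBound H (3 * D) * |x - x'| := by
  induction t with
  | ent => simp [value, valueBound]
  | bullet ν n =>
    have := valueBound_nonneg H (D := 3 * D) (by positivity) (bullet ν n)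
    simp only [value, sub_self, norm_zero]
    positivity
  | vertex ν n l r ihl ihr =>
    have hel : l.numEnt ≤ 1 := by simp only [numEnt] at he; omega
    have her : r.numEnt ≤ 1 := by simp only [numEnt] at he; omega
    have hgs : ∀ s ∈ (vertex ν n l r).scales, ∀ y, ‖g s y‖ ≤ 3 * D * 4 ^ s := fun s hs y =>
      (hg s hs y).trans (by gcongr; linarith)
    have hgL : ∀ s ∈ l.scales, ∀ y, ‖g s y‖ ≤ 3 * D * 4 ^ s :=
      fun s hs => hgs s (by simp [scales, hs])
    have hgR : ∀ s ∈ r.scales, ∀ y, ‖g s y‖ ≤ 3 * D * 4 ^ s :=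
      fun s hs => hgs s (by simp [scales, hs])
    have hn : n ∈ (vertex ν n l r).scales := by simp [scales]
    have harg := abs_arg_sub_le H x x' _ he
    have key := norm_mul_mul_sub_le (W := D * 4 ^ n * ‖H.Q ν‖) (δ := |x - x'|)
      (g := g n ((vertex ν n l r).arg H x) * H.Q ν) (g' := g n ((vertex ν n l r).arg H x') * H.Q ν)
      (by
        rw [← sub_mul, norm_mul, mul_right_comm]
        have := hgl n hn ((vertex ν n l r).arg H x) ((vertex ν n l r).arg H x')
        gcongr
        exact this.trans (by gcongr))
      (by
        rw [norm_mul]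
        have := hg n hn ((vertex ν n l r).arg H x')
        gcongr)
      (norm_value_le H (by positivity) x l hgL) (norm_value_le H (by positivity) x' l hgL)
      (ihl hel (fun s hs => hg s (by simp [scales, hs])) fun s hs => hgl s (by simp [scales, hs]))
      (norm_value_le H (by positivity) x r hgR)
      (ihr her (fun s hs => hg s (by simp [scales, hs])) fun s hs => hgl s (by simp [scales, hs]))
    refine key.trans (le_of_eq ?_)
    simp only [valueBound]
    ring

theorem supported_of_value_ne_zero (H : HillData A) {g : ℕ → ℝ → ℂ} {x : ℝ} (t : LTree A)
    (h : t.value H g x ≠ 0) : t.Supported H (fun s y => g s y ≠ 0) x := by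
  induction t with
  | ent => trivial
  | bullet ν n => exact left_ne_zero_of_mul h
  | vertex ν n l r ihl ihr =>
    simp only [value] at h
    exact ⟨left_ne_zero_of_mul (left_ne_zero_of_mul (left_ne_zero_of_mul h)),
      ihl (right_ne_zero_of_mul (left_ne_zero_of_mul h)), ihr (right_ne_zero_of_mul h)⟩

/-- With at most one entering line, the argument of each line moves by no more than `x` does. -/
theorem Supported.of_abs_sub_le {H : HillData A} {good good' : ℕ → ℝ → Prop} {x x' δ : ℝ}
    (hx : |x - x'| ≤ δ) {t : LTree A} (he : t.numEnt ≤ 1)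
    (h : ∀ s ∈ t.scales, ∀ y y', |y - y'| ≤ δ → good s y → good' s y')
    (ht : t.Supported H good x) : t.Supported H good' x' := by
  induction t with
  | ent => trivial
  | bullet ν s =>
    exact h s (by simp [scales]) _ _ (by simpa using (abs_nonneg _).trans hx) ht
  | vertex ν s l r ihl ihr =>
    have hel : l.numEnt ≤ 1 := by simp only [numEnt] at he; omega
    have her : r.numEnt ≤ 1 := by simp only [numEnt] at he; omega
    exact ⟨h s (by simp [scales]) _ _ ((abs_arg_sub_le H x x' _ he).trans hx) ht.1,
      ihl hel (fun s hs => h s (by simp [scales, hs])) ht.2.1,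
      ihr her (fun s hs => h s (by simp [scales, hs])) ht.2.2⟩

theorem weight_eq (H : HillData A) {η D κ B : ℝ} (hη : 0 ≤ η) (hD : 0 ≤ D) (hB : 0 ≤ B)
    (t : LTree A) :
    t.weight (fun ν n => ENNReal.ofReal (η * (D * 4 ^ n * ‖H.Q ν‖) * (1 / 8) ^ n * B *
        Real.exp (κ * ν.l1)))
      (fun ν n => ENNReal.ofReal ((D * 4 ^ n * ‖H.R ν‖) * (1 / 8) ^ n * B *
        Real.exp (κ * ν.l1))) =
    ENNReal.ofReal (η ^ t.order * t.valueBound H D * (1 / 8) ^ t.scaleSum * B ^ t.numLines *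
      Real.exp (κ * t.modeNorm)) := by
  induction t with
  | ent => simp [weight, order, valueBound, scaleSum, numLines, modeNorm]
  | bullet ν n => simp [weight, order, valueBound, scaleSum, numLines, modeNorm]
  | vertex ν n l r ihl ihr =>
    have hl := valueBound_nonneg H hD l
    simp only [weight, order, valueBound, scaleSum, numLines, modeNorm, ihl, ihr]
    rw [← ENNReal.ofReal_mul (by positivity), ← ENNReal.ofReal_mul (by positivity)]
    congr 1
    rw [mul_add, mul_add, Real.exp_add, Real.exp_add]
    ring

end LTree

/-! ### From small divisors to the bound on the sum of scales -/

/-- The coefficients in the bounds on the numbers of lines on large scales. -/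
def countConst (τ₁ : ℝ) (q : ℕ) : ℝ := 2 * (2 : ℝ) ^ ((3 - q : ℝ) / τ₁)

theorem countConst_nonneg (τ₁ : ℝ) (q : ℕ) : 0 ≤ countConst τ₁ q := by
  unfold countConst; positivity

/-- Taking the power `1/τ₁` of a bound `l^{-τ₁} ≤ 2^{3-q}` gives `1 ≤ l 2^{(3-q)/τ₁}`. The `3` makes
room for the factor `8` lost in `DivisorBounds.two_le_of_close`. -/
theorem two_le_countConst_mul {τ₁ τ' l : ℝ} {q : ℕ} (hτ₁ : 0 < τ₁) (h : τ' ≤ τ₁)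
    (hl : 1 ≤ l) (hq : l ^ (-τ') ≤ (2 : ℝ) ^ (3 - q : ℝ)) : 2 ≤ countConst τ₁ q * l := by
  have hl0 : 0 < l := by linarith
  have h1 : l ^ (-τ₁) ≤ (2 : ℝ) ^ (3 - q : ℝ) :=
    (Real.rpow_le_rpow_of_exponent_le hl (by linarith)).trans hq
  have h2 : l ^ (-1 : ℝ) ≤ (2 : ℝ) ^ ((3 - q : ℝ) / τ₁) := by
    have := Real.rpow_le_rpow (by positivity) h1 (by positivity : 0 ≤ 1 / τ₁)
    rw [← Real.rpow_mul hl0.le, ← Real.rpow_mul (by norm_num)] at this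
    convert this using 2
    · field_simp
    · field_simp
  rw [Real.rpow_neg_one, inv_le_iff_one_le_mul₀ hl0] at h2
  unfold countConst
  linarith

theorem rpow_three_sub (q : ℕ) : (2 : ℝ) ^ (3 - q : ℝ) = 8 / 2 ^ q := by
  rw [Real.rpow_sub (by norm_num), Real.rpow_natCast]
  norm_num

section Count

variable {A : ℕ} {H : HillData A} {C₀ τ C₁ τ₁ : ℝ} {K : ℕ → ℝ → ℂ} {n₀ q : ℕ}

/-- The conditions on the small divisors under which the trees are estimated. -/
structure DivisorBounds (H : HillData A) (C₀ τ C₁ τ₁ : ℝ) (n₀ : ℕ) (K : ℕ → ℝ → ℂ) : Prop where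
  C₁_pos : 0 < C₁
  C₁_lt : C₁ < C₀
  τ_pos : 0 < τ
  τ_lt : τ < τ₁
  dio : H.IsDiophantine C₀ τ
  adm : ∀ ν : Mode A, ν ≠ 0 → ∀ j, n₀ ≤ j → C₁ * ν.l1 ^ (-τ₁) ≤ divisor K j (H.freq ν)

/-- The argument of a line on scale `s` satisfies the support conditions of the propagator, up to a
factor `2`. -/
def IsGood (C₁ : ℝ) (n₀ : ℕ) (K : ℕ → ℝ → ℂ) (s : ℕ) (y : ℝ) : Prop :=
  ∀ j, n₀ ≤ j → j < s → 2 ^ j * divisor K j y ≤ 2 * C₁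

theorem DivisorBounds.two_le_of_small (hB : DivisorBounds H C₀ τ C₁ τ₁ n₀ K) (hq : n₀ ≤ q)
    {ν : Mode A} (hν : ν ≠ 0) (h : 2 ^ q * divisor K q (H.freq ν) ≤ 2 * C₁) :
    2 ≤ countConst τ₁ q * ν.l1 := by
  have h1 := hB.adm ν hν q hq
  have hC := hB.C₁_pos
  refine two_le_countConst_mul (hB.τ_pos.trans hB.τ_lt) le_rfl (Mode.one_le_l1 hν) ?_
  have h2 : (0 : ℝ) < 2 ^ q := by positivity
  rw [rpow_three_sub, le_div_iff₀ h2]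
  have := mul_le_mul_of_nonneg_left h1 h2.le
  nlinarith

/-- Both divisors are at most `2 C₁ / 2^q`, so the Lipschitz bound on `K q` gives `|ω · ν| ≤ 8 C₁ /
2^q`. The unperturbed Diophantine condition then applies, since `C₁ < C₀`. -/
theorem DivisorBounds.two_le_of_close (hB : DivisorBounds H C₀ τ C₁ τ₁ n₀ K)
    (hK : ∀ x y, ‖K q x - K q y‖ ≤ 1 / 2 * |x - y|) {ν : Mode A} (hν : ν ≠ 0) {y : ℝ}
    (hy : 2 ^ q * divisor K q y ≤ 2 * C₁)
    (hy' : 2 ^ q * divisor K q (H.freq ν + y) ≤ 2 * C₁) :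
    2 ≤ countConst τ₁ q * ν.l1 := by
  have h1 := abs_sub_le_divisor hK (H.freq ν + y) y
  have h3 := hB.dio ν hν
  rw [add_sub_cancel_right] at h1
  have hC := hB.C₁_pos
  have hC' := hB.C₁_lt
  refine two_le_countConst_mul (hB.τ_pos.trans hB.τ_lt) hB.τ_lt.le (Mode.one_le_l1 hν) ?_
  have h2 : (0 : ℝ) < 2 ^ q := by positivity
  rw [rpow_three_sub, le_div_iff₀ h2]
  have h4 := mul_le_mul_of_nonneg_left (h3.trans h1) h2.le
  have h5 : 0 ≤ ν.l1 ^ (-τ) := Real.rpow_nonneg ν.l1_nonneg _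
  have h6 : C₁ * (ν.l1 ^ (-τ) * 2 ^ q) ≤ C₀ * (ν.l1 ^ (-τ) * 2 ^ q) := by gcongr
  nlinarith

/-- The bound on the sum of the scales of a tree without self-energy graphs. -/
theorem DivisorBounds.scaleSum_le (hB : DivisorBounds H C₀ τ C₁ τ₁ n₀ K) {γ x : ℝ}
    (hγ : ∀ n, ∑ q ∈ Finset.Ico n₀ n, countConst τ₁ q ≤ γ) (t : LTree A)
    (he : t.numEnt ≤ 1)
    (hK : ∀ q, (∃ s ∈ t.scales, q < s) → ∀ x y, ‖K q x - K q y‖ ≤ 1 / 2 * |x - y|)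
    (hx : 0 < t.numEnt → ∀ q, n₀ ≤ q → (∃ s ∈ t.scales, q < s) →
      2 ^ q * divisor K q x ≤ 2 * C₁)
    (hP : t.Supported H (IsGood C₁ n₀ K) x) (hm : t.NonzeroMomenta)
    (hs : ¬ t.ContainsSelfEnergy) (h0 : ∀ s ∈ t.scales, n₀ ≤ s) :
    (t.scaleSum : ℝ) ≤ n₀ * t.numLines + γ * t.modeNorm := by
  refine LTree.scaleSum_le hγ t h0 (fun q hq hqs => ?_) (countConst_nonneg τ₁)
  exact LTree.numAbove_le (P := fun y => 2 ^ q * divisor K q y ≤ 2 * C₁) (x := x) H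
    (countConst_nonneg τ₁ q) (fun ν hν h => hB.two_le_of_small hq hν h)
    (fun ν hν y hy hy' => hB.two_le_of_close (hK q hqs) hν hy hy') t he
    (fun h => hx h q hq hqs) (hP.imp fun s y hsy hlt => hsy q hq hlt) hm hs

/-- The value of a tree without self-energy graphs, together with an additional weight for large
scales and large modes, is estimated by a product over its nodes. -/
theorem DivisorBounds.ofReal_valueBound_le (hB : DivisorBounds H C₀ τ C₁ τ₁ n₀ K)
    {γ x κ η D : ℝ} (hη : 0 ≤ η) (hD : 0 ≤ D)
    (hγ : ∀ n, ∑ q ∈ Finset.Ico n₀ n, countConst τ₁ q ≤ γ) (hκ : Real.log 64 * γ ≤ κ)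
    (t : LTree A) (he : t.numEnt ≤ 1)
    (hK : ∀ q, (∃ s ∈ t.scales, q < s) → ∀ x y, ‖K q x - K q y‖ ≤ 1 / 2 * |x - y|)
    (hx : 0 < t.numEnt → ∀ q, n₀ ≤ q → (∃ s ∈ t.scales, q < s) →
      2 ^ q * divisor K q x ≤ 2 * C₁)
    (hP : t.Supported H (IsGood C₁ n₀ K) x) (hm : t.NonzeroMomenta)
    (hs : ¬ t.ContainsSelfEnergy) (h0 : ∀ s ∈ t.scales, n₀ ≤ s) :
    ENNReal.ofReal (η ^ t.order * t.valueBound H D * 8 ^ t.scaleSum *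
      Real.exp (κ * t.modeNorm)) ≤
    t.weight (fun ν n => ENNReal.ofReal (η * (D * 4 ^ n * ‖H.Q ν‖) * (1 / 8) ^ n * 64 ^ n₀ *
        Real.exp (2 * κ * ν.l1)))
      (fun ν n => ENNReal.ofReal ((D * 4 ^ n * ‖H.R ν‖) * (1 / 8) ^ n * 64 ^ n₀ *
        Real.exp (2 * κ * ν.l1))) := by
  rw [LTree.weight_eq H hη hD (by positivity)]
  refine ENNReal.ofReal_le_ofReal ?_
  have h1 := hB.scaleSum_le hγ t he hK hx hP hm hs h0
  have hM := t.modeNorm_nonneg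
  have hv := t.valueBound_nonneg H hD
  -- The scale-sum bound is exponentiated: `n₀` per line becomes `64^{n₀}` per line, and `log 64 * γ
  -- ≤ κ` absorbs the rest.
  have h2 : (64 : ℝ) ^ t.scaleSum ≤ (64 ^ n₀) ^ t.numLines * Real.exp (κ * t.modeNorm) := by
    have e : ∀ k : ℕ, (64 : ℝ) ^ k = Real.exp (Real.log 64 * k) := fun k => by
      rw [mul_comm, Real.exp_nat_mul, Real.exp_log (by norm_num)]
    rw [← pow_mul, e, e, ← Real.exp_add, Real.exp_le_exp]
    have hlog : 0 ≤ Real.log 64 := Real.log_nonneg (by norm_num)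
    have h3 := mul_le_mul_of_nonneg_left h1 hlog
    have h4 := mul_le_mul_of_nonneg_right hκ hM
    push_cast
    linarith
  -- One of the two factors `8` in `64` is the gain kept in the statement; the other pays for the
  -- `(1/8)^n` in the weights.
  have e8 : (8 : ℝ) ^ t.scaleSum = (1 / 8) ^ t.scaleSum * 64 ^ t.scaleSum := by
    rw [← mul_pow]; norm_num
  have e2 : Real.exp (2 * κ * t.modeNorm) =
      Real.exp (κ * t.modeNorm) * Real.exp (κ * t.modeNorm) := by
    rw [← Real.exp_add]; ring_nf
  rw [e8, e2]
  calc _ = η ^ t.order * t.valueBound H D * (1 / 8) ^ t.scaleSum * 64 ^ t.scaleSum *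
        Real.exp (κ * t.modeNorm) := by ring
    _ ≤ η ^ t.order * t.valueBound H D * (1 / 8) ^ t.scaleSum *
        ((64 ^ n₀) ^ t.numLines * Real.exp (κ * t.modeNorm)) * Real.exp (κ * t.modeNorm) := by
      gcongr
    _ = _ := by ring

end Count

/-! ### Sums over self-energy graphs -/

theorem summable_and_tsum_le_of_ofReal {ι : Type*} {f : ι → ℝ} {c : ℝ} (hf : ∀ i, 0 ≤ f i)
    (hc : 0 ≤ c) (h : ∑' i, ENNReal.ofReal (f i) ≤ ENNReal.ofReal c) :
    Summable f ∧ ∑' i, f i ≤ c := by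
  have hs : Summable f := by
    have h1 := ENNReal.summable_toReal (ne_top_of_le_ne_top ENNReal.ofReal_ne_top h)
    simpa [ENNReal.toReal_ofReal, hf] using h1
  refine ⟨hs, ?_⟩
  rwa [← ENNReal.ofReal_tsum_of_nonneg hf hs, ENNReal.ofReal_le_ofReal_iff hc] at h

/-- The segment is divided into pieces shorter than `δ`. This is needed because the support
conditions are only stable under displacements of order `2^{-n}`, while the Lipschitz bound has to
be global with the same constant. -/
theorem norm_sub_le_of_local {f : ℝ → ℂ} {c δ : ℝ} (hδ : 0 < δ)
    (h : ∀ x y, |x - y| ≤ δ → ‖f x - f y‖ ≤ c * |x - y|) (x y : ℝ) :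
    ‖f x - f y‖ ≤ c * |x - y| := by
  have key : ∀ N : ℕ, ∀ x y, |x - y| ≤ N * δ → ‖f x - f y‖ ≤ c * |x - y| := by
    intro N
    induction N with
    | zero => exact fun x y hxy => h x y (by simp at hxy; simpa [hxy] using hδ.le)
    | succ N ih =>
      intro x y hxy
      push_cast at hxy
      have hN : (0 : ℝ) < N + 1 := by positivity
      set z := x + (y - x) * (N / (N + 1)) with hz
      have e1 : |x - z| = |x - y| * (N / (N + 1)) := by
        rw [hz, show x - (x + (y - x) * (N / (N + 1))) = (x - y) * (N / (N + 1) : ℝ) by ring,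
          abs_mul, abs_of_nonneg (by positivity : (0 : ℝ) ≤ N / (N + 1))]
      have e2 : |z - y| = |x - y| * (1 / (N + 1)) := by
        rw [hz, show x + (y - x) * (N / (N + 1)) - y = (x - y) * (1 / (N + 1) : ℝ) by
          field_simp; ring, abs_mul, abs_of_nonneg (by positivity : (0 : ℝ) ≤ 1 / (N + 1))]
      have h1 := ih x z (by
        rw [e1, mul_div_assoc', div_le_iff₀ hN]
        have := mul_le_mul_of_nonneg_right hxy (by positivity : (0 : ℝ) ≤ N)
        nlinarith)
      have h2 := h z y (by
        rw [e2, mul_one_div, div_le_iff₀ hN]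
        linarith)
      have h3 : |x - z| + |z - y| = |x - y| := by
        rw [e1, e2]; field_simp
      calc ‖f x - f y‖ ≤ ‖f x - f z‖ + ‖f z - f y‖ := norm_sub_le_norm_sub_add_norm_sub _ _ _
        _ ≤ c * |x - z| + c * |z - y| := add_le_add h1 h2
        _ = c * |x - y| := by rw [← mul_add, h3]
  obtain ⟨N, hN⟩ := exists_nat_ge (|x - y| / δ)
  exact key N x y (by rwa [div_le_iff₀ hδ] at hN)

/-- The weight of a vertex. -/
def vertexWeight {A : ℕ} (H : HillData A) (D κ η : ℝ) (n₀ : ℕ) (ν : Mode A) (n : ℕ) : ℝ≥0∞ :=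
  ENNReal.ofReal (η * (D * 4 ^ n * ‖H.Q ν‖) * (1 / 8) ^ n * 64 ^ n₀ * Real.exp (2 * κ * ν.l1))

/-- The weight of a bullet. -/
def bulletWeight {A : ℕ} (H : HillData A) (D κ : ℝ) (n₀ : ℕ) (ν : Mode A) (n : ℕ) : ℝ≥0∞ :=
  ENNReal.ofReal ((D * 4 ^ n * ‖H.R ν‖) * (1 / 8) ^ n * 64 ^ n₀ * Real.exp (2 * κ * ν.l1))

/-- The weight of a tree. -/
def treeWeight {A : ℕ} (H : HillData A) (D κ η : ℝ) (n₀ : ℕ) (t : LTree A) : ℝ≥0∞ :=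
  t.weight (vertexWeight H D κ η n₀) (bulletWeight H D κ n₀)

/-- The hypotheses on the parameters under which the sums over trees converge. -/
structure TreeBounds {A : ℕ} (H : HillData A) (D κ η : ℝ) (n₀ : ℕ) (τ₁ γ θ : ℝ) (S W : ℝ≥0∞) :
    Prop where
  D_nonneg : 0 ≤ D
  η_nonneg : 0 ≤ η
  κ_nonneg : 0 ≤ κ
  θ_nonneg : 0 ≤ θ
  sum_countConst : ∀ n, ∑ q ∈ Finset.Ico n₀ n, countConst τ₁ q ≤ γ
  log_mul_le : Real.log 64 * γ ≤ κ
  tsum_Q : ∑' ν : Mode A, ENNReal.ofReal ‖H.Q ν‖ ≤ S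
  tsum_treeWeight : ∑' t : LTree A, treeWeight H D κ η n₀ t ≤ W
  small : ENNReal.ofReal η * S * W * W ≤ ENNReal.ofReal θ

section SelfEnergy

variable {A : ℕ} {H : HillData A} {C₀ τ C₁ τ₁ : ℝ} {K : ℕ → ℝ → ℂ} {n₀ n : ℕ}
  {D κ η γ θ : ℝ} {S W : ℝ≥0∞}

/-- The self-energy graphs on scale `n`, of all orders. -/
abbrev SelfEnergies (A n₀ n : ℕ) : Type := Σ k : ℕ, renSelfEnergies A n₀ k n

/-- The bound on the value of a subgraph. -/
def Subgraph.valueBound (H : HillData A) (D η : ℝ) (T : Subgraph A) : ℝ :=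
  η ^ T.order * (‖H.Q T.mode‖ * T.left.valueBound H D * T.right.valueBound H D)

theorem Subgraph.valueBound_nonneg (hD : 0 ≤ D) (hη : 0 ≤ η) (T : Subgraph A) :
    0 ≤ T.valueBound H D η := by
  have h1 := T.left.valueBound_nonneg H hD
  have h2 := T.right.valueBound_nonneg H hD
  unfold Subgraph.valueBound
  positivity

/-- All lines of the subgraph satisfy the support conditions. -/
def Subgraph.IsSupported (H : HillData A) (C₁ : ℝ) (n₀ : ℕ) (K : ℕ → ℝ → ℂ) (x : ℝ)
    (T : Subgraph A) : Prop :=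
  T.left.Supported H (IsGood C₁ n₀ K) x ∧ T.right.Supported H (IsGood C₁ n₀ K) x

open scoped Classical in
/-- The bound on the value of a subgraph, which takes into account the support conditions. -/
def Subgraph.majorant (H : HillData A) (C₁ : ℝ) (n₀ : ℕ) (K : ℕ → ℝ → ℂ) (D η x : ℝ)
    (T : Subgraph A) : ℝ :=
  if T.IsSupported H C₁ n₀ K x then T.valueBound H D η else 0

theorem Subgraph.majorant_nonneg (hD : 0 ≤ D) (hη : 0 ≤ η) (x : ℝ) (T : Subgraph A) :
    0 ≤ T.majorant H C₁ n₀ K D η x := by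
  unfold Subgraph.majorant
  split_ifs
  · exact T.valueBound_nonneg hD hη
  · exact le_rfl

/-- Some line of the graph has scale `n`, so `8^n` is at most the product of `8` to the scales of
all lines, which is the gain available in the tree estimate. That estimate is applied to the two
branches at the top vertex, one of which carries the entering line; `hx` says that this line also
counts as one with small divisors. -/
theorem TreeBounds.ofReal_majorant_le (hT : TreeBounds H D κ η n₀ τ₁ γ θ S W)
    (hB : DivisorBounds H C₀ τ C₁ τ₁ n₀ K)
    (hK : ∀ j ≤ n, ∀ x y, ‖K j x - K j y‖ ≤ 1 / 2 * |x - y|) {x : ℝ}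
    (hx : ∀ q, n₀ ≤ q → q ≤ n → 2 ^ q * divisor K q x ≤ 2 * C₁) {k : ℕ} {T : Subgraph A}
    (hTm : T ∈ renSelfEnergies A n₀ k n) :
    ENNReal.ofReal (8 ^ n * T.majorant H C₁ n₀ K D η x) ≤
      ENNReal.ofReal η * ENNReal.ofReal ‖H.Q T.mode‖ * treeWeight H D κ η n₀ T.left *
        treeWeight H D κ η n₀ T.right := by
  unfold Subgraph.majorant
  split_ifs with hsupp
  swap
  · simp
  obtain ⟨⟨hle, hn, he, -⟩, -, hml, hmr, h0, -, hsl, hsr⟩ := hTm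
  have hmem : ∀ s ∈ T.left.scales, s ∈ T.scales := fun s hs => Finset.mem_union_left _ hs
  have hmem' : ∀ s ∈ T.right.scales, s ∈ T.scales := fun s hs => Finset.mem_union_right _ hs
  have hl := hB.ofReal_valueBound_le (κ := κ) (η := η) (D := D) (x := x) hT.η_nonneg hT.D_nonneg
    hT.sum_countConst hT.log_mul_le
    T.left (by omega) (fun q ⟨s, hs, hqs⟩ => hK q (hqs.le.trans (hle s (hmem s hs))))
    (fun _ q hq ⟨s, hs, hqs⟩ => hx q hq (hqs.le.trans (hle s (hmem s hs)))) hsupp.1 hml hsl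
    fun s hs => h0 s (hmem s hs)
  have hr := hB.ofReal_valueBound_le (κ := κ) (η := η) (D := D) (x := x) hT.η_nonneg hT.D_nonneg
    hT.sum_countConst hT.log_mul_le
    T.right (by omega) (fun q ⟨s, hs, hqs⟩ => hK q (hqs.le.trans (hle s (hmem' s hs))))
    (fun _ q hq ⟨s, hs, hqs⟩ => hx q hq (hqs.le.trans (hle s (hmem' s hs)))) hsupp.2 hmr hsr
    fun s hs => h0 s (hmem' s hs)
  have hη := hT.η_nonneg
  have hvl := T.left.valueBound_nonneg H hT.D_nonneg
  have hvr := T.right.valueBound_nonneg H hT.D_nonneg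
  have hnle : n ≤ T.left.scaleSum + T.right.scaleSum := by
    rcases Finset.mem_union.1 hn with h | h
    · exact (T.left.le_scaleSum n h).trans (Nat.le_add_right _ _)
    · exact (T.right.le_scaleSum n h).trans (Nat.le_add_left _ _)
  refine le_trans ?_ (mul_le_mul' (mul_le_mul' le_rfl hl) hr)
  rw [← ENNReal.ofReal_mul hη, ← ENNReal.ofReal_mul (by positivity),
    ← ENNReal.ofReal_mul (by positivity)]
  refine ENNReal.ofReal_le_ofReal ?_
  have h8 : (8 : ℝ) ^ n ≤ 8 ^ T.left.scaleSum * 8 ^ T.right.scaleSum := by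
    rw [← pow_add]; exact pow_le_pow_right₀ (by norm_num) hnle
  have hel : 1 ≤ Real.exp (κ * T.left.modeNorm) :=
    Real.one_le_exp (mul_nonneg hT.κ_nonneg T.left.modeNorm_nonneg)
  have her : 1 ≤ Real.exp (κ * T.right.modeNorm) :=
    Real.one_le_exp (mul_nonneg hT.κ_nonneg T.right.modeNorm_nonneg)
  have hee : 1 ≤ Real.exp (κ * T.left.modeNorm) * Real.exp (κ * T.right.modeNorm) :=
    one_le_mul_of_one_le_of_one_le hel her
  unfold Subgraph.valueBound Subgraph.order
  calc 8 ^ n * (η ^ (1 + T.left.order + T.right.order) *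
        (‖H.Q T.mode‖ * T.left.valueBound H D * T.right.valueBound H D))
      ≤ (8 ^ T.left.scaleSum * 8 ^ T.right.scaleSum) *
        (η ^ (1 + T.left.order + T.right.order) *
        (‖H.Q T.mode‖ * T.left.valueBound H D * T.right.valueBound H D)) *
        (Real.exp (κ * T.left.modeNorm) * Real.exp (κ * T.right.modeNorm)) := by
        refine le_trans ?_ (le_mul_of_one_le_right (by positivity) hee)
        gcongr
    _ = _ := by ring

/-- A self-energy graph is determined by the mode of its top vertex and its two branches. The sum is
thus dominated by a sum over independent triples, which factorizes. -/
theorem TreeBounds.tsum_majorant (hT : TreeBounds H D κ η n₀ τ₁ γ θ S W)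
    (hB : DivisorBounds H C₀ τ C₁ τ₁ n₀ K)
    (hK : ∀ j ≤ n, ∀ x y, ‖K j x - K j y‖ ≤ 1 / 2 * |x - y|) {x : ℝ}
    (hx : ∀ q, n₀ ≤ q → q ≤ n → 2 ^ q * divisor K q x ≤ 2 * C₁) :
    Summable (fun T : SelfEnergies A n₀ n => T.2.1.majorant H C₁ n₀ K D η x) ∧
      ∑' T : SelfEnergies A n₀ n, T.2.1.majorant H C₁ n₀ K D η x ≤ θ * (1 / 8) ^ n := by
  have hnn := fun T : SelfEnergies A n₀ n =>
    T.2.1.majorant_nonneg (H := H) (C₁ := C₁) (n₀ := n₀) (K := K) hT.D_nonneg hT.η_nonneg x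
  have key : ∑' T : SelfEnergies A n₀ n,
      ENNReal.ofReal (8 ^ n * T.2.1.majorant H C₁ n₀ K D η x) ≤ ENNReal.ofReal θ := by
    set F : Mode A × LTree A × LTree A → ℝ≥0∞ := fun p =>
      ENNReal.ofReal η * ENNReal.ofReal ‖H.Q p.1‖ * treeWeight H D κ η n₀ p.2.1 *
        treeWeight H D κ η n₀ p.2.2 with hF
    set e : SelfEnergies A n₀ n → Mode A × LTree A × LTree A := fun T =>
      (T.2.1.mode, T.2.1.left, T.2.1.right) with he
    -- The order is determined by the subgraph, so that summing over all orders counts nothing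
    -- twice.
    have hinj : Function.Injective e := by
      rintro ⟨k, ⟨⟨m, l, r⟩, h⟩⟩ ⟨k', ⟨⟨m', l', r'⟩, h'⟩⟩ heq
      simp only [he, Prod.mk.injEq] at heq
      obtain ⟨rfl, rfl, rfl⟩ := heq
      have : k = k' := h.2.1.symm.trans h'.2.1
      subst this
      rfl
    calc _ ≤ ∑' T : SelfEnergies A n₀ n, F (e T) :=
          ENNReal.tsum_le_tsum fun T => hT.ofReal_majorant_le hB hK hx T.2.2
      _ ≤ ∑' p, F p := ENNReal.tsum_comp_le_tsum_of_injective hinj F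
      _ = ENNReal.ofReal η * (∑' ν : Mode A, ENNReal.ofReal ‖H.Q ν‖) *
          (∑' t : LTree A, treeWeight H D κ η n₀ t) *
          (∑' t : LTree A, treeWeight H D κ η n₀ t) := by
          have h : ∀ ν, ∑' p, F (ν, p) = ENNReal.ofReal η * ENNReal.ofReal ‖H.Q ν‖ *
              (∑' t : LTree A, treeWeight H D κ η n₀ t) *
              (∑' t : LTree A, treeWeight H D κ η n₀ t) := fun ν => by
            rw [ENNReal.tsum_prod']
            simp only [hF, ENNReal.tsum_mul_left, ENNReal.tsum_mul_right]
          rw [ENNReal.tsum_prod']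
          simp only [h, ENNReal.tsum_mul_left, ENNReal.tsum_mul_right]
      _ ≤ ENNReal.ofReal η * S * W * W :=
          mul_le_mul' (mul_le_mul' (mul_le_mul' le_rfl hT.tsum_Q) hT.tsum_treeWeight)
            hT.tsum_treeWeight
      _ ≤ ENNReal.ofReal θ := hT.small
  obtain ⟨h1, h2⟩ := summable_and_tsum_le_of_ofReal
    (fun T => mul_nonneg (by positivity) (hnn T)) hT.θ_nonneg key
  have h8 : (8 : ℝ) ^ n ≠ 0 := by positivity
  refine ⟨(summable_mul_left_iff h8).1 h1, ?_⟩
  rw [tsum_mul_left] at h2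
  rw [one_div, inv_pow, ← div_eq_mul_inv, le_div_iff₀ (by positivity)]
  linarith

end SelfEnergy

/-! ### Bounds on the self-energies `M^{[n]}` -/

section Mass

variable {A : ℕ} {H : HillData A} {C₀ τ C₁ τ₁ : ℝ} {ψ : ℝ → ℝ} {K : ℕ → ℝ → ℂ} {n₀ n : ℕ}
  {L κ ε γ θ : ℝ} {S W : ℝ≥0∞}

/-- On the support of the propagator the divisors obey `2^j * divisor < C₁`. A displacement of at
most `C₁/2 · 2^{-n}` adds at most `3/4 · C₁` to the left side, which stays below the relaxed
threshold `2 C₁`. -/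
theorem isGood_of_propOf_ne_zero (hC₁ : 0 < C₁) (hψ : IsCutoff C₁ ψ) {s : ℕ} (hs : s ≤ n)
    (hK : ∀ j ≤ n, ∀ x y, ‖K j x - K j y‖ ≤ 1 / 2 * |x - y|) {y y' : ℝ}
    (hy : |y - y'| ≤ C₁ / 2 * (1 / 2) ^ n) (h : propOf ψ n₀ K s y ≠ 0) :
    IsGood C₁ n₀ K s y' := by
  intro j h1 h2
  have h3 := divisor_lt_of_propOf_ne_zero hψ h j h1 h2
  have h4 := divisor_le_add (hK j (by omega)) y' y
  rw [abs_sub_comm] at hy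
  have h5 : (2 : ℝ) ^ j * |y' - y| ≤ C₁ / 2 := by
    calc (2 : ℝ) ^ j * |y' - y| ≤ 2 ^ n * (C₁ / 2 * (1 / 2) ^ n) := by
          gcongr
          · norm_num
          · omega
      _ = C₁ / 2 * (2 * (1 / 2)) ^ n := by rw [mul_pow]; ring
      _ = C₁ / 2 := by norm_num
  have h6 := mul_le_mul_of_nonneg_left h4 (by positivity : (0 : ℝ) ≤ 2 ^ j)
  nlinarith

theorem Subgraph.isSupported_of_value_ne_zero (hC₁ : 0 < C₁) (hψ : IsCutoff C₁ ψ)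
    (hK : ∀ j ≤ n, ∀ x y, ‖K j x - K j y‖ ≤ 1 / 2 * |x - y|) {k : ℕ} {T : Subgraph A}
    (hT : T ∈ renSelfEnergies A n₀ k n) {x x' : ℝ} (hx : |x - x'| ≤ C₁ / 2 * (1 / 2) ^ n)
    (h : T.value H (propOf ψ n₀ K) ε x ≠ 0) : T.IsSupported H C₁ n₀ K x' := by
  obtain ⟨⟨hle, -, he, -⟩, -⟩ := hT
  have h1 := right_ne_zero_of_mul h
  refine ⟨(LTree.supported_of_value_ne_zero H _ (right_ne_zero_of_mul
    (left_ne_zero_of_mul h1))).of_abs_sub_le hx (by omega) fun s hs y y' hy =>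
      isGood_of_propOf_ne_zero hC₁ hψ (hle s (Finset.mem_union_left _ hs)) hK hy,
    (LTree.supported_of_value_ne_zero H _ (right_ne_zero_of_mul h1)).of_abs_sub_le hx (by omega)
      fun s hs y y' hy =>
      isGood_of_propOf_ne_zero hC₁ hψ (hle s (Finset.mem_union_right _ hs)) hK hy⟩

theorem Subgraph.norm_value_le_majorant (hC₁ : 0 < C₁) (hψ : IsCutoff C₁ ψ) (hL0 : 0 ≤ L)
    (hK : ∀ j ≤ n, ∀ x y, ‖K j x - K j y‖ ≤ 1 / 2 * |x - y|) {k : ℕ} {T : Subgraph A}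
    (hT : T ∈ renSelfEnergies A n₀ k n) (x : ℝ) :
    ‖T.value H (propOf ψ n₀ K) ε x‖ ≤ T.majorant H C₁ n₀ K (3 * propConst C₁ L) |ε| x := by
  have hD := propConst_nonneg hC₁ hL0
  by_cases h : T.value H (propOf ψ n₀ K) ε x = 0
  · rw [h, norm_zero]
    exact T.majorant_nonneg (by positivity) (abs_nonneg _) x
  · have hs := T.isSupported_of_value_ne_zero hC₁ hψ hK hT (x' := x)
      (by rw [sub_self, abs_zero]; positivity) h
    have hg : ∀ s y, ‖propOf ψ n₀ K s y‖ ≤ 3 * propConst C₁ L * 4 ^ s := fun s y =>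
      (norm_propOf_le' hC₁ hψ hL0 y).trans (by gcongr; linarith)
    rw [Subgraph.majorant, if_pos hs, Subgraph.value, Subgraph.valueBound, norm_mul, norm_pow,
      Complex.norm_real, Real.norm_eq_abs, norm_mul, norm_mul]
    have h1 := LTree.norm_value_le H (by positivity) x T.left fun s _ => hg s
    have h2 := LTree.norm_value_le H (by positivity) x T.right fun s _ => hg s
    have h3 := T.left.valueBound_nonneg H (D := 3 * propConst C₁ L) (by positivity)
    gcongr

/-- A graph that fails even the relaxed support condition at `x` has value zero at `x` and at all
nearby points. Hence one majorant, taken at `x`, controls the difference, and it has already been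
summed. -/
theorem Subgraph.norm_value_sub_le_majorant (hC₁ : 0 < C₁) (hψ : IsCutoff C₁ ψ) (hL0 : 0 ≤ L)
    (hL : ∀ x y, |ψ x - ψ y| ≤ L * |x - y|)
    (hK : ∀ j ≤ n, ∀ x y, ‖K j x - K j y‖ ≤ 1 / 2 * |x - y|) {k : ℕ} {T : Subgraph A}
    (hT : T ∈ renSelfEnergies A n₀ k n) {x x' : ℝ} (hx : |x - x'| ≤ C₁ / 2 * (1 / 2) ^ n) :
    ‖T.value H (propOf ψ n₀ K) ε x - T.value H (propOf ψ n₀ K) ε x'‖ ≤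
      3 * T.majorant H C₁ n₀ K (3 * propConst C₁ L) |ε| x * |x - x'| := by
  have hD := propConst_nonneg hC₁ hL0
  by_cases hs : T.IsSupported H C₁ n₀ K x
  · have hg : ∀ s y, ‖propOf ψ n₀ K s y‖ ≤ propConst C₁ L * 4 ^ s := fun s y =>
      norm_propOf_le' hC₁ hψ hL0 y
    have hg3 : ∀ s y, ‖propOf ψ n₀ K s y‖ ≤ 3 * propConst C₁ L * 4 ^ s := fun s y =>
      (hg s y).trans (by gcongr; linarith)
    have hgl : ∀ s ∈ T.scales, ∀ y y', ‖propOf ψ n₀ K s y - propOf ψ n₀ K s y'‖ ≤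
        propConst C₁ L * 4 ^ s * |y - y'| := fun s hs => norm_propOf_sub_le hC₁ hψ hL0 hL
      fun j hj => hK j (hj.trans (hT.1.1 s hs))
    have he := hT.1.2.2.1
    rw [Subgraph.majorant, if_pos hs, Subgraph.value, Subgraph.value, Subgraph.valueBound,
      ← mul_sub, norm_mul, norm_pow, Complex.norm_real, Real.norm_eq_abs]
    have key := norm_mul_mul_sub_le (g := H.Q T.mode) (g' := H.Q T.mode) (W := ‖H.Q T.mode‖)
      (δ := |x - x'|) (by rw [sub_self, norm_zero]; positivity) le_rfl
      (LTree.norm_value_le H (by positivity) x T.left fun s _ => hg3 s)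
      (LTree.norm_value_le H (by positivity) x' T.left fun s _ => hg3 s)
      (LTree.norm_value_sub_le H hD x x' T.left (by omega) (fun s _ => hg s)
        fun s hs => hgl s (Finset.mem_union_left _ hs))
      (LTree.norm_value_le H (by positivity) x T.right fun s _ => hg3 s)
      (LTree.norm_value_sub_le H hD x x' T.right (by omega) (fun s _ => hg s)
        fun s hs => hgl s (Finset.mem_union_right _ hs))
    calc _ ≤ |ε| ^ T.order * _ := mul_le_mul_of_nonneg_left key (by positivity)
      _ = _ := by ring
  · have hC : 0 ≤ C₁ / 2 * (1 / 2) ^ n := by positivity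
    have h1 : T.value H (propOf ψ n₀ K) ε x = 0 := by
      by_contra h
      exact hs (T.isSupported_of_value_ne_zero hC₁ hψ hK hT (by rwa [sub_self, abs_zero]) h)
    have h2 : T.value H (propOf ψ n₀ K) ε x' = 0 := by
      by_contra h
      exact hs (T.isSupported_of_value_ne_zero hC₁ hψ hK hT (by rwa [abs_sub_comm]) h)
    rw [h1, h2, sub_zero, norm_zero]
    have := T.majorant_nonneg (H := H) (C₁ := C₁) (n₀ := n₀) (K := K)
      (D := 3 * propConst C₁ L) (by positivity) (abs_nonneg ε) x
    positivity

/-- The external argument is not that of a propagator of the graph; it is `Ξ_n(x) ≠ 0` that makes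
its divisors small on all scales up to `n`, as the counting requires. -/
theorem TreeBounds.summable_value (hT : TreeBounds H (3 * propConst C₁ L) κ |ε| n₀ τ₁ γ θ S W)
    (hB : DivisorBounds H C₀ τ C₁ τ₁ n₀ K) (hψ : IsCutoff C₁ ψ) (hL0 : 0 ≤ L)
    (hK : ∀ j ≤ n, ∀ x y, ‖K j x - K j y‖ ≤ 1 / 2 * |x - y|) {x : ℝ}
    (hx : XiOf ψ n₀ K n x ≠ 0) :
    Summable fun T : SelfEnergies A n₀ n => T.2.1.value H (propOf ψ n₀ K) ε x := by
  have hC₁ := hB.C₁_pos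
  refine Summable.of_norm_bounded (hT.tsum_majorant hB hK (x := x) fun q h1 h2 => ?_).1
    fun T => T.2.1.norm_value_le_majorant hC₁ hψ hL0 hK T.2.2 x
  have := divisor_lt_of_XiOf_ne_zero hψ hx q h1 h2
  linarith

theorem TreeBounds.norm_massOf_le (hT : TreeBounds H (3 * propConst C₁ L) κ |ε| n₀ τ₁ γ θ S W)
    (hB : DivisorBounds H C₀ τ C₁ τ₁ n₀ K) (hψ : IsCutoff C₁ ψ) (hL0 : 0 ≤ L)
    (hK : ∀ j ≤ n, ∀ x y, ‖K j x - K j y‖ ≤ 1 / 2 * |x - y|) {x : ℝ}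
    (hx : XiOf ψ n₀ K n x ≠ 0) : ‖massOf H ψ n₀ ε K n x‖ ≤ θ * (1 / 8) ^ n := by
  have hC₁ := hB.C₁_pos
  have h1 := hT.tsum_majorant hB hK (x := x) fun q h1 h2 => by
    have := divisor_lt_of_XiOf_ne_zero hψ hx q h1 h2
    linarith
  rw [massOf, ← (hT.summable_value hB hψ hL0 hK hx).tsum_sigma]
  exact (tsum_of_norm_bounded h1.1.hasSum fun T =>
    T.2.1.norm_value_le_majorant hC₁ hψ hL0 hK T.2.2 x).trans h1.2

theorem TreeBounds.norm_massOf_sub_le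
    (hT : TreeBounds H (3 * propConst C₁ L) κ |ε| n₀ τ₁ γ θ S W)
    (hB : DivisorBounds H C₀ τ C₁ τ₁ n₀ K) (hψ : IsCutoff C₁ ψ) (hL0 : 0 ≤ L)
    (hL : ∀ x y, |ψ x - ψ y| ≤ L * |x - y|)
    (hK : ∀ j ≤ n, ∀ x y, ‖K j x - K j y‖ ≤ 1 / 2 * |x - y|) {x x' : ℝ}
    (hx : XiOf ψ n₀ K n x ≠ 0) (hx' : XiOf ψ n₀ K n x' ≠ 0)
    (hxx : |x - x'| ≤ C₁ / 2 * (1 / 2) ^ n) :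
    ‖massOf H ψ n₀ ε K n x - massOf H ψ n₀ ε K n x'‖ ≤ 3 * θ * (1 / 8) ^ n * |x - x'| := by
  have hC₁ := hB.C₁_pos
  have h1 := hT.tsum_majorant hB hK (x := x) fun q h1 h2 => by
    have := divisor_lt_of_XiOf_ne_zero hψ hx q h1 h2
    linarith
  have hs := hT.summable_value hB hψ hL0 hK hx
  have hs' := hT.summable_value hB hψ hL0 hK hx'
  rw [massOf, massOf, ← hs.tsum_sigma, ← hs'.tsum_sigma, ← hs.tsum_sub hs']
  refine (tsum_of_norm_bounded ((h1.1.hasSum.mul_left 3).mul_right |x - x'|) fun T =>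
    T.2.1.norm_value_sub_le_majorant hC₁ hψ hL0 hL hK T.2.2 hxx).trans ?_
  have := mul_le_mul_of_nonneg_right h1.2 (abs_nonneg (x - x'))
  linarith

/-- The Lipschitz bound on the correction `Ξ_n M^{[n]}`. -/
theorem TreeBounds.norm_XiOf_mul_massOf_sub_le
    (hT : TreeBounds H (3 * propConst C₁ L) κ |ε| n₀ τ₁ γ θ S W)
    (hB : DivisorBounds H C₀ τ C₁ τ₁ n₀ K) (hψ : IsCutoff C₁ ψ) (hL0 : 0 ≤ L)
    (hL : ∀ x y, |ψ x - ψ y| ≤ L * |x - y|) (hθ : 12 * (L + 1) * θ ≤ 1)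
    (hK : ∀ j ≤ n, ∀ x y, ‖K j x - K j y‖ ≤ 1 / 2 * |x - y|) (x y : ℝ) :
    ‖(XiOf ψ n₀ K n x : ℂ) * massOf H ψ n₀ ε K n x -
      (XiOf ψ n₀ K n y : ℂ) * massOf H ψ n₀ ε K n y‖ ≤ (1 / 4) ^ (n + 1) * |x - y| := by
  have hC₁ := hB.C₁_pos
  have hθ0 := hT.θ_nonneg
  -- The cutoff product `Ξ_n` has Lipschitz constant of order `2^n`; the decay `8^{-n}` of the
  -- self-energy beats it and leaves `4^{-n}`.
  have e28 : (2 : ℝ) ^ n * (1 / 8) ^ n = (1 / 4) ^ n := by rw [← mul_pow]; norm_num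
  have e8 : (1 / 8 : ℝ) ^ n ≤ (1 / 4) ^ n := pow_le_pow_left₀ (by norm_num) (by norm_num) n
  have e4 : (0 : ℝ) ≤ (1 / 4) ^ n := by positivity
  -- It suffices that `Ξ_n` is nonzero at `x`: if it vanishes at `y`, the term containing the
  -- difference of the self-energies drops out.
  have one : ∀ x y, XiOf ψ n₀ K n x ≠ 0 → |x - y| ≤ C₁ / 2 * (1 / 2) ^ n →
      ‖(XiOf ψ n₀ K n x : ℂ) * massOf H ψ n₀ ε K n x -
      (XiOf ψ n₀ K n y : ℂ) * massOf H ψ n₀ ε K n y‖ ≤ (1 / 4) ^ (n + 1) * |x - y| := by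
    intro x y hx hxy
    have h1 : ‖((XiOf ψ n₀ K n x - XiOf ψ n₀ K n y : ℝ) : ℂ) * massOf H ψ n₀ ε K n x‖ ≤
        3 * L * 2 ^ n * |x - y| * (θ * (1 / 8) ^ n) := by
      rw [norm_mul, Complex.norm_real, Real.norm_eq_abs]
      exact mul_le_mul (abs_XiOf_sub_le hψ hL0 hL hK x y) (hT.norm_massOf_le hB hψ hL0 hK hx)
        (norm_nonneg _) (by positivity)
    have h2 : ‖(XiOf ψ n₀ K n y : ℂ) *
        (massOf H ψ n₀ ε K n x - massOf H ψ n₀ ε K n y)‖ ≤ 3 * θ * (1 / 8) ^ n * |x - y| := by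
      by_cases hy : XiOf ψ n₀ K n y = 0
      · rw [hy, Complex.ofReal_zero, zero_mul, norm_zero]; positivity
      · rw [norm_mul, Complex.norm_real, Real.norm_eq_abs]
        have hm := XiOf_mem (n₀ := n₀) (K := K) (n := n) hψ y
        rw [abs_of_nonneg hm.1]
        have := hT.norm_massOf_sub_le hB hψ hL0 hL hK hx hy hxy
        calc _ ≤ 1 * _ := mul_le_mul hm.2 this (norm_nonneg _) zero_le_one
          _ = _ := one_mul _
    have e : (XiOf ψ n₀ K n x : ℂ) * massOf H ψ n₀ ε K n x -
        (XiOf ψ n₀ K n y : ℂ) * massOf H ψ n₀ ε K n y =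
        ((XiOf ψ n₀ K n x - XiOf ψ n₀ K n y : ℝ) : ℂ) * massOf H ψ n₀ ε K n x +
        (XiOf ψ n₀ K n y : ℂ) * (massOf H ψ n₀ ε K n x - massOf H ψ n₀ ε K n y) := by
      push_cast; ring
    rw [e]
    refine (norm_add_le _ _).trans ((add_le_add h1 h2).trans ?_)
    calc 3 * L * 2 ^ n * |x - y| * (θ * (1 / 8) ^ n) + 3 * θ * (1 / 8) ^ n * |x - y|
        = (3 * L * θ * (2 ^ n * (1 / 8) ^ n) + 3 * θ * (1 / 8) ^ n) * |x - y| := by ring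
      _ ≤ (3 * L * θ * (1 / 4) ^ n + 3 * θ * (1 / 4) ^ n) * |x - y| := by
        rw [e28]; gcongr
      _ = (12 * (L + 1) * θ) * ((1 / 4) ^ (n + 1) * |x - y|) := by ring
      _ ≤ 1 * ((1 / 4) ^ (n + 1) * |x - y|) := by gcongr
      _ = _ := one_mul _
  refine norm_sub_le_of_local (f := fun x => (XiOf ψ n₀ K n x : ℂ) * massOf H ψ n₀ ε K n x)
    (δ := C₁ / 2 * (1 / 2) ^ n) (by positivity) (fun x y hxy => ?_) x y
  by_cases hx : XiOf ψ n₀ K n x = 0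
  · by_cases hy : XiOf ψ n₀ K n y = 0
    · simp only [hx, hy, Complex.ofReal_zero, zero_mul, sub_zero, norm_zero]; positivity
    · rw [norm_sub_rev, abs_sub_comm]
      exact one y x hy (by rwa [abs_sub_comm])
  · exact one x y hx hxy

end Mass

/-! ### Induction on the scale for `𝓜^{[n]}` -/

section Lag

variable {A : ℕ} {H : HillData A} {C₀ τ C₁ τ₁ : ℝ} {ψ : ℝ → ℝ} {n₀ : ℕ}
  {L κ ε γ θ : ℝ} {S W : ℝ≥0∞}

theorem HillData.lag_eq_zero {n : ℕ} (hn : n ≤ n₀) : H.lag ψ n₀ ε n = fun _ => 0 := by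
  cases n with
  | zero => rfl
  | succ n =>
    funext x
    have : ¬ n₀ ≤ n := by omega
    simp [HillData.lag, HillData.lagHist, this]

/-- The functions `𝓜^{[n]}` are Lipschitz with a small constant. -/
theorem TreeBounds.norm_lag_sub_le
    (hT : TreeBounds H (3 * propConst C₁ L) κ |ε| n₀ τ₁ γ θ S W)
    (hB : DivisorBounds H C₀ τ C₁ τ₁ n₀ (H.lag ψ n₀ ε)) (hψ : IsCutoff C₁ ψ) (hL0 : 0 ≤ L)
    (hL : ∀ x y, |ψ x - ψ y| ≤ L * |x - y|) (hθ : 12 * (L + 1) * θ ≤ 1) (n : ℕ) (x y : ℝ) :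
    ‖H.lag ψ n₀ ε n x - H.lag ψ n₀ ε n y‖ ≤ 1 / 2 * |x - y| := by
  -- The constant is the partial sum of `4^{-(j+1)}` over `j < n`. It reproduces itself under the
  -- induction, which the uniform bound `1/2` would not.
  have key : ∀ n x y, ‖H.lag ψ n₀ ε n x - H.lag ψ n₀ ε n y‖ ≤
      (1 - (1 / 4) ^ n) / 3 * |x - y| := by
    intro n
    induction n using Nat.strong_induction_on with
    | _ n ih =>
      have hpos : ∀ m : ℕ, 0 ≤ (1 - (1 / 4 : ℝ) ^ m) / 3 := fun m => by
        have : (1 / 4 : ℝ) ^ m ≤ 1 := pow_le_one₀ (by norm_num) (by norm_num)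
        linarith
      intro x y
      rcases Nat.lt_or_ge n₀ n with hn | hn
      · obtain ⟨m, rfl⟩ : ∃ m, n = m + 1 := ⟨n - 1, by omega⟩
        have hK : ∀ j ≤ m, ∀ x y, ‖H.lag ψ n₀ ε j x - H.lag ψ n₀ ε j y‖ ≤ 1 / 2 * |x - y| :=
          fun j hj x y => (ih j (by omega) x y).trans (by
            have : (0 : ℝ) ≤ (1 / 4) ^ j := by positivity
            exact mul_le_mul_of_nonneg_right (by linarith) (abs_nonneg _))
        have e : ∀ x, H.lag ψ n₀ ε (m + 1) x = H.lag ψ n₀ ε m x +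
            (XiOf ψ n₀ (H.lag ψ n₀ ε) m x : ℂ) * massOf H ψ n₀ ε (H.lag ψ n₀ ε) m x :=
          H.calM_eq ψ n₀ ε (by omega)
        have h1 := ih m (by omega) x y
        have h2 := hT.norm_XiOf_mul_massOf_sub_le hB hψ hL0 hL hθ hK x y
        rw [e, e, add_sub_add_comm]
        refine (norm_add_le _ _).trans ((add_le_add h1 h2).trans (le_of_eq ?_))
        ring
      · rw [HillData.lag_eq_zero hn]
        have := hpos n
        simp only [sub_self, norm_zero]
        positivity
  refine (key n x y).trans ?_
  have : (0 : ℝ) ≤ (1 / 4) ^ n := by positivity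
  exact mul_le_mul_of_nonneg_right (by linarith) (abs_nonneg _)

/-- At the initial scale `𝓜^{[n₀-1]} = 0`, so the Diophantine condition suffices, with `C₁ < C₀` and
`τ < τ₁`. From `n₀ + 1` on the bound is admissibility, with the index shifted by one. -/
theorem divisorBounds_lag (hC₁ : 0 < C₁) (hC : C₁ < C₀) (hτ : 0 < τ) (hτ₁ : τ < τ₁)
    (hdio : H.IsDiophantine C₀ τ) (hε : ε ∈ H.admissible ψ n₀ C₁ τ₁) :
    DivisorBounds H C₀ τ C₁ τ₁ n₀ (H.lag ψ n₀ ε) where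
  C₁_pos := hC₁
  C₁_lt := hC
  τ_pos := hτ
  τ_lt := hτ₁
  dio := hdio
  adm ν hν j hj := by
    rcases Nat.eq_or_lt_of_le hj with rfl | hj
    · rw [divisor, H.lag_start, sub_zero, norm_mul, Complex.norm_I, one_mul, Complex.norm_real,
        Real.norm_eq_abs]
      refine le_trans ?_ (hdio ν hν)
      have h1 := Mode.one_le_l1 hν
      have h2 : ν.l1 ^ (-τ₁) ≤ ν.l1 ^ (-τ) := Real.rpow_le_rpow_of_exponent_le h1 (by linarith)
      exact mul_le_mul hC.le h2 (Real.rpow_nonneg ν.l1_nonneg _) (hC₁.trans hC).le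
    · obtain ⟨m, rfl⟩ : ∃ m, j = m + 1 := ⟨j - 1, by omega⟩
      exact hε ν hν m (by omega)

end Lag

/-! ### Exponential decay of Fourier coefficients of analytic functions -/

/-- Dividing the `k`-th inequality by `k! (2ρ)^k` and summing yields an exponential series on the
left and a geometric series on the right. -/
theorem le_exp_of_forall_pow_mul_le {a μ C ρ : ℝ} (hρ : 0 < ρ)
    (h : ∀ k : ℕ, μ ^ k * a ≤ C * k.factorial * ρ ^ k) :
    a ≤ 2 * C * Real.exp (-(μ / (2 * ρ))) := by
  have h1 : HasSum (fun k : ℕ => (μ / (2 * ρ)) ^ k / k.factorial * a)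
      (Real.exp (μ / (2 * ρ)) * a) := by
    have := NormedSpace.expSeries_div_hasSum_exp (𝔸 := ℝ) (μ / (2 * ρ))
    rw [← Real.exp_eq_exp_ℝ] at this
    exact this.mul_right a
  have h2 : HasSum (fun k : ℕ => C * (1 / 2 : ℝ) ^ k) (C * 2) := hasSum_geometric_two.mul_left C
  have h3 : Real.exp (μ / (2 * ρ)) * a ≤ C * 2 := by
    refine hasSum_le (fun k => ?_) h1 h2
    have hk : (0 : ℝ) < k.factorial := by positivity
    have e : (μ / (2 * ρ)) ^ k / k.factorial * a =
        (μ ^ k * a) * ((1 / 2) ^ k / (ρ ^ k * k.factorial)) := by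
      rw [div_pow, mul_pow, one_div, inv_pow]; field_simp
    rw [e]
    calc _ ≤ (C * k.factorial * ρ ^ k) * ((1 / 2) ^ k / (ρ ^ k * k.factorial)) := by
          exact mul_le_mul_of_nonneg_right (h k) (by positivity)
      _ = _ := by field_simp
  rw [Real.exp_neg, ← div_eq_mul_inv, le_div_iff₀ (Real.exp_pos _)]
  linarith

section Analytic

variable {E : Type*} [NormedAddCommGroup E] [NormedSpace ℝ E] {f : E → ℂ}

/-- Near `x`, the derivatives at `z` are `k!` times the coefficients of the power series re-expanded
at `z`. A single double series, convergent because `r + r` is below the radius of convergence,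
bounds `r^k` times the `k`-th coefficient for every `k` and every `z` within `r` of `x`. -/
theorem eventually_iteratedFDeriv_le {x : E} (hf : AnalyticAt ℝ f x) :
    ∃ C ρ : ℝ, 0 < ρ ∧ ∀ᶠ z in 𝓝 x, ∀ (k : ℕ) (v : E), ‖v‖ ≤ 1 →
      ‖iteratedFDeriv ℝ k f z (fun _ => v)‖ ≤ C * k.factorial * ρ ^ k := by
  obtain ⟨p, R, hp⟩ := hf
  obtain ⟨r', hr0, hrR⟩ : ∃ r' : ℝ≥0, 0 < (r' : ℝ≥0∞) ∧ (r' : ℝ≥0∞) < R :=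
    ENNReal.lt_iff_exists_nnreal_btwn.1 hp.r_pos
  set r : ℝ≥0 := r' / 2 with hr
  have hrr : (r : ℝ≥0∞) + (r : ℝ≥0∞) = r' := by
    rw [← ENNReal.coe_add, hr, add_halves]
  have hr0' : 0 < r := by
    have : 0 < r' := by exact_mod_cast hr0
    positivity
  have hrad : ((r : ℝ≥0∞) + (r : ℝ≥0∞)) < p.radius := by
    rw [hrr]; exact hrR.trans_le hp.r_le
  have hsum := p.changeOriginSeries_summable_aux₁ hrad
  have hsum2 := NNReal.summable_sigma.1 hsum
  set C : ℝ≥0 := ∑' k : ℕ, ∑' s : Σ l : ℕ, { s : Finset (Fin (k + l)) // s.card = l },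
    ‖p (k + s.1)‖₊ * r ^ s.1 * r ^ k with hC
  refine ⟨C, (r : ℝ)⁻¹, by positivity, ?_⟩
  filter_upwards [Metric.ball_mem_nhds x (by positivity : (0 : ℝ) < r)] with z hz k v hv
  have hy : ‖z - x‖₊ < r := by
    rw [mem_ball_iff_norm] at hz
    exact_mod_cast hz
  have hyr : (‖z - x‖₊ : ℝ≥0∞) < p.radius := by
    refine lt_of_le_of_lt ?_ hrad
    exact (ENNReal.coe_le_coe.2 hy.le).trans le_self_add
  have hyR : (‖z - x‖₊ : ℝ≥0∞) < R := by
    refine lt_of_le_of_lt ?_ (hrr ▸ hrR)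
    exact (ENNReal.coe_le_coe.2 hy.le).trans le_self_add
  have hq := hp.changeOrigin hyR
  rw [add_sub_cancel] at hq
  rw [← hq.factorial_smul v k, nsmul_eq_mul, norm_mul, Complex.norm_natCast]
  have hle : ‖p.changeOrigin (z - x) k‖₊ * r ^ k ≤ C := by
    have h1 := p.nnnorm_changeOrigin_le k hyr
    have h2 : ∑' s : Σ l : ℕ, { s : Finset (Fin (k + l)) // s.card = l },
        ‖p (k + s.1)‖₊ * ‖z - x‖₊ ^ s.1 * r ^ k ≤
        ∑' s : Σ l : ℕ, { s : Finset (Fin (k + l)) // s.card = l },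
        ‖p (k + s.1)‖₊ * r ^ s.1 * r ^ k := by
      have hle : ∀ s : Σ l : ℕ, { s : Finset (Fin (k + l)) // s.card = l },
          ‖p (k + s.1)‖₊ * ‖z - x‖₊ ^ s.1 * r ^ k ≤ ‖p (k + s.1)‖₊ * r ^ s.1 * r ^ k :=
        fun s => by gcongr
      exact (NNReal.summable_of_le hle (hsum2.1 k)).tsum_le_tsum hle (hsum2.1 k)
    calc _ ≤ (∑' s : Σ l : ℕ, { s : Finset (Fin (k + l)) // s.card = l },
        ‖p (k + s.1)‖₊ * ‖z - x‖₊ ^ s.1) * r ^ k := by gcongr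
      _ = _ := NNReal.tsum_mul_right _ _ |>.symm
      _ ≤ _ := h2
      _ ≤ C := hsum2.2.le_tsum k fun _ _ => zero_le
  have hle' : ‖p.changeOrigin (z - x) k‖ ≤ C * (r : ℝ)⁻¹ ^ k := by
    have h : ‖p.changeOrigin (z - x) k‖ * (r : ℝ) ^ k ≤ C := by exact_mod_cast hle
    rw [inv_pow, ← div_eq_mul_inv, le_div_iff₀ (by positivity)]
    exact h
  have hop : ‖p.changeOrigin (z - x) k fun _ => v‖ ≤ ‖p.changeOrigin (z - x) k‖ := by
    refine (ContinuousMultilinearMap.le_opNorm _ _).trans ?_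
    simp only [Finset.prod_const, Finset.card_univ, Fintype.card_fin]
    exact mul_le_of_le_one_right (norm_nonneg _) (pow_le_one₀ (norm_nonneg _) hv)
  calc (k.factorial : ℝ) * ‖p.changeOrigin (z - x) k fun _ => v‖
      ≤ k.factorial * (C * (r : ℝ)⁻¹ ^ k) := by gcongr; exact hop.trans hle'
    _ = _ := by ring

/-- Cauchy estimates on compact sets. -/
theorem exists_iteratedFDeriv_le (hf : AnalyticOnNhd ℝ f Set.univ) {s : Set E}
    (hs : IsCompact s) :
    ∃ C ρ : ℝ, 0 ≤ C ∧ 0 < ρ ∧ ∀ z ∈ s, ∀ (k : ℕ) (v : E), ‖v‖ ≤ 1 →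
      ‖iteratedFDeriv ℝ k f z (fun _ => v)‖ ≤ C * k.factorial * ρ ^ k := by
  refine hs.induction_on (p := fun s => ∃ C ρ : ℝ, 0 ≤ C ∧ 0 < ρ ∧ ∀ z ∈ s, ∀ (k : ℕ) (v : E),
    ‖v‖ ≤ 1 → ‖iteratedFDeriv ℝ k f z (fun _ => v)‖ ≤ C * k.factorial * ρ ^ k)
    ⟨0, 1, le_rfl, one_pos, by simp⟩ ?_ ?_ ?_
  · rintro s t hst ⟨C, ρ, hC, hρ, h⟩
    exact ⟨C, ρ, hC, hρ, fun z hz => h z (hst hz)⟩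
  · rintro s t ⟨C, ρ, hC, hρ, h⟩ ⟨C', ρ', hC', hρ', h'⟩
    refine ⟨max C C', max ρ ρ', le_max_of_le_left hC, lt_max_of_lt_left hρ, fun z hz k v hv => ?_⟩
    rcases hz with hz | hz
    · refine (h z hz k v hv).trans ?_
      gcongr
      · exact le_max_left _ _
      · exact le_max_left _ _
    · refine (h' z hz k v hv).trans ?_
      gcongr
      · exact le_max_right _ _
      · exact le_max_right _ _
  · intro x _
    obtain ⟨C, ρ, hρ, h⟩ := eventually_iteratedFDeriv_le (hf x (Set.mem_univ x))
    refine ⟨_, mem_nhdsWithin_of_mem_nhds h, max C 0, ρ, le_max_right _ _, hρ,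
      fun z hz k v hv => (hz k v hv).trans ?_⟩
    gcongr
    exact le_max_left _ _

theorem contDiff_iteratedFDeriv_apply (hf : AnalyticOnNhd ℝ f Set.univ) (k : ℕ) (v : E) :
    ContDiff ℝ 1 fun x => iteratedFDeriv ℝ k f x (fun _ => v) := by
  have h : ContDiff ℝ (⊤ : ℕ∞) f := hf.contDiff
  have h1 : ContDiff ℝ 1 (iteratedFDeriv ℝ k f) := h.iteratedFDeriv_right (by exact_mod_cast le_top)
  exact (ContinuousMultilinearMap.apply ℝ (fun _ : Fin k => E) ℂ (fun _ => v)).contDiff.comp h1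

theorem fderiv_iteratedFDeriv_apply (hf : AnalyticOnNhd ℝ f Set.univ) (k : ℕ) (v x : E) :
    fderiv ℝ (fun x => iteratedFDeriv ℝ k f x (fun _ => v)) x v =
      iteratedFDeriv ℝ (k + 1) f x (fun _ => v) := by
  have h : ContDiff ℝ (⊤ : ℕ∞) f := hf.contDiff
  have h1 : ContDiff ℝ 1 (iteratedFDeriv ℝ k f) := h.iteratedFDeriv_right (by exact_mod_cast le_top)
  exact ((h1.differentiable one_ne_zero x).iteratedFDeriv_succ_apply_left' (m := fun _ => v)).symm

end Analytic

/-- Exponential decay of the Fourier coefficients of an analytic periodic function on `ℝ`. -/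
theorem exists_norm_intervalIntegral_le {f : ℝ → ℂ} (hf : AnalyticOnNhd ℝ f Set.univ) {ω : ℝ}
    (hω : ω ≠ 0) (hper : ∀ t, f (t + 2 * Real.pi / ω) = f t) :
    ∃ F κ : ℝ, 0 ≤ F ∧ 0 < κ ∧ ∀ n : ℤ,
      ‖∫ t in (0 : ℝ)..(2 * Real.pi / ω), f t * Complex.exp (-(Complex.I * ((n * ω : ℝ) : ℂ) * t))‖
        ≤ F * Real.exp (-(κ * |(n : ℝ)|)) := by
  set T := 2 * Real.pi / ω with hT
  obtain ⟨C, ρ, hC, hρ, hb⟩ := exists_iteratedFDeriv_le hf (isCompact_uIcc (a := 0) (b := T))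
  set G : ℕ → ℝ → ℂ := fun k x => iteratedFDeriv ℝ k f x (fun _ => (1 : ℝ)) with hG
  refine ⟨2 * (|T| * C), |ω| / (2 * ρ), by positivity, by positivity, fun n => ?_⟩
  set e : ℝ → ℂ := fun t => Complex.exp (-(Complex.I * ((n * ω : ℝ) : ℂ) * t)) with he
  have hed : ∀ t, HasDerivAt e (e t * (-(Complex.I * ((n * ω : ℝ) : ℂ)))) t := by
    intro t
    have h1 : HasDerivAt (fun t : ℝ => -(Complex.I * ((n * ω : ℝ) : ℂ) * (t : ℂ)))
        (-(Complex.I * ((n * ω : ℝ) : ℂ))) t := by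
      simpa using ((Complex.ofRealCLM.hasDerivAt (x := t)).const_mul
        (Complex.I * ((n * ω : ℝ) : ℂ))).fun_neg
    exact h1.cexp
  have hec : Continuous e := by fun_prop
  have heT : e T = 1 := by
    have : -(Complex.I * ((n * ω : ℝ) : ℂ) * ((T : ℝ) : ℂ)) =
        ((-n : ℤ) : ℂ) * (2 * Real.pi * Complex.I) := by
      have hω' : (ω : ℂ) ≠ 0 := by exact_mod_cast hω
      rw [hT]; push_cast; field_simp
    simp only [he, this]
    exact Complex.exp_int_mul_two_pi_mul_I _
  have he0 : e 0 = 1 := by simp [he]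
  have hen : ∀ t, ‖e t‖ = 1 := by
    intro t
    have : -(Complex.I * ((n * ω : ℝ) : ℂ) * (t : ℂ)) = ((-(n * ω * t) : ℝ) : ℂ) * Complex.I := by
      push_cast; ring
    simp only [he, this]
    exact Complex.norm_exp_ofReal_mul_I _
  have hGd : ∀ k t, HasDerivAt (G k) (G (k + 1) t) t := by
    intro k t
    have h1 := ((contDiff_iteratedFDeriv_apply hf k (1 : ℝ)).differentiable one_ne_zero
      t).hasFDerivAt.hasDerivAt
    rwa [fderiv_iteratedFDeriv_apply hf] at h1
  have hGc : ∀ k, Continuous (G k) := fun k => (contDiff_iteratedFDeriv_apply hf k _).continuous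
  have hGT : ∀ k, G k T = G k 0 := by
    intro k
    have := iteratedFDeriv_comp_add_right (𝕜 := ℝ) (f := f) k T 0
    rw [zero_add, show (fun z => f (z + T)) = f from funext hper] at this
    simp only [hG, this]
  -- Integration by parts; the boundary terms cancel by periodicity. Each step trades a derivative
  -- for a factor `n ω`.
  have hrec : ∀ k, ∫ t in (0 : ℝ)..T, G (k + 1) t * e t =
      (Complex.I * ((n * ω : ℝ) : ℂ)) * ∫ t in (0 : ℝ)..T, G k t * e t := by
    intro k
    have c1 : Continuous fun t => G (k + 1) t * e t := (hGc _).mul hec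
    have c2 : Continuous fun t => G k t * (e t * (-(Complex.I * ((n * ω : ℝ) : ℂ)))) :=
      (hGc _).mul (hec.mul continuous_const)
    have h1 := intervalIntegral.integral_eq_sub_of_hasDerivAt (a := 0) (b := T)
      (f := fun t => G k t * e t)
      (f' := fun t => G (k + 1) t * e t + G k t * (e t * (-(Complex.I * ((n * ω : ℝ) : ℂ)))))
      (fun t _ => (hGd k t).mul (hed t))
      ((c1.add c2).intervalIntegrable _ _)
    rw [hGT, heT, he0, sub_self, intervalIntegral.integral_add (c1.intervalIntegrable _ _)
      (c2.intervalIntegrable _ _)] at h1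
    have h2 : ∫ t in (0 : ℝ)..T, G k t * (e t * (-(Complex.I * ((n * ω : ℝ) : ℂ)))) =
        -(Complex.I * ((n * ω : ℝ) : ℂ)) * ∫ t in (0 : ℝ)..T, G k t * e t := by
      rw [← intervalIntegral.integral_const_mul]
      congr 1; ext t; ring
    rw [h2] at h1
    linear_combination h1
  have hpow : ∀ k, ‖∫ t in (0 : ℝ)..T, G k t * e t‖ =
      (|(n : ℝ)| * |ω|) ^ k * ‖∫ t in (0 : ℝ)..T, f t * e t‖ := by
    intro k
    induction k with
    | zero => simp [hG]
    | succ k ih =>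
      rw [hrec, norm_mul, ih, norm_mul, Complex.norm_I, Complex.norm_real, Real.norm_eq_abs, abs_mul]
      ring
  have hle := le_exp_of_forall_pow_mul_le (a := ‖∫ t in (0 : ℝ)..T, f t * e t‖)
    (μ := |(n : ℝ)| * |ω|) (C := |T| * C) hρ fun k => by
      rw [← hpow]
      have := intervalIntegral.norm_integral_le_of_norm_le_const (a := 0) (b := T)
        (f := fun t => G k t * e t) (C := C * k.factorial * ρ ^ k) fun t ht => by
          rw [norm_mul, hen, mul_one]
          exact hb t (Set.uIoc_subset_uIcc ht) k 1 (by simp)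
      rw [sub_zero] at this
      linarith
  refine hle.trans (le_of_eq ?_)
  ring_nf

/-- Exponential decay of the Fourier coefficients of an analytic function on `ℝ^(n+1)` which is
periodic in each variable. -/
theorem exists_norm_integral_box_le {n : ℕ} {f : (Fin (n + 1) → ℝ) → ℂ}
    (hf : AnalyticOnNhd ℝ f Set.univ)
    (hper : ∀ (α : Fin (n + 1) → ℝ) (i : Fin (n + 1)), f (α + Pi.single i (2 * Real.pi)) = f α) :
    ∃ F κ : ℝ, 0 ≤ F ∧ 0 < κ ∧ ∀ m : Fin (n + 1) → ℤ,
      ‖∫ α in Set.Icc (0 : Fin (n + 1) → ℝ) (fun _ => 2 * Real.pi),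
        f α * Complex.exp (-(Complex.I * ∑ i, (m i : ℂ) * (α i : ℂ)))‖
        ≤ F * Real.exp (-(κ * ∑ i, |(m i : ℝ)|)) := by
  have hpi := Real.pi_pos
  set box := Set.Icc (0 : Fin (n + 1) → ℝ) (fun _ => 2 * Real.pi) with hbox
  have hcomp : IsCompact box := isCompact_Icc
  obtain ⟨C, ρ, hC, hρ, hb⟩ := exists_iteratedFDeriv_le hf hcomp
  set V := (volume box).toReal with hV
  refine ⟨2 * (V * C), 1 / (2 * ρ * (n + 1)), by positivity, by positivity, fun m => ?_⟩
  set e : (Fin (n + 1) → ℝ) → ℂ := fun α => Complex.exp (-(Complex.I * ∑ i, (m i : ℂ) * (α i : ℂ)))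
    with he
  have hesingle : ∀ α i, e (α + Pi.single i (2 * Real.pi)) = e α := by
    intro α i
    have : ∑ j, (m j : ℂ) * (((α + Pi.single i (2 * Real.pi) : Fin (n + 1) → ℝ) j : ℝ) : ℂ) =
        ∑ j, (m j : ℂ) * (α j : ℂ) + (m i : ℂ) * (2 * Real.pi) := by
      simp only [Pi.add_apply, Complex.ofReal_add, mul_add, Finset.sum_add_distrib]
      congr 1
      rw [Finset.sum_eq_single i]
      · simp
      · intro j _ hj; simp [hj]
      · simp
    simp only [he, this]
    have h2 : -(Complex.I * (∑ j, (m j : ℂ) * (α j : ℂ) + (m i : ℂ) * (2 * Real.pi))) =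
        -(Complex.I * ∑ j, (m j : ℂ) * (α j : ℂ)) +
          ((-m i : ℤ) : ℂ) * (2 * Real.pi * Complex.I) := by push_cast; ring
    rw [h2, Complex.exp_add, Complex.exp_int_mul_two_pi_mul_I, mul_one]
  have hen : ∀ α, ‖e α‖ = 1 := by
    intro α
    have : -(Complex.I * ∑ i, (m i : ℂ) * (α i : ℂ)) =
        ((-(∑ i, (m i : ℝ) * α i) : ℝ) : ℂ) * Complex.I := by push_cast; ring
    simp only [he, this]
    exact Complex.norm_exp_ofReal_mul_I _
  have hed : ContDiff ℝ 1 e := by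
    have h : ∀ i : Fin (n + 1), ContDiff ℝ 1 fun α : Fin (n + 1) → ℝ => ((α i : ℝ) : ℂ) := fun i =>
      Complex.ofRealCLM.contDiff.comp (contDiff_apply ℝ ℝ i)
    exact ((contDiff_const.mul (ContDiff.sum fun i _ => contDiff_const.mul (h i))).neg).cexp
  have hefd : ∀ α i, fderiv ℝ e α (Pi.single i 1) = e α * (-(Complex.I * m i)) := by
    intro α i
    have h1 : HasDerivAt (fun t : ℝ => e (α + t • Pi.single i (1 : ℝ)))
        (fderiv ℝ e α (Pi.single i 1)) 0 := by
      have := (hed.differentiable one_ne_zero α).hasFDerivAt.hasLineDerivAt (Pi.single i (1 : ℝ))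
      exact this
    have h2 : HasDerivAt (fun t : ℝ => e (α + t • Pi.single i (1 : ℝ)))
        (e α * (-(Complex.I * m i))) 0 := by
      have h3 : (fun t : ℝ => e (α + t • Pi.single i (1 : ℝ))) =
          fun t : ℝ => e α * Complex.exp (-(Complex.I * m i) * (t : ℂ)) := by
        funext t
        simp only [he]
        rw [← Complex.exp_add]
        congr 1
        have : ∑ j, (m j : ℂ) * (((α + t • Pi.single i (1 : ℝ) : Fin (n + 1) → ℝ) j : ℝ) : ℂ) =
            ∑ j, (m j : ℂ) * (α j : ℂ) + (m i : ℂ) * t := by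
          simp only [Pi.add_apply, Complex.ofReal_add, mul_add, Finset.sum_add_distrib]
          congr 1
          rw [Finset.sum_eq_single i]
          · simp
          · intro j _ hj; simp [hj]
          · simp
        rw [this]; ring
      rw [h3]
      have h4 : HasDerivAt (fun t : ℝ => -(Complex.I * (m i : ℂ)) * (t : ℂ))
          (-(Complex.I * (m i : ℂ))) 0 := by
        simpa using (Complex.ofRealCLM.hasDerivAt (x := (0 : ℝ))).const_mul
          (-(Complex.I * (m i : ℂ)))
      simpa using h4.cexp.const_mul (e α)
    exact h1.unique h2
  -- Repeated integration by parts in the single direction `i` gives decay in `|m i|`; the direction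
  -- with the largest component is chosen at the end.
  have key : ∀ i, ‖∫ α in box, f α * e α‖ ≤ 2 * (V * C) * Real.exp (-(|(m i : ℝ)| / (2 * ρ))) := by
    intro i
    set G : ℕ → (Fin (n + 1) → ℝ) → ℂ :=
      fun k x => iteratedFDeriv ℝ k f x (fun _ => Pi.single i (1 : ℝ)) with hG
    have hGd : ∀ k, ContDiff ℝ 1 (G k) := fun k => contDiff_iteratedFDeriv_apply hf k _
    have hGper : ∀ k α, G k (α + Pi.single i (2 * Real.pi)) = G k α := by
      intro k α
      have := iteratedFDeriv_comp_add_right (𝕜 := ℝ) (f := f) k (Pi.single i (2 * Real.pi)) α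
      rw [show (fun z => f (z + Pi.single i (2 * Real.pi))) = f from funext fun z => hper z i]
        at this
      simp only [hG, this]
    have hrec : ∀ k, ∫ α in box, G (k + 1) α * e α =
        (Complex.I * m i) * ∫ α in box, G k α * e α := by
      intro k
      have hF : ContDiff ℝ 1 fun α => G k α * e α := (hGd k).mul hed
      have hFd : ∀ α, fderiv ℝ (fun α => G k α * e α) α (Pi.single i 1) =
          G (k + 1) α * e α - (Complex.I * m i) * (G k α * e α) := by
        intro α
        rw [fderiv_fun_mul ((hGd k).differentiable one_ne_zero α)
          (hed.differentiable one_ne_zero α)]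
        simp only [_root_.add_apply, _root_.smul_apply, smul_eq_mul, hefd]
        rw [fderiv_iteratedFDeriv_apply hf]
        ring
      have hcont : ∀ k, Continuous fun α => G k α * e α := fun k =>
        (hGd k).continuous.mul hed.continuous
      have hint : ∀ k, IntegrableOn (fun α => G k α * e α) box := fun k =>
        (hcont k).continuousOn.integrableOn_compact hcomp
      -- The divergence theorem for a field with only its `i`-th component nonzero. Its fluxes
      -- through the two opposite faces agree by periodicity.
      have hdiv := integral_divergence_of_hasFDerivAt_off_countable' (E := ℂ)
        (0 : Fin (n + 1) → ℝ) (fun _ => 2 * Real.pi) (fun _ => by simp; positivity)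
        (fun j α => if j = i then G k α * e α else 0)
        (fun j α => if j = i then fderiv ℝ (fun α => G k α * e α) α else 0) ∅ Set.countable_empty
        (fun j => by
          by_cases hj : j = i
          · simpa [hj] using (hcont k).continuousOn
          · simpa [hj] using continuousOn_const)
        (fun α _ j => by
          by_cases hj : j = i
          · simpa [hj] using (hF.differentiable one_ne_zero α).hasFDerivAt
          · simpa [hj] using hasFDerivAt_const (0 : ℂ) α)
        (by
          have : (fun α => ∑ j, (if j = i then fderiv ℝ (fun α => G k α * e α) α else 0)
              (Pi.single j (1 : ℝ))) =
              fun α => G (k + 1) α * e α - (Complex.I * m i) * (G k α * e α) := by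
            funext α
            rw [Finset.sum_eq_single i]
            · simpa using hFd α
            · intro j _ hj; simp [hj]
            · simp
          rw [this]
          exact (hint _).sub ((hint _).const_mul _))
      have hL : (fun α => ∑ j, (if j = i then fderiv ℝ (fun α => G k α * e α) α else 0)
          (Pi.single j (1 : ℝ))) =
          fun α => G (k + 1) α * e α - (Complex.I * m i) * (G k α * e α) := by
        funext α
        rw [Finset.sum_eq_single i]
        · simpa using hFd α
        · intro j _ hj; simp [hj]
        · simp
      rw [hL, integral_sub (hint _) ((hint _).const_mul _), integral_const_mul] at hdiv
      have hR : ∀ x : Fin n → ℝ, i.insertNth (2 * Real.pi) x =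
          (i.insertNth (0 : ℝ) x : Fin (n + 1) → ℝ) + Pi.single i (2 * Real.pi) := by
        intro x
        funext j
        rcases eq_or_ne j i with rfl | hj
        · simp
        · obtain ⟨l, rfl⟩ := Fin.exists_succAbove_eq hj
          simp
      rw [Finset.sum_eq_zero] at hdiv
      · linear_combination hdiv
      · intro j _
        by_cases hj : j = i
        · subst hj
          simp only [if_true, hR, hGper, hesingle, Pi.zero_apply, sub_self]
        · simp [hj]
    have hpow : ∀ k, ‖∫ α in box, G k α * e α‖ =
        |(m i : ℝ)| ^ k * ‖∫ α in box, f α * e α‖ := by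
      intro k
      induction k with
      | zero => simp [hG]
      | succ k ih =>
        rw [hrec, norm_mul, ih, norm_mul, Complex.norm_I, Complex.norm_intCast]
        ring
    refine le_exp_of_forall_pow_mul_le (μ := |(m i : ℝ)|) (C := V * C) hρ fun k => ?_
    rw [← hpow]
    have := norm_setIntegral_le_of_norm_le_const (μ := volume) (s := box)
      (f := fun α => G k α * e α) (C := C * k.factorial * ρ ^ k) hcomp.measure_lt_top
      fun α hα => by
        rw [norm_mul, hen, mul_one]
        refine hb α hα k _ ?_
        rw [Pi.norm_single]; simp
    rw [Measure.real, ← hV] at this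
    linarith
  obtain ⟨i, -, hi⟩ := Finset.exists_max_image Finset.univ (fun i => |(m i : ℝ)|)
    ⟨0, Finset.mem_univ _⟩
  refine (key i).trans ?_
  gcongr
  -- The largest component is at least the average, which accounts for the `n + 1` in the decay
  -- rate.
  have hsum : ∑ j, |(m j : ℝ)| ≤ (n + 1) * |(m i : ℝ)| := by
    have := Finset.sum_le_card_nsmul Finset.univ (fun j => |(m j : ℝ)|) |(m i : ℝ)| hi
    simpa [Finset.card_univ] using this
  rw [div_mul_eq_mul_div, one_mul, div_le_div_iff₀ (by positivity) (by positivity)]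
  nlinarith [mul_le_mul_of_nonneg_left hsum (by positivity : (0 : ℝ) ≤ 2 * ρ)]

/-! ### The unperturbed solution has no zeros; decay of `Q` and `R` -/

section Floquet

variable {A : ℕ} (H : HillData A) {C₀ τ : ℝ}

theorem HillData.freq_ne_zero (hC₀ : 0 < C₀) (hdio : H.IsDiophantine C₀ τ) {ν : Mode A}
    (hν : ν ≠ 0) : H.freq ν ≠ 0 := by
  intro h
  have h1 := hdio ν hν
  rw [h, abs_zero] at h1
  have h2 : 0 < ν.l1 ^ (-τ) := Real.rpow_pos_of_pos (by linarith [Mode.one_le_l1 hν]) _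
  nlinarith

theorem HillData.ω₀_ne_zero (hC₀ : 0 < C₀) (hdio : H.IsDiophantine C₀ τ) : H.ω₀ ≠ 0 := by
  have h := H.freq_ne_zero hC₀ hdio (ν := ((0 : Fin A → ℤ), (1 : ℤ), (0 : ℤ)))
    (fun h => by simp [Prod.ext_iff] at h)
  simpa [HillData.freq] using h

theorem hasDerivAt_conj {f : ℝ → ℂ} {f' : ℂ} {t : ℝ} (h : HasDerivAt f f' t) :
    HasDerivAt (fun t => conj (f t)) (conj f') t :=
  (Complex.conjCLE : ℂ ≃L[ℝ] ℂ).toContinuousLinearMap.hasFDerivAt.comp_hasDerivAt t h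

/-- A solution which vanishes somewhere is proportional to its complex conjugate. -/
theorem HillData.exists_conj_eq_of_eq_zero {t₀ : ℝ} (h0 : H.φ₀ t₀ = 0) :
    ∃ c : ℂ, ∀ t, conj (H.φ₀ t) = c * H.φ₀ t := by
  obtain ⟨t₁, h1⟩ := H.φ₀_nontrivial
  have hd : ∀ t, HasDerivAt H.φ₀ (deriv H.φ₀ t) t := fun t =>
    (H.φ₀_analytic t (Set.mem_univ t)).differentiableAt.hasDerivAt
  have hd2 : ∀ t, HasDerivAt (deriv H.φ₀) (-((H.p₀ t : ℂ) * H.φ₀ t)) t := fun t => by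
    have := (H.φ₀_analytic.deriv t (Set.mem_univ t)).differentiableAt.hasDerivAt
    rwa [eq_neg_of_add_eq_zero_left (H.φ₀_hill t)] at this
  -- The Wronskian of `φ₀` and its conjugate is constant, because `p₀` is real so that both solve
  -- the same equation; it vanishes at `t₀`.
  have hw : ∀ t, conj (deriv H.φ₀ t) * H.φ₀ t - conj (H.φ₀ t) * deriv H.φ₀ t = 0 := by
    have hwd : ∀ t, HasDerivAt
        (fun t => conj (deriv H.φ₀ t) * H.φ₀ t - conj (H.φ₀ t) * deriv H.φ₀ t) 0 t := fun t => by
      have := ((hasDerivAt_conj (hd2 t)).mul (hd t)).sub ((hasDerivAt_conj (hd t)).mul (hd2 t))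
      refine this.congr_deriv ?_
      simp only [map_neg, map_mul, Complex.conj_ofReal]
      ring
    intro t
    have := is_const_of_deriv_eq_zero (fun t => (hwd t).differentiableAt)
      (fun t => (hwd t).deriv) t t₀
    rw [this, h0]; simp
  have hev : ∀ᶠ t in 𝓝 t₁, H.φ₀ t ≠ 0 := (hd t₁).continuousAt.eventually_ne h1
  obtain ⟨r, hr, hball⟩ := Metric.eventually_nhds_iff_ball.1 hev
  refine ⟨conj (H.φ₀ t₁) / H.φ₀ t₁, fun t => ?_⟩
  have hq : ∀ t ∈ Metric.ball t₁ r, conj (H.φ₀ t) = conj (H.φ₀ t₁) / H.φ₀ t₁ * H.φ₀ t := by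
    intro t ht
    have hqd : ∀ s ∈ Metric.ball t₁ r, HasDerivWithinAt (fun s => conj (H.φ₀ s) / H.φ₀ s) 0
        (Metric.ball t₁ r) s := fun s hs => by
      have := (hasDerivAt_conj (hd s)).fun_div (hd s) (hball s hs)
      rw [hw, zero_div] at this
      exact this.hasDerivWithinAt
    have := (convex_ball t₁ r).norm_image_sub_le_of_norm_hasDerivWithin_le hqd
      (C := 0) (fun _ _ => by simp) (Metric.mem_ball_self hr) ht
    rw [zero_mul, norm_le_zero_iff, sub_eq_zero] at this
    rw [← this, div_mul_cancel₀ _ (hball t ht)]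
  -- The quotient is constant only on an interval free of zeros; the identity theorem extends the
  -- proportionality to the line.
  have han : AnalyticOnNhd ℝ (fun t => conj (H.φ₀ t)) Set.univ := fun t ht =>
    ((Complex.conjCLE : ℂ ≃L[ℝ] ℂ).toContinuousLinearMap.analyticAt _).comp (H.φ₀_analytic t ht)
  have han2 : AnalyticOnNhd ℝ (fun t => conj (H.φ₀ t₁) / H.φ₀ t₁ * H.φ₀ t) Set.univ :=
    fun t ht => analyticAt_const.mul (H.φ₀_analytic t ht)
  exact congrFun (han.eq_of_eventuallyEq han2 (z₀ := t₁)
    (by filter_upwards [Metric.ball_mem_nhds t₁ hr] with t ht using hq t ht)) t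

theorem HillData.φ₀_add_period (t : ℝ) : H.φ₀ (t + 2 * Real.pi / H.ω₀) =
    Complex.exp (Complex.I * H.Ω₀ * ((2 * Real.pi / H.ω₀ : ℝ) : ℂ)) * H.φ₀ t := by
  have h : Complex.exp (-(Complex.I * H.Ω₀ * ((t + 2 * Real.pi / H.ω₀ : ℝ) : ℂ))) *
      H.φ₀ (t + 2 * Real.pi / H.ω₀) = Complex.exp (-(Complex.I * H.Ω₀ * t)) * H.φ₀ t :=
    H.φ₀_floquet t
  have h2 : H.φ₀ (t + 2 * Real.pi / H.ω₀) =
      Complex.exp (Complex.I * H.Ω₀ * ((t + 2 * Real.pi / H.ω₀ : ℝ) : ℂ)) *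
      (Complex.exp (-(Complex.I * H.Ω₀ * t)) * H.φ₀ t) := by
    rw [← h, ← mul_assoc, ← Complex.exp_add, add_neg_cancel, Complex.exp_zero, one_mul]
  rw [h2, ← mul_assoc, ← Complex.exp_add]
  congr 2
  push_cast; ring

/-- If `φ₀` vanished somewhere it would be proportional to its conjugate, so the Floquet multiplier
`exp(i Ω₀ T)`, with `T = 2π/ω₀`, would equal its own conjugate. Then `n ω₀ + 2 Ω₀ = 0` for some
integer `n`, a resonance excluded by the Diophantine condition. -/
theorem HillData.φ₀_ne_zero (hC₀ : 0 < C₀) (hdio : H.IsDiophantine C₀ τ) (t : ℝ) :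
    H.φ₀ t ≠ 0 := by
  intro h0
  obtain ⟨c, hc⟩ := H.exists_conj_eq_of_eq_zero h0
  obtain ⟨t₁, h1⟩ := H.φ₀_nontrivial
  have hω := H.ω₀_ne_zero hC₀ hdio
  set T := 2 * Real.pi / H.ω₀ with hT
  have hc0 : c ≠ 0 := by
    rintro rfl
    have := hc t₁
    rw [zero_mul, map_eq_zero] at this
    exact h1 this
  have h2 := H.φ₀_add_period t₁
  rw [← hT] at h2
  have h3 := hc (t₁ + T)
  rw [h2, map_mul, hc t₁, ← Complex.exp_conj, map_mul, map_mul, Complex.conj_I,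
    Complex.conj_ofReal, Complex.conj_ofReal] at h3
  have h4 : Complex.exp (-Complex.I * H.Ω₀ * (T : ℂ)) = Complex.exp (Complex.I * H.Ω₀ * (T : ℂ)) := by
    have : c * H.φ₀ t₁ ≠ 0 := mul_ne_zero hc0 h1
    exact mul_right_cancel₀ this (by linear_combination h3)
  obtain ⟨n, hn⟩ := Complex.exp_eq_exp_iff_exists_int.1 h4
  have h5 : -(2 * H.Ω₀ * T) = n * (2 * Real.pi) := by
    have h : Complex.I * ((-(2 * H.Ω₀ * T) : ℝ) : ℂ) = Complex.I * ((n * (2 * Real.pi) : ℝ) : ℂ) := by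
      push_cast
      linear_combination hn
    exact_mod_cast mul_left_cancel₀ Complex.I_ne_zero h
  have h6 : n * H.ω₀ + 2 * H.Ω₀ = 0 := by
    have hpi := Real.pi_ne_zero
    rw [hT] at h5
    field_simp at h5
    linarith
  refine H.freq_ne_zero hC₀ hdio (ν := ((0 : Fin A → ℤ), n, (2 : ℤ)))
    (fun h => by simp [Prod.ext_iff] at h) ?_
  simpa [HillData.freq] using h6

/-- Removing the Floquet factor leaves the Fourier coefficients of a power of a periodic analytic
function; its having no zeros is what permits negative powers. -/
theorem HillData.exists_norm_φ₀Coeff_le (hC₀ : 0 < C₀) (hdio : H.IsDiophantine C₀ τ) (a : ℤ) :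
    ∃ F κ : ℝ, 0 ≤ F ∧ 0 < κ ∧ ∀ n : ℤ, ‖H.φ₀Coeff a n‖ ≤ F * Real.exp (-(κ * |(n : ℝ)|)) := by
  have hω := H.ω₀_ne_zero hC₀ hdio
  set g : ℝ → ℂ := fun t => Complex.exp (-(Complex.I * H.Ω₀ * t)) * H.φ₀ t with hg
  have hga : AnalyticOnNhd ℝ g Set.univ := by
    intro t ht
    have h1 : AnalyticAt ℝ (fun t : ℝ => -(Complex.I * H.Ω₀ * (t : ℂ))) t :=
      (analyticAt_const.mul (Complex.ofRealCLM.analyticAt t)).neg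
    exact (AnalyticAt.comp (g := Complex.exp) (f := fun t : ℝ => -(Complex.I * H.Ω₀ * (t : ℂ)))
      (analyticAt_cexp.restrictScalars (𝕜 := ℝ)) h1).mul (H.φ₀_analytic t ht)
  have hg0 : ∀ t, g t ≠ 0 := fun t => mul_ne_zero (Complex.exp_ne_zero _) (H.φ₀_ne_zero hC₀ hdio t)
  have hfa : AnalyticOnNhd ℝ (fun t => g t ^ a) Set.univ := fun t ht => (hga t ht).zpow (hg0 t)
  obtain ⟨F, κ, hF, hκ, hb⟩ := exists_norm_intervalIntegral_le hfa hω
    (fun t => by rw [show g (t + 2 * Real.pi / H.ω₀) = g t from H.φ₀_floquet t])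
  refine ⟨|H.ω₀ / (2 * Real.pi)| * F, κ, by positivity, hκ, fun n => ?_⟩
  have e : ∀ t : ℝ, (H.φ₀ t) ^ a * Complex.exp (-(Complex.I * ((n * H.ω₀ + a * H.Ω₀ : ℝ) : ℂ) * t)) =
      g t ^ a * Complex.exp (-(Complex.I * ((n * H.ω₀ : ℝ) : ℂ) * t)) := by
    intro t
    simp only [hg]
    have h : Complex.exp (-(Complex.I * ((n * H.ω₀ + a * H.Ω₀ : ℝ) : ℂ) * t)) =
        Complex.exp (a * -(Complex.I * H.Ω₀ * t)) *
          Complex.exp (-(Complex.I * ((n * H.ω₀ : ℝ) : ℂ) * t)) := by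
      rw [← Complex.exp_add]
      congr 1
      push_cast; ring
    rw [mul_zpow, ← Complex.exp_int_mul, h]
    ring
  rw [HillData.φ₀Coeff, norm_mul, Complex.norm_real, Real.norm_eq_abs, mul_assoc]
  simp only [e]
  exact mul_le_mul_of_nonneg_left (hb n) (abs_nonneg _)

theorem HillData.exists_norm_p₁Coeff_le (hA : 1 ≤ A) :
    ∃ F κ : ℝ, 0 ≤ F ∧ 0 < κ ∧ ∀ m : Fin A → ℤ,
      ‖H.p₁Coeff m‖ ≤ F * Real.exp (-(κ * ∑ i, |(m i : ℝ)|)) := by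
  obtain ⟨n, rfl⟩ : ∃ n, A = n + 1 := ⟨A - 1, by omega⟩
  have hfa : AnalyticOnNhd ℝ (fun α => (H.P₁ α : ℂ)) Set.univ := fun α hα =>
    (Complex.ofRealCLM.analyticAt _).comp (H.P₁_analytic α hα)
  obtain ⟨F, κ, hF, hκ, hb⟩ := exists_norm_integral_box_le hfa (fun α i => by
    have : α + Pi.single i (2 * Real.pi) = Function.update α i (α i + 2 * Real.pi) := by
      funext j
      rcases eq_or_ne j i with rfl | hj
      · simp
      · simp [hj]
    rw [this, H.P₁_periodic])
  refine ⟨‖((2 * Real.pi : ℝ) : ℂ)⁻¹ ^ (n + 1)‖ * F, κ, by positivity, hκ, fun m => ?_⟩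
  rw [HillData.p₁Coeff, norm_mul, mul_assoc]
  exact mul_le_mul_of_nonneg_left (hb m) (norm_nonneg _)

/-- Exponential decay of the coefficients `Q_ν` and `R_ν`. -/
theorem HillData.exists_norm_Q_R_le (hA : 1 ≤ A) (hC₀ : 0 < C₀) (hdio : H.IsDiophantine C₀ τ) :
    ∃ F κ : ℝ, 0 ≤ F ∧ 0 < κ ∧ (∀ ν, ‖H.Q ν‖ ≤ F * Real.exp (-(κ * ν.l1))) ∧
      ∀ ν, ‖H.R ν‖ ≤ F * Real.exp (-(κ * ν.l1)) := by
  obtain ⟨F₁, κ₁, hF₁, hκ₁, h₁⟩ := H.exists_norm_φ₀Coeff_le hC₀ hdio (-2)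
  obtain ⟨F₂, κ₂, hF₂, hκ₂, h₂⟩ := H.exists_norm_φ₀Coeff_le hC₀ hdio 2
  obtain ⟨F₃, κ₃, hF₃, hκ₃, h₃⟩ := H.exists_norm_p₁Coeff_le hA
  set κ := min κ₁ (min κ₂ κ₃) with hκ
  have hκ0 : 0 < κ := lt_min hκ₁ (lt_min hκ₂ hκ₃)
  -- The factor `exp(2κ)` accounts for the last component `±2` of the modes, which contributes to
  -- the norm but carries no decay of its own.
  refine ⟨(F₁ + F₃ * F₂) * Real.exp (2 * κ), κ, by positivity, hκ0, fun ν => ?_, fun ν => ?_⟩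
  · unfold HillData.Q
    split_ifs with h
    · refine (h₁ _).trans ?_
      have hl : ν.l1 = |(ν.2.1 : ℝ)| + 2 := by simp [Mode.l1, h.1, h.2]
      rw [hl, mul_assoc, ← Real.exp_add, show 2 * κ + -(κ * (|(ν.2.1 : ℝ)| + 2)) =
        -(κ * |(ν.2.1 : ℝ)|) by ring]
      have : κ ≤ κ₁ := min_le_left _ _
      gcongr
      have : 0 ≤ F₃ * F₂ := by positivity
      linarith
    · rw [norm_zero]; positivity
  · unfold HillData.R
    split_ifs with h
    · rw [norm_mul]
      have hl : ν.l1 = ∑ i, |(ν.1 i : ℝ)| + |(ν.2.1 : ℝ)| + 2 := by simp [Mode.l1, h]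
      have hκ2 : κ ≤ κ₂ := (min_le_right _ _).trans (min_le_left _ _)
      have hκ3 : κ ≤ κ₃ := (min_le_right _ _).trans (min_le_right _ _)
      calc _ ≤ (F₃ * Real.exp (-(κ₃ * ∑ i, |(ν.1 i : ℝ)|))) *
            (F₂ * Real.exp (-(κ₂ * |(ν.2.1 : ℝ)|))) :=
            mul_le_mul (h₃ _) (h₂ _) (norm_nonneg _) (by positivity)
        _ ≤ (F₃ * Real.exp (-(κ * ∑ i, |(ν.1 i : ℝ)|))) *
            (F₂ * Real.exp (-(κ * |(ν.2.1 : ℝ)|))) := by gcongr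
        _ = (F₃ * F₂) * Real.exp (-(κ * (∑ i, |(ν.1 i : ℝ)| + |(ν.2.1 : ℝ)|))) := by
            rw [mul_mul_mul_comm, ← Real.exp_add]; ring_nf
        _ ≤ (F₁ + F₃ * F₂) * Real.exp (-(κ * (∑ i, |(ν.1 i : ℝ)| + |(ν.2.1 : ℝ)|))) := by
            gcongr; linarith
        _ = _ := by
            rw [hl, mul_assoc, ← Real.exp_add]; ring_nf
    · rw [norm_zero]; positivity

end Floquet

/-! ### Summability over modes and scales; choice of parameters -/

theorem summable_exp_neg_mul_abs {c : ℝ} (hc : 0 < c) :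
    Summable fun n : ℤ => Real.exp (-(c * |(n : ℝ)|)) := by
  have h : Summable fun n : ℕ => Real.exp (-(c * n)) := by
    have : (fun n : ℕ => Real.exp (-(c * n))) = fun n : ℕ => Real.exp (-c) ^ n := by
      funext n; rw [← Real.exp_nat_mul]; ring_nf
    rw [this]
    exact summable_geometric_of_lt_one (Real.exp_pos _).le (Real.exp_lt_one_iff.2 (by linarith))
  refine Summable.of_nat_of_neg ?_ ?_ <;> simpa using h

theorem summable_pi_prod {f : ℤ → ℝ} (hf : Summable f) (h0 : ∀ n, 0 ≤ f n) (A : ℕ) :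
    Summable fun m : Fin A → ℤ => ∏ i, f (m i) := by
  induction A with
  | zero => exact Summable.of_finite
  | succ A ih =>
    rw [← (Fin.consEquiv fun _ => ℤ).summable_iff]
    have := hf.mul_of_nonneg ih h0 fun m => Finset.prod_nonneg fun i _ => h0 _
    refine this.congr fun p => ?_
    simp [Fin.prod_univ_succ, Fin.consEquiv]

theorem summable_exp_neg_mul_l1 {c : ℝ} (hc : 0 < c) (A : ℕ) :
    Summable fun ν : Mode A => Real.exp (-(c * ν.l1)) := by
  have h1 := summable_exp_neg_mul_abs hc
  have h2 := summable_pi_prod h1 (fun n => (Real.exp_pos _).le) A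
  have h3 := h2.mul_of_nonneg (h1.mul_of_nonneg h1 (fun n => (Real.exp_pos _).le)
    fun n => (Real.exp_pos _).le) (fun m => Finset.prod_nonneg fun i _ => (Real.exp_pos _).le)
    fun p => by positivity
  refine h3.congr fun ν => ?_
  rw [← Real.exp_sum, ← Real.exp_add, ← Real.exp_add]
  congr 1
  simp only [Mode.l1, Finset.sum_neg_distrib, ← Finset.mul_sum]
  ring

section Parameters

theorem tsum_ofReal_half_pow : ∑' n : ℕ, ENNReal.ofReal ((1 / 2 : ℝ) ^ n) = ENNReal.ofReal 2 := by
  rw [← ENNReal.ofReal_tsum_of_nonneg (fun n => by positivity) summable_geometric_two,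
    tsum_geometric_two]

theorem tsum_scales_le {A : ℕ} {f : Mode A → ℝ} (hf : ∀ ν, 0 ≤ f ν) {c S : ℝ} (hc : 0 ≤ c)
    (hS : ∑' ν, ENNReal.ofReal (f ν) ≤ ENNReal.ofReal S) :
    ∑' p : Mode A × ℕ, ENNReal.ofReal (c * (f p.1 * (1 / 2) ^ p.2)) ≤
      ENNReal.ofReal (c * (S * 2)) := by
  have h : ∀ (ν : Mode A) (n : ℕ), ENNReal.ofReal (c * (f ν * (1 / 2) ^ n)) =
      ENNReal.ofReal c * (ENNReal.ofReal (f ν) * ENNReal.ofReal ((1 / 2) ^ n)) := fun ν n => by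
    rw [ENNReal.ofReal_mul hc, ENNReal.ofReal_mul (hf ν)]
  rw [ENNReal.tsum_prod']
  simp only [h, ENNReal.tsum_mul_left, ENNReal.tsum_mul_right, tsum_ofReal_half_pow]
  rw [ENNReal.ofReal_mul hc, ENNReal.ofReal_mul' (by norm_num : (0 : ℝ) ≤ 2)]
  gcongr

theorem four_mul_eighth (n : ℕ) : (4 : ℝ) ^ n * (1 / 8) ^ n = (1 / 2) ^ n := by
  rw [← mul_pow]; norm_num

/-- With `B = D 64^{n₀}`, the weights of vertices and bullets sum to at most `2ηBS` and `2BS`. The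
convergence criterion for trees and the smallness of the self-energies are both implied by a bound
on `η (1 + 2BS)²`, which is why `64^{n₀}` enters squared. -/
theorem exists_treeBounds {A : ℕ} (H : HillData A) {D κ S τ₁ γ θ : ℝ} (hD : 0 ≤ D) (hκ : 0 ≤ κ)
    (hS : 0 ≤ S) (hθ : 0 ≤ θ) (hθ1 : θ ≤ 1)
    (hQ : ∑' ν, ENNReal.ofReal (‖H.Q ν‖ * Real.exp (2 * κ * ν.l1)) ≤ ENNReal.ofReal S)
    (hR : ∑' ν, ENNReal.ofReal (‖H.R ν‖ * Real.exp (2 * κ * ν.l1)) ≤ ENNReal.ofReal S)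
    {η : ℝ} (hη : 0 ≤ η) {n₀ : ℕ}
    (hγ : ∀ n, ∑ q ∈ Finset.Ico n₀ n, countConst τ₁ q ≤ γ) (hlog : Real.log 64 * γ ≤ κ)
    (hsmall : η * (4 * (1 + S) * (1 + 2 * D * S) ^ 2) * (64 ^ n₀) ^ 2 ≤ θ) :
    TreeBounds H D κ η n₀ τ₁ γ θ (ENNReal.ofReal S)
      (ENNReal.ofReal (2 * (1 + D * 64 ^ n₀ * (S * 2)))) := by
  set B : ℝ := D * 64 ^ n₀ with hB
  have hB0 : 0 ≤ B := by positivity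
  have hX : (0 : ℝ) ≤ 1 + B * (S * 2) := by positivity
  have h64 : (1 : ℝ) ≤ 64 ^ n₀ := one_le_pow₀ (by norm_num)
  have hle : 1 + B * (S * 2) ≤ (1 + 2 * D * S) * 64 ^ n₀ := by
    have : B * (S * 2) = 2 * D * S * 64 ^ n₀ := by rw [hB]; ring
    linarith
  have hsq : η * (4 * (1 + S)) * (1 + B * (S * 2)) ^ 2 ≤ θ := by
    refine le_trans ?_ hsmall
    calc _ ≤ η * (4 * (1 + S)) * ((1 + 2 * D * S) * 64 ^ n₀) ^ 2 := by gcongr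
      _ = _ := by ring
  refine ⟨hD, hη, hκ, hθ, hγ, hlog, ?_, ?_, ?_⟩
  · refine (ENNReal.tsum_le_tsum fun ν => ENNReal.ofReal_le_ofReal ?_).trans hQ
    exact le_mul_of_one_le_right (norm_nonneg _)
      (Real.one_le_exp (mul_nonneg (by positivity) ν.l1_nonneg))
  · have ha : ∑' p : Mode A × ℕ, vertexWeight H D κ η n₀ p.1 p.2 ≤
        ENNReal.ofReal (η * B * (S * 2)) := by
      refine le_trans (le_of_eq (tsum_congr fun p => ?_))
        (tsum_scales_le (fun ν => by positivity) (by positivity) hQ)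
      rw [vertexWeight, ← four_mul_eighth]
      congr 1
      rw [hB]; ring
    have hb : ∑' p : Mode A × ℕ, bulletWeight H D κ n₀ p.1 p.2 ≤
        ENNReal.ofReal (B * (S * 2)) := by
      refine le_trans (le_of_eq (tsum_congr fun p => ?_))
        (tsum_scales_le (fun ν => by positivity) hB0 hR)
      rw [bulletWeight, ← four_mul_eighth]
      congr 1
      rw [hB]; ring
    have h1 : 1 + ENNReal.ofReal (B * (S * 2)) = ENNReal.ofReal (1 + B * (S * 2)) := by
      rw [ENNReal.ofReal_add zero_le_one (by positivity), ENNReal.ofReal_one]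
    have h4 : (4 : ℝ≥0∞) = ENNReal.ofReal 4 := by simp
    have h2 : (2 : ℝ≥0∞) = ENNReal.ofReal 2 := by simp
    refine (LTree.tsum_weight_le ha hb ?_).trans (le_of_eq ?_)
    · rw [h1, h4, ← ENNReal.ofReal_mul (by norm_num), ← ENNReal.ofReal_mul (by positivity),
        ENNReal.ofReal_le_one]
      have : 4 * (η * B * (S * 2)) * (1 + B * (S * 2)) ≤
          η * (4 * (1 + S)) * (1 + B * (S * 2)) ^ 2 := by
        have h5 : B * (S * 2) ≤ (1 + S) * (1 + B * (S * 2)) := by nlinarith [mul_nonneg hB0 hS]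
        calc 4 * (η * B * (S * 2)) * (1 + B * (S * 2))
            = 4 * η * (1 + B * (S * 2)) * (B * (S * 2)) := by ring
          _ ≤ 4 * η * (1 + B * (S * 2)) * ((1 + S) * (1 + B * (S * 2))) := by gcongr
          _ = _ := by ring
      linarith
    · rw [h1, h2, ← ENNReal.ofReal_mul (by norm_num)]
  · rw [← ENNReal.ofReal_mul hη, ← ENNReal.ofReal_mul (by positivity),
      ← ENNReal.ofReal_mul (by positivity)]
    refine ENNReal.ofReal_le_ofReal (le_trans ?_ hsq)
    calc η * S * (2 * (1 + B * (S * 2))) * (2 * (1 + B * (S * 2)))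
        = η * (4 * S) * (1 + B * (S * 2)) ^ 2 := by ring
      _ ≤ η * (4 * (1 + S)) * (1 + B * (S * 2)) ^ 2 := by gcongr; linarith

/-- Of the decay rate `κ₀`, half is spent on `exp(2κ|ν|)` with `κ = κ₀/4`: one `κ` for the cost of
the scales, one for the weight carried by the trees. The other half makes the sum over modes
converge. -/
theorem tsum_ofReal_norm_le {A : ℕ} {f : Mode A → ℂ} {F κ₀ : ℝ} (hκ₀ : 0 < κ₀)
    (hf : ∀ ν, ‖f ν‖ ≤ F * Real.exp (-(κ₀ * ν.l1))) :
    ∑' ν, ENNReal.ofReal (‖f ν‖ * Real.exp (2 * (κ₀ / 4) * ν.l1)) ≤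
      ENNReal.ofReal (∑' ν : Mode A, F * Real.exp (-(κ₀ / 2 * ν.l1))) := by
  have hs : Summable fun ν : Mode A => F * Real.exp (-(κ₀ / 2 * ν.l1)) :=
    (summable_exp_neg_mul_l1 (by positivity) A).mul_left F
  have hle : ∀ ν, ‖f ν‖ * Real.exp (2 * (κ₀ / 4) * ν.l1) ≤
      F * Real.exp (-(κ₀ / 2 * ν.l1)) := fun ν => by
    calc _ ≤ F * Real.exp (-(κ₀ * ν.l1)) * Real.exp (2 * (κ₀ / 4) * ν.l1) := by
          gcongr; exact hf ν
      _ = _ := by rw [mul_assoc, ← Real.exp_add]; ring_nf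
  rw [ENNReal.ofReal_tsum_of_nonneg (fun ν => le_trans (by positivity) (hle ν)) hs]
  exact ENNReal.tsum_le_tsum fun ν => ENNReal.ofReal_le_ofReal (hle ν)

/-- The constant in the sum of the bounds on the numbers of lines on large scales. -/
def countSum (τ₁ : ℝ) : ℝ := 2 * (2 : ℝ) ^ (3 / τ₁) / (1 - (2 : ℝ) ^ (-1 / τ₁))

/-- A geometric series with ratio `2^{-1/τ₁}`; the initial scale is chosen so that its first power
is at most `1/z`. -/
theorem sum_countConst_le {τ₁ z : ℝ} (hτ₁ : 0 < τ₁) (hz : 0 < z) {n₀ : ℕ}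
    (hn₀ : τ₁ * Real.logb 2 z ≤ n₀) (n : ℕ) :
    ∑ q ∈ Finset.Ico n₀ n, countConst τ₁ q ≤ countSum τ₁ / z := by
  set r : ℝ := (2 : ℝ) ^ (-1 / τ₁) with hr
  have hr0 : 0 ≤ r := by positivity
  have hr1 : r < 1 := Real.rpow_lt_one_of_one_lt_of_neg (by norm_num)
    (div_neg_of_neg_of_pos (by norm_num) hτ₁)
  have hq : ∀ q : ℕ, countConst τ₁ q = 2 * (2 : ℝ) ^ (3 / τ₁) * r ^ q := fun q => by
    rw [countConst, mul_assoc, hr, ← Real.rpow_natCast, ← Real.rpow_mul (by norm_num),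
      ← Real.rpow_add (by norm_num)]
    congr 2
    ring
  have hrn : r ^ n₀ ≤ 1 / z := by
    have h1 : z ≤ (2 : ℝ) ^ ((n₀ : ℝ) / τ₁) := by
      rw [← Real.logb_le_iff_le_rpow (by norm_num) hz, le_div_iff₀ hτ₁, mul_comm]
      exact hn₀
    have h2 : r ^ n₀ = ((2 : ℝ) ^ ((n₀ : ℝ) / τ₁))⁻¹ := by
      rw [hr, ← Real.rpow_natCast, ← Real.rpow_mul (by norm_num), ← Real.rpow_neg (by norm_num)]
      congr 1
      ring
    rw [h2, one_div]
    exact inv_anti₀ hz h1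
  simp only [hq]
  rw [← Finset.mul_sum]
  have h3 : ∑ q ∈ Finset.Ico n₀ n, r ^ q ≤ r ^ n₀ / (1 - r) :=
    geom_sum_Ico_le_of_lt_one hr0 hr1
  have h4 : 0 < 1 - r := by linarith
  calc _ ≤ 2 * (2 : ℝ) ^ (3 / τ₁) * (1 / z / (1 - r)) := by
        refine mul_le_mul_of_nonneg_left (h3.trans ?_) (by positivity)
        gcongr
    _ = countSum τ₁ / z := by
        rw [countSum, ← hr]
        field_simp

theorem two_pow_startScale_le {τ₁ z : ℝ} (hτ₁ : 0 < τ₁) (hz : 1 ≤ z) :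
    (2 : ℝ) ^ ⌈τ₁ * Real.logb 2 z⌉₊ ≤ 2 * z ^ τ₁ := by
  have h0 : 0 ≤ τ₁ * Real.logb 2 z := mul_nonneg hτ₁.le (Real.logb_nonneg (by norm_num) hz)
  have h1 := (Nat.ceil_lt_add_one h0).le
  rw [← Real.rpow_natCast]
  calc (2 : ℝ) ^ ((⌈τ₁ * Real.logb 2 z⌉₊ : ℕ) : ℝ) ≤ (2 : ℝ) ^ (τ₁ * Real.logb 2 z + 1) :=
        Real.rpow_le_rpow_of_exponent_le (by norm_num) h1
    _ = 2 * z ^ τ₁ := by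
        rw [Real.rpow_add (by norm_num), Real.rpow_one, mul_comm τ₁, Real.rpow_mul (by norm_num),
          Real.rpow_logb (by norm_num) (by norm_num) (by linarith), mul_comm]

/-- The initial scale must be large enough for the counting, yet `64^{n₀}` must not defeat the
smallness of `ε`. The first holds because the logarithm grows, or by assumption on `c₁` when `c₂ =
0`; the second because powers of logarithms are dominated by `e^{-1/2}`. -/
theorem exists_mul_rpow_le {c₁ c₂ a δ c : ℝ} (hc₁ : 0 < c₁) (hc₂ : 0 ≤ c₂) (ha : 0 < a)
    (hδ : 0 < δ) (hc : c₂ = 0 → c ≤ c₁) :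
    ∃ e₀ : ℝ, 0 < e₀ ∧ ∀ e, 0 < e → e ≤ e₀ → c ≤ c₁ + c₂ * Real.log (2 / e) ∧
      e * (c₁ + c₂ * Real.log (2 / e)) ^ a ≤ δ := by
  -- With this exponent `((2/e)^b)^a` is a square root, which leaves a factor of order `e^{1/2}`.
  set b : ℝ := 1 / (2 * a) with hb
  have hb0 : 0 < b := by positivity
  set C : ℝ := (c₁ + c₂ / b) ^ a with hC
  have hC0 : 0 < C := Real.rpow_pos_of_pos (by positivity) _
  refine ⟨min 2 (min (2 * Real.exp (-(|c| / c₂))) ((δ / C) ^ 2 / 2)), by positivity,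
    fun e he hle => ⟨?_, ?_⟩⟩
  · rcases hc₂.eq_or_lt with h | h
    · rw [← h, zero_mul, add_zero]; exact hc h.symm
    · have h1 : e ≤ 2 * Real.exp (-(|c| / c₂)) :=
        hle.trans ((min_le_right _ _).trans (min_le_left _ _))
      have h2 : |c| / c₂ ≤ Real.log (2 / e) := by
        rw [Real.le_log_iff_exp_le (by positivity), le_div_iff₀ he]
        calc Real.exp (|c| / c₂) * e ≤ Real.exp (|c| / c₂) * (2 * Real.exp (-(|c| / c₂))) := by
              gcongr
          _ = 2 := by rw [mul_left_comm, ← Real.exp_add]; simp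
      rw [div_le_iff₀ h] at h2
      have := le_abs_self c
      linarith
  · have h2e : e ≤ 2 := hle.trans (min_le_left _ _)
    have hx : 1 ≤ 2 / e := by rw [le_div_iff₀ he]; linarith
    have hlog0 : 0 ≤ Real.log (2 / e) := Real.log_nonneg hx
    have hlog : Real.log (2 / e) ≤ (2 / e) ^ b / b := Real.log_le_rpow_div (by positivity) hb0
    have hxb : 1 ≤ (2 / e) ^ b := Real.one_le_rpow hx hb0.le
    have hz : c₁ + c₂ * Real.log (2 / e) ≤ (c₁ + c₂ / b) * (2 / e) ^ b := by
      have h1 := mul_le_mul_of_nonneg_left hlog hc₂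
      have h2 := mul_le_mul_of_nonneg_left hxb hc₁.le
      calc _ ≤ c₁ * (2 / e) ^ b + c₂ * ((2 / e) ^ b / b) := by linarith
        _ = _ := by ring
    have hza : (c₁ + c₂ * Real.log (2 / e)) ^ a ≤ C * Real.sqrt (2 / e) := by
      calc _ ≤ ((c₁ + c₂ / b) * (2 / e) ^ b) ^ a := by
            apply Real.rpow_le_rpow _ hz ha.le
            positivity
        _ = C * Real.sqrt (2 / e) := by
            rw [Real.mul_rpow (by positivity) (by positivity), ← Real.rpow_mul (by positivity),
              Real.sqrt_eq_rpow, hb]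
            congr 2
            field_simp
    have hsq : e * Real.sqrt (2 / e) = Real.sqrt (2 * e) := by
      rw [← Real.sqrt_sq he.le, ← Real.sqrt_mul (by positivity), Real.sqrt_sq he.le]
      congr 1
      field_simp
    have hfin : Real.sqrt (2 * e) ≤ δ / C := by
      rw [← Real.sqrt_sq (by positivity : 0 ≤ δ / C)]
      apply Real.sqrt_le_sqrt
      have : e ≤ (δ / C) ^ 2 / 2 := hle.trans ((min_le_right _ _).trans (min_le_right _ _))
      linarith
    calc _ ≤ e * (C * Real.sqrt (2 / e)) := by gcongr
      _ = C * Real.sqrt (2 * e) := by rw [← hsq]; ring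
      _ ≤ C * (δ / C) := by gcongr
      _ = δ := by field_simp

end Parameters

/-! ### The sum over renormalized trees -/

section Trees

variable {A : ℕ} {H : HillData A} {C₀ τ C₁ τ₁ : ℝ} {ψ : ℝ → ℝ} {K : ℕ → ℝ → ℂ} {n₀ : ℕ}
  {L κ ε γ θ : ℝ} {S W : ℝ≥0∞}

theorem TreeBounds.ofReal_norm_value_le
    (hT : TreeBounds H (3 * propConst C₁ L) κ |ε| n₀ τ₁ γ θ S W)
    (hB : DivisorBounds H C₀ τ C₁ τ₁ n₀ K) (hψ : IsCutoff C₁ ψ) (hL0 : 0 ≤ L)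
    (hK : ∀ j x y, ‖K j x - K j y‖ ≤ 1 / 2 * |x - y|) {k : ℕ} {ν : Mode A} {t : LTree A}
    (ht : t ∈ renTrees A n₀ k ν) :
    ENNReal.ofReal (|ε| ^ k * ‖t.value H (propOf ψ n₀ K) 0‖ * Real.exp (κ * ν.l1)) ≤
      treeWeight H (3 * propConst C₁ L) κ |ε| n₀ t := by
  obtain ⟨he, rfl, rfl, hm, h0, hs⟩ := ht
  have hC₁ := hB.C₁_pos
  by_cases hv : t.value H (propOf ψ n₀ K) 0 = 0
  · simp [hv]
  have hsupp : t.Supported H (IsGood C₁ n₀ K) 0 :=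
    (LTree.supported_of_value_ne_zero H t hv).imp fun s y hy j h1 h2 => by
      have := divisor_lt_of_propOf_ne_zero hψ hy j h1 h2
      linarith
  refine le_trans (ENNReal.ofReal_le_ofReal ?_) (hB.ofReal_valueBound_le (x := 0) hT.η_nonneg
    hT.D_nonneg hT.sum_countConst hT.log_mul_le t (by omega) (fun q _ => hK q)
    (fun h => absurd h (by omega)) hsupp hm hs h0)
  have hD := propConst_nonneg hC₁ hL0
  have h1 := LTree.norm_value_le H (g := propOf ψ n₀ K) (D := 3 * propConst C₁ L) (by positivity) 0
    t fun s _ y => (norm_propOf_le' hC₁ hψ hL0 y).trans (by gcongr; linarith)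
  have h2 : (1 : ℝ) ≤ 8 ^ t.scaleSum := one_le_pow₀ (by norm_num)
  have h3 := t.l1_modeSum_le
  have h4 := t.valueBound_nonneg H (D := 3 * propConst C₁ L) (by positivity)
  have hκ := hT.κ_nonneg
  calc |ε| ^ t.order * ‖t.value H (propOf ψ n₀ K) 0‖ * Real.exp (κ * t.modeSum.l1)
      ≤ |ε| ^ t.order * t.valueBound H (3 * propConst C₁ L) * Real.exp (κ * t.modeNorm) := by
        gcongr
    _ ≤ |ε| ^ t.order * t.valueBound H (3 * propConst C₁ L) * 8 ^ t.scaleSum *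
        Real.exp (κ * t.modeNorm) := by
        refine mul_le_mul_of_nonneg_right (le_mul_of_one_le_right ?_ h2) (Real.exp_pos _).le
        positivity

/-- Order and momentum can be read off the tree, so the joint sum over orders, momenta and trees is
part of the sum over all labelled trees. -/
theorem TreeBounds.summable_trees
    (hT : TreeBounds H (3 * propConst C₁ L) κ |ε| n₀ τ₁ γ θ S W) (hW : W ≠ ∞)
    (hB : DivisorBounds H C₀ τ C₁ τ₁ n₀ K) (hψ : IsCutoff C₁ ψ) (hL0 : 0 ≤ L)
    (hK : ∀ j x y, ‖K j x - K j y‖ ≤ 1 / 2 * |x - y|) :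
    Summable fun t : (Σ p : ℕ × Mode A, renTrees A n₀ p.1 p.2) =>
      |ε| ^ t.1.1 * ‖t.2.1.value H (propOf ψ n₀ K) 0‖ * Real.exp (κ * t.1.2.l1) := by
  set e : (Σ p : ℕ × Mode A, renTrees A n₀ p.1 p.2) → LTree A := fun t => t.2.1 with he
  have hinj : Function.Injective e := by
    rintro ⟨⟨k, ν⟩, ⟨t, h⟩⟩ ⟨⟨k', ν'⟩, ⟨t', h'⟩⟩ heq
    simp only [he] at heq
    subst heq
    obtain rfl : k = k' := h.2.1.symm.trans h'.2.1
    obtain rfl : ν = ν' := h.2.2.1.symm.trans h'.2.2.1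
    rfl
  refine (summable_and_tsum_le_of_ofReal (c := W.toReal) (fun t => by positivity)
    ENNReal.toReal_nonneg ?_).1
  rw [ENNReal.ofReal_toReal hW]
  calc _ ≤ ∑' t, treeWeight H (3 * propConst C₁ L) κ |ε| n₀ (e t) :=
        ENNReal.tsum_le_tsum fun t => hT.ofReal_norm_value_le hB hψ hL0 hK t.2.2
    _ ≤ ∑' t, treeWeight H (3 * propConst C₁ L) κ |ε| n₀ t :=
        ENNReal.tsum_comp_le_tsum_of_injective hinj _
    _ ≤ W := hT.tsum_treeWeight

end Trees

/-! ### Convergence and analyticity of the renormalized series -/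

section Series

variable {A : ℕ} {H : HillData A} {ψ : ℝ → ℝ} {n₀ : ℕ} {ε κ : ℝ}

theorem HillData.abs_freq_le (H : HillData A) (ν : Mode A) :
    |H.freq ν| ≤ (∑ i, |H.ω₁ i| + |H.ω₀| + |H.Ω₀|) * ν.l1 := by
  have h1 : |∑ i, (ν.1 i : ℝ) * H.ω₁ i| ≤ (∑ i, |H.ω₁ i|) * ∑ i, |(ν.1 i : ℝ)| := by
    refine (Finset.abs_sum_le_sum_abs _ _).trans ?_
    rw [Finset.mul_sum]
    refine Finset.sum_le_sum fun i _ => ?_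
    rw [abs_mul, mul_comm]
    gcongr
    exact Finset.single_le_sum (f := fun i => |H.ω₁ i|) (fun i _ => abs_nonneg _)
      (Finset.mem_univ i)
  have h2 : |H.freq ν| ≤ |∑ i, (ν.1 i : ℝ) * H.ω₁ i| + |(ν.2.1 : ℝ)| * |H.ω₀| +
      |(ν.2.2 : ℝ)| * |H.Ω₀| := by
    rw [← abs_mul, ← abs_mul]
    exact abs_add_three _ _ _
  have s1 : 0 ≤ ∑ i, |H.ω₁ i| := Finset.sum_nonneg fun i _ => abs_nonneg _
  have s2 : 0 ≤ ∑ i, |(ν.1 i : ℝ)| := Finset.sum_nonneg fun i _ => abs_nonneg _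
  have t1 := abs_nonneg H.ω₀
  have t2 := abs_nonneg H.Ω₀
  have t3 := abs_nonneg (ν.2.1 : ℝ)
  have t4 := abs_nonneg (ν.2.2 : ℝ)
  unfold Mode.l1
  nlinarith [mul_nonneg s1 t3, mul_nonneg s1 t4, mul_nonneg t1 s2, mul_nonneg t1 t4,
    mul_nonneg t2 s2, mul_nonneg t2 t3]

/-- A trigonometric series with exponentially decaying coefficients is analytic. -/
theorem analyticOnNhd_tsum_exp {ι : Type*} {f l : ι → ℝ} {a : ι → ℂ} {Ω : ℝ} (hκ : 0 < κ)
    (hΩ : 0 ≤ Ω) (hl : ∀ i, 0 ≤ l i) (hf : ∀ i, |f i| ≤ Ω * l i)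
    (ha : Summable fun i => ‖a i‖ * Real.exp (κ * l i)) :
    AnalyticOnNhd ℝ (fun t : ℝ => ∑' i, Complex.exp (Complex.I * (f i : ℂ) * t) * a i)
      Set.univ := by
  -- On this strip `|exp(i f z)| ≤ exp(κ l)`, so the series converges uniformly to a holomorphic
  -- function. The `+ 1` covers `Ω = 0`.
  set U : Set ℂ := {z | |z.im| < κ / (Ω + 1)} with hU
  have hUo : IsOpen U := isOpen_lt (by fun_prop) continuous_const
  have hd : DifferentiableOn ℂ
      (fun z : ℂ => ∑' i, Complex.exp (Complex.I * (f i : ℂ) * z) * a i) U := by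
    refine Complex.differentiableOn_tsum_of_summable_norm ha (fun i => ?_) hUo fun i z hz => ?_
    · exact (by fun_prop : Differentiable ℂ
        fun z : ℂ => Complex.exp (Complex.I * (f i : ℂ) * z) * a i).differentiableOn
    · rw [norm_mul, mul_comm, Complex.norm_exp]
      gcongr
      have hre : (Complex.I * (f i : ℂ) * z).re = -(f i * z.im) := by
        simp [mul_assoc]
      have hz' : |z.im| * (Ω + 1) ≤ κ := by
        have : |z.im| < κ / (Ω + 1) := hz
        rw [lt_div_iff₀ (by positivity)] at this
        exact this.le
      rw [hre]
      calc -(f i * z.im) ≤ |f i| * |z.im| := by rw [← abs_mul]; exact neg_le_abs _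
        _ ≤ Ω * l i * |z.im| := by gcongr; exact hf i
        _ = (|z.im| * Ω) * l i := by ring
        _ ≤ κ * l i := by
          have h1 := hl i
          gcongr
          nlinarith [abs_nonneg z.im]
  intro t _
  have hmem : (t : ℂ) ∈ U := by
    simp only [hU, Set.mem_ofPred_eq, Complex.ofReal_im, abs_zero]; positivity
  have han := hd.analyticAt (hUo.mem_nhds hmem)
  exact AnalyticAt.comp (g := fun z : ℂ => ∑' i, Complex.exp (Complex.I * (f i : ℂ) * z) * a i)
    (f := fun t : ℝ => (t : ℂ)) (han.restrictScalars (𝕜 := ℝ)) (Complex.ofRealCLM.analyticAt t)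

theorem norm_exp_I_mul_freq (x t : ℝ) : ‖Complex.exp (Complex.I * (x : ℂ) * t)‖ = 1 := by
  rw [show Complex.I * (x : ℂ) * t = ((x * t : ℝ) : ℂ) * Complex.I by push_cast; ring,
    Complex.norm_exp_ofReal_mul_I]

/-- The values of the renormalized trees of all orders and momenta, weighted by an exponential of
the momentum, are summable. -/
def SummableTrees (H : HillData A) (ψ : ℝ → ℝ) (n₀ : ℕ) (ε κ : ℝ) : Prop :=
  Summable fun t : (Σ p : ℕ × Mode A, renTrees A n₀ p.1 p.2) =>
    |ε| ^ t.1.1 * ‖t.2.1.value H (H.prop ψ n₀ ε) 0‖ * Real.exp (κ * t.1.2.l1)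

/-- The summability at hand carries the factor `|ε|^k`; dividing it out requires `ε ≠ 0`, which
holds throughout the shell. -/
theorem summable_renTrees_value (hs : SummableTrees H ψ n₀ ε κ) (hε : ε ≠ 0) (k : ℕ) (ν : Mode A) :
    Summable fun t : renTrees A n₀ k ν => t.1.value H (H.prop ψ n₀ ε) 0 := by
  have h : Summable fun t : renTrees A n₀ k ν =>
      |ε| ^ k * ‖t.1.value H (H.prop ψ n₀ ε) 0‖ * Real.exp (κ * ν.l1) := Summable.sigma_factor hs (k, ν)
  have h1 := (summable_mul_right_iff (Real.exp_ne_zero _)).1 h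
  exact ((summable_mul_left_iff (pow_ne_zero _ (abs_ne_zero.2 hε))).1 h1).of_norm

theorem summable_uCoeff_mul_exp (hs : SummableTrees H ψ n₀ ε κ) (hε : ε ≠ 0) :
    Summable fun p : ℕ × Mode A => ‖(ε : ℂ) ^ p.1 * H.uCoeff ψ n₀ ε p.1 p.2‖ * Real.exp (κ * p.2.l1) := by
  refine Summable.of_nonneg_of_le (fun p => by positivity) (fun p => ?_) (Summable.sigma hs)
  have h : Summable fun t : renTrees A n₀ p.1 p.2 =>
      |ε| ^ p.1 * ‖t.1.value H (H.prop ψ n₀ ε) 0‖ * Real.exp (κ * p.2.l1) := Summable.sigma_factor hs p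
  by_cases h0 : p.2 = 0
  · rw [HillData.uCoeff, if_pos h0, mul_zero, norm_zero, zero_mul]
    exact tsum_nonneg fun t => by positivity
  · have hv := (summable_renTrees_value hs hε p.1 p.2).norm
    have e : ∑' t : renTrees A n₀ p.1 p.2,
        |ε| ^ p.1 * ‖t.1.value H (H.prop ψ n₀ ε) 0‖ * Real.exp (κ * p.2.l1) =
        |ε| ^ p.1 * (∑' t : renTrees A n₀ p.1 p.2, ‖t.1.value H (H.prop ψ n₀ ε) 0‖) *
          Real.exp (κ * p.2.l1) := by
      rw [tsum_mul_right, tsum_mul_left]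
    rw [HillData.uCoeff, if_neg h0, norm_mul, norm_pow, Complex.norm_real, Real.norm_eq_abs]
    refine le_trans ?_ e.ge
    gcongr
    exact norm_tsum_le_tsum_norm hv

theorem summable_norm_uCoeff (hκ : 0 ≤ κ) (hs : SummableTrees H ψ n₀ ε κ)
    (hε : ε ≠ 0) : Summable fun p : ℕ × Mode A =>
    ‖(ε : ℂ) ^ p.1 * H.uCoeff ψ n₀ ε p.1 p.2‖ :=
  Summable.of_nonneg_of_le (fun _ => norm_nonneg _)
    (fun p => le_mul_of_one_le_right (norm_nonneg _)
      (Real.one_le_exp (mul_nonneg hκ p.2.l1_nonneg))) (summable_uCoeff_mul_exp hs hε)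

theorem norm_pow_mul_uOrder_le (hκ : 0 ≤ κ) (hs : SummableTrees H ψ n₀ ε κ)
    (hε : ε ≠ 0) (k : ℕ) (t : ℝ) :
    ‖(ε : ℂ) ^ k * H.uOrder ψ n₀ ε k t‖ ≤
      ∑' ν : Mode A, ‖(ε : ℂ) ^ k * H.uCoeff ψ n₀ ε k ν‖ := by
  have h := (summable_norm_uCoeff hκ hs hε).prod_factor k
  rw [HillData.uOrder, ← tsum_mul_left]
  refine tsum_of_norm_bounded h.hasSum fun ν => le_of_eq ?_
  rw [mul_left_comm, norm_mul, norm_exp_I_mul_freq, one_mul]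

theorem tendstoUniformly_uBar (hκ : 0 ≤ κ) (hs : SummableTrees H ψ n₀ ε κ)
    (hε : ε ≠ 0) : TendstoUniformly
    (fun (N : ℕ) (t : ℝ) => ∑ k ∈ Finset.range N, (ε : ℂ) ^ k * H.uOrder ψ n₀ ε k t)
    (H.uBar ψ n₀ ε) atTop :=
  tendstoUniformly_tsum_nat (summable_norm_uCoeff hκ hs hε).prod
    fun k t => norm_pow_mul_uOrder_le hκ hs hε k t

theorem uBar_eq_tsum (hκ : 0 ≤ κ) (hs : SummableTrees H ψ n₀ ε κ)
    (hε : ε ≠ 0) (t : ℝ) : H.uBar ψ n₀ ε t =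
    ∑' p : ℕ × Mode A, Complex.exp (Complex.I * (H.freq p.2 : ℂ) * t) *
      ((ε : ℂ) ^ p.1 * H.uCoeff ψ n₀ ε p.1 p.2) := by
  have hsum : Summable fun p : ℕ × Mode A => Complex.exp (Complex.I * (H.freq p.2 : ℂ) * t) *
      ((ε : ℂ) ^ p.1 * H.uCoeff ψ n₀ ε p.1 p.2) := by
    refine Summable.of_norm_bounded (summable_norm_uCoeff hκ hs hε) fun p => le_of_eq ?_
    rw [norm_mul, norm_exp_I_mul_freq, one_mul]
  rw [hsum.tsum_prod]
  refine tsum_congr fun k => ?_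
  rw [HillData.uOrder, ← tsum_mul_left]
  exact tsum_congr fun ν => mul_left_comm _ _ _

end Series

end HillRen

/-! ### Fixing the constants and assembling the proof -/

open HillRen in
theorem proposition7p8 {A : ℕ} (hA : 1 ≤ A) (H : HillRen.HillData A)
    (C₀ τ C₁ τ₁ : ℝ) (hC₀ : 0 < C₀) (hτ : (A : ℝ) + 1 < τ) (hdio : H.IsDiophantine C₀ τ)
    (hC₁ : 0 < C₁) (hC₁₀ : C₁ < C₀) (hτ₁ : τ < τ₁)
    (ψ : ℝ → ℝ) (hψ : HillRen.IsCutoff C₁ ψ) :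
    ∃ cstar : ℝ, ∀ c₁ c₂ : ℝ, 0 < c₁ → 0 ≤ c₂ → (c₂ = 0 → cstar ≤ c₁) →
      ∃ εbar : ℝ, 0 < εbar ∧ ∀ ε₀ : ℝ, 0 < ε₀ → ε₀ ≤ εbar → ∀ m n₀ : ℕ,
        n₀ = HillRen.startScale τ₁ c₁ c₂ ε₀ m →
        volume (H.admissible ψ n₀ C₁ τ₁ ∩ HillRen.shell ε₀ m) ≠ 0 →
        ∀ ε ∈ H.admissible ψ n₀ C₁ τ₁ ∩ HillRen.shell ε₀ m,
          -- the sums defining the renormalized propagators converge absolutely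
          (∀ n, n₀ ≤ n → ∀ x : ℝ, H.Xi ψ n₀ ε n x ≠ 0 →
            Summable fun T : (Σ k : ℕ, HillRen.renSelfEnergies A n₀ k n) =>
              T.2.1.value H (H.prop ψ n₀ ε) ε x) ∧
          -- the bound on the renormalized propagators
          (∀ n, n₀ ≤ n → ∀ x : ℝ, ‖H.prop ψ n₀ ε n x‖ ≤ C₁⁻¹ * 2 ^ (n + 1)) ∧
          -- the sums over trees and the renormalized series converge absolutely
          (∀ (k : ℕ) (ν : HillRen.Mode A), ν ≠ 0 →
            Summable fun θ : HillRen.renTrees A n₀ k ν => θ.1.value H (H.prop ψ n₀ ε) 0) ∧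
          (Summable fun p : ℕ × HillRen.Mode A => ‖(ε : ℂ) ^ p.1 * H.uCoeff ψ n₀ ε p.1 p.2‖) ∧
          -- the series converges uniformly in time to an analytic function
          TendstoUniformly
            (fun (N : ℕ) (t : ℝ) => ∑ k ∈ Finset.range N, (ε : ℂ) ^ k * H.uOrder ψ n₀ ε k t)
            (H.uBar ψ n₀ ε) atTop ∧
          AnalyticOnNhd ℝ (H.uBar ψ n₀ ε) Set.univ := by
  have hτ0 : 0 < τ := lt_trans (by positivity) hτ
  have hτ₁0 : 0 < τ₁ := hτ0.trans hτ₁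
  obtain ⟨L, hL0, hL⟩ := hψ.exists_lipschitz
  obtain ⟨F, κ₀, hF, hκ₀, hQ, hR⟩ := H.exists_norm_Q_R_le hA hC₀ hdio
  have hlog : 0 < Real.log 64 := Real.log_pos (by norm_num)
  have hD : 0 ≤ 3 * propConst C₁ L := by
    have := propConst_nonneg hC₁ hL0
    positivity
  set κ : ℝ := κ₀ / 4 with hκ
  have hκ0 : 0 < κ := by positivity
  set S : ℝ := ∑' ν : Mode A, F * Real.exp (-(κ₀ / 2 * ν.l1)) with hS
  have hS0 : 0 ≤ S := tsum_nonneg fun ν => by positivity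
  -- The largest total count for which `64` to the scale sum is still absorbed by `exp(κ ·
  -- modeNorm)`.
  set γ : ℝ := κ / Real.log 64 with hγ
  have hγ0 : 0 < γ := by positivity
  -- The size of the self-energies for which the increments of `𝓜` have Lipschitz constants
  -- `4^{-(n+1)}`.
  set θ : ℝ := 1 / (12 * (L + 1)) with hθ
  have hθ0 : 0 < θ := by positivity
  have hθ1 : θ ≤ 1 := by
    rw [hθ, div_le_one (by positivity)]; linarith
  have hθL : 12 * (L + 1) * θ ≤ 1 := le_of_eq (by rw [hθ]; field_simp)
  set G : ℝ := 4 * (1 + S) * (1 + 2 * (3 * propConst C₁ L) * S) ^ 2 with hG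
  have hG0 : 0 < G := by positivity
  -- The `1` makes the logarithm defining `n₀` non-negative, so that rounding up costs only a factor
  -- `2` in `2^{n₀}`; the other entry brings the sum of the counting constants below `γ`.
  refine ⟨max 1 (countSum τ₁ / γ), fun c₁ c₂ hc₁ hc₂ hc => ?_⟩
  -- Since `(64^{n₀})² = (2^{n₀})^{12}` and `2^{n₀} ≤ 2 z^{τ₁}`, the exponent is `12 τ₁` and the
  -- prefactor `2^{12} = 4096`. The bound holds for every `e ≤ e₀`, hence for all `m` at once.
  obtain ⟨e₀, he₀, he⟩ := exists_mul_rpow_le (a := τ₁ * 12) (δ := θ / (G * 4096)) hc₁ hc₂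
    (by positivity) (by positivity) hc
  refine ⟨e₀, he₀, fun ε₀ hε₀ hε₀le m n₀ hn₀ _ ε hε => ?_⟩
  set e : ℝ := ε₀ / 2 ^ m with hee
  have he0 : 0 < e := by positivity
  have hele : e ≤ e₀ := (div_le_self hε₀.le (one_le_pow₀ (by norm_num))).trans hε₀le
  obtain ⟨hz, hsmall⟩ := he e he0 hele
  set z : ℝ := c₁ + c₂ * Real.log (2 / e) with hzdef
  have hz1 : 1 ≤ z := (le_max_left _ _).trans hz
  have hz2 : countSum τ₁ / z ≤ γ := by
    have := (le_max_right _ _).trans hz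
    rw [div_le_iff₀ hγ0] at this
    rw [div_le_iff₀ (by linarith)]
    linarith
  have hn₀' : n₀ = ⌈τ₁ * Real.logb 2 z⌉₊ := hn₀
  have hεpos : 0 < ε := lt_of_le_of_lt (by positivity) hε.2.1
  have hεle : ε ≤ e := hε.2.2
  have hsum : ∀ n, ∑ q ∈ Finset.Ico n₀ n, countConst τ₁ q ≤ γ := fun n =>
    (sum_countConst_le hτ₁0 (by linarith) (hn₀' ▸ Nat.le_ceil _) n).trans hz2
  have h64 : ((64 : ℝ) ^ n₀) ^ 2 ≤ 4096 * z ^ (τ₁ * 12) := by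
    have h1 : (2 : ℝ) ^ n₀ ≤ 2 * z ^ τ₁ := hn₀' ▸ two_pow_startScale_le hτ₁0 hz1
    have h2 : ((64 : ℝ) ^ n₀) ^ 2 = ((2 : ℝ) ^ n₀) ^ 12 := by
      rw [show (64 : ℝ) = 2 ^ 6 by norm_num, ← pow_mul, ← pow_mul, ← pow_mul]
      congr 1; ring
    rw [h2, Real.rpow_mul (by linarith)]
    calc ((2 : ℝ) ^ n₀) ^ 12 ≤ (2 * z ^ τ₁) ^ 12 := by gcongr
      _ = _ := by rw [mul_pow, ← Real.rpow_natCast (z ^ τ₁)]; norm_num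
  have hsm : |ε| * G * (64 ^ n₀) ^ 2 ≤ θ := by
    rw [abs_of_pos hεpos]
    calc ε * G * (64 ^ n₀) ^ 2 ≤ e * G * (4096 * z ^ (τ₁ * 12)) := by gcongr
      _ = (e * z ^ (τ₁ * 12)) * (G * 4096) := by ring
      _ ≤ θ / (G * 4096) * (G * 4096) := by gcongr
      _ = θ := by field_simp
  have hT := exists_treeBounds H (η := |ε|) hD hκ0.le hS0 hθ0.le hθ1
    (tsum_ofReal_norm_le hκ₀ hQ) (tsum_ofReal_norm_le hκ₀ hR) (abs_nonneg ε) hsum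
    (le_of_eq (by rw [hγ]; field_simp)) hsm
  have hB := divisorBounds_lag hC₁ hC₁₀ hτ0 hτ₁ hdio hε.1
  have hK := hT.norm_lag_sub_le hB hψ hL0 hL hθL
  have hs : SummableTrees H ψ n₀ ε κ := hT.summable_trees ENNReal.ofReal_ne_top hB hψ hL0 hK
  refine ⟨fun n _ x hx => hT.summable_value hB hψ hL0 (fun j _ => hK j) hx,
    fun n _ x => norm_propOf_le hC₁ hψ x, fun k ν _ => summable_renTrees_value hs hεpos.ne' k ν,
    summable_norm_uCoeff hκ0.le hs hεpos.ne', tendstoUniformly_uBar hκ0.le hs hεpos.ne', ?_⟩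
  rw [show H.uBar ψ n₀ ε = _ from funext fun t => uBar_eq_tsum hκ0.le hs hεpos.ne' t]
  exact analyticOnNhd_tsum_exp (f := fun p : ℕ × Mode A => H.freq p.2) hκ0
    (by positivity) (fun p => p.2.l1_nonneg) (fun p => H.abs_freq_le p.2)
    (summable_uCoeff_mul_exp hs hεpos.ne')

end
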